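/- **Lemma 3.1 (lem:rings).** For a polynomial $f(z)=f_0+f_1z+\dots+f_dz^d\in\mathbb C[z]$ and $0\le \ell\le u\le d$ write $f_{\ell,u}(z)=f_\ell+f_{\ell+1}z+\dots+f_uz^{u-\ell}$ and $\hat f(x)=\max_{0\le j\le d}|f_j|x^j$ for $x\ge 0$. There are an algorithm and constants $C,k$ with the following property. Let $d,m,\tau$ be positive integers and let $f$ be a polynomial of degree exactly $d$ whose coefficients are complex floating-point numbers with $m$-bit mantissas and magnitudes bounded by $2^\tau$: the real part and the imaginary part of each coefficient are given in the form $a2^e$ with integers $a,e$, $|a|<2^m$, where either $a=e=0$ or $2^{-\tau}\le|a2^e|<2^\tau$. Given $m$, $d$ and the coefficients of $f$, the algorithm uses at most $C\,B\,(1+\log B)^k$ bit operations, where $B=d(m+\log\tau)$ (that is, $\widetilde O(d(m+\log\tau))$ bit operations), and computes, for some $N\geq 1$, radii $$0=r_0<r_1<\dots<r_{N-1}<r_N=+\infty ,$$ the finite ones as floating-point numbers, index pairs $(\ell_n,u_n)$ with $0\le\ell_n\le u_n\le d$, and the lists of coefficients of the polynomials $f_{\ell_n,u_n}$ ($0\le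 n<N$), such that, with $\delta_n=u_n-\ell_n$: (i) $2^{m/2}\,r_n^{\delta_n}\le r_{n+1}^{\delta_n}\le 2^m\,r_n^{\delta_n}$ for every $n$ with $\delta_n\ge1$; (ii) $\sum_{n=0}^{N-1}(\delta_n+1)\le 65d+1$; (iii) $|f(z)-z^{\ell_n}f_{\ell_n,u_n}(z)|\le(d-\delta_n)\,2^{-m}\,\hat f(|z|)$ for every $n$ and every $z\in\mathbb C$ with $r_n\le|z|\le r_{n+1}$. Bit operations are counted on a random access machine with integer registers and arrays, in which every instruction is charged the bit lengths of its operands (for array accesses including the address, and for left shifts also the shift distance), and a product or an integer quotient the product of the two bit lengths. -/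

import Mathlib

open scoped ENNReal

namespace RingLemma

/-! ### Machine model: a RAM in which every instruction is charged its bit cost -/

/-- Bit length of an integer, including a sign bit. -/
def len (a : ℤ) : ℕ := Nat.size a.natAbs + 1

/-- A state: integer registers, integer arrays (the first argument is the name of the array), the
part of the input that is still to be read, and the output that has been written so far. -/
structure State where
  reg : ℕ → ℤ
  arr : ℕ → ℤ → ℤ
  inp : List ℤ
  out : List ℤ

/-- The initial state on a given input: all registers and arrays hold `0`. -/
def State.init (input : List ℤ) : State := ⟨fun _ => 0, fun _ _ => 0, input, []⟩

/-- `s.set x v` is the state `s` after the assignment `x := v` to the register `x`. -/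
def State.set (s : State) (x : ℕ) (v : ℤ) : State :=
  { s with reg := Function.update s.reg x v }

/-- Elementary instructions; `x y z` are names of registers and `a` is the name of an array. -/
inductive Instr where
  | const (x : ℕ) (v : ℤ)
  | add (x y z : ℕ)
  | sub (x y z : ℕ)
  | mul (x y z : ℕ)
  | div (x y z : ℕ)
  | shl (x y z : ℕ)
  | shr (x y z : ℕ)
  | size (x y : ℕ)
  | load (x a y : ℕ)
  | store (a y x : ℕ)
  | read (x : ℕ)
  | write (x : ℕ)

/-- The effect of an instruction. `div` is the integer quotient of division with remainder (`0` if
the divisor is `0`), shifts by a negative amount do nothing, and reading past the end of the input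
gives `0`. -/
def Instr.eval (s : State) : Instr → State
  | .const x v => s.set x v
  | .add x y z => s.set x (s.reg y + s.reg z)
  | .sub x y z => s.set x (s.reg y - s.reg z)
  | .mul x y z => s.set x (s.reg y * s.reg z)
  | .div x y z => s.set x (s.reg y / s.reg z)
  | .shl x y z => s.set x (s.reg y * 2 ^ (s.reg z).toNat)
  | .shr x y z => s.set x (s.reg y / 2 ^ (s.reg z).toNat)
  | .size x y => s.set x (Nat.size (s.reg y).natAbs)
  | .load x a y => s.set x (s.arr a (s.reg y))
  | .store a y x =>
      { s with arr := Function.update s.arr a (Function.update (s.arr a) (s.reg y) (s.reg x)) }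
  | .read x => { s.set x (s.inp.headD 0) with inp := s.inp.tail }
  | .write x => { s with out := s.out ++ [s.reg x] }

/-- The number of bit operations charged for an instruction: linear in the lengths of operands and
result for additions, shifts, comparisons and transfers, the length of the address being charged
as well as that of the data; the cost of the schoolbook method for products and quotients. -/
def Instr.cost (s : State) : Instr → ℕ
  | .const _ v => len v
  | .add _ y z => len (s.reg y) + len (s.reg z)
  | .sub _ y z => len (s.reg y) + len (s.reg z)
  | .mul _ y z => len (s.reg y) * len (s.reg z)
  | .div _ y z => len (s.reg y) * len (s.reg z)
  | .shl _ y z => len (s.reg y) + (s.reg z).toNat + len (s.reg z)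
  | .shr _ y z => len (s.reg y) + len (s.reg z)
  | .size _ y => len (s.reg y)
  | .load _ a y => len (s.reg y) + len (s.arr a (s.reg y))
  | .store _ y x => len (s.reg y) + len (s.reg x)
  | .read _ => len (s.inp.headD 0)
  | .write x => len (s.reg x)

/-- Programs: finite compositions of instructions, branching and looping on the sign of a
register. -/
inductive Prog where
  | instr (i : Instr)
  | seq (p q : Prog)
  | ifPos (x : ℕ) (p q : Prog)
  | whilePos (x : ℕ) (p : Prog)

/-- `Exec p s t s'`: the program `p`, started in the state `s`, halts in the state `s'` after
exactly `t` bit operations. -/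
inductive Exec : Prog → State → ℕ → State → Prop where
  | instr (i : Instr) (s : State) : Exec (.instr i) s (i.cost s) (i.eval s)
  | seq {p q : Prog} {s₁ s₂ s₃ : State} {t₁ t₂ : ℕ} :
      Exec p s₁ t₁ s₂ → Exec q s₂ t₂ s₃ → Exec (.seq p q) s₁ (t₁ + t₂) s₃
  | ifTrue {x : ℕ} {p q : Prog} {s s' : State} {t : ℕ} :
      0 < s.reg x → Exec p s t s' → Exec (.ifPos x p q) s (len (s.reg x) + t) s'
  | ifFalse {x : ℕ} {p q : Prog} {s s' : State} {t : ℕ} :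
      s.reg x ≤ 0 → Exec q s t s' → Exec (.ifPos x p q) s (len (s.reg x) + t) s'
  | whileTrue {x : ℕ} {p : Prog} {s₁ s₂ s₃ : State} {t₁ t₂ : ℕ} :
      0 < s₁.reg x → Exec p s₁ t₁ s₂ → Exec (.whilePos x p) s₂ t₂ s₃ →
      Exec (.whilePos x p) s₁ (len (s₁.reg x) + t₁ + t₂) s₃
  | whileFalse {x : ℕ} {p : Prog} {s : State} :
      s.reg x ≤ 0 → Exec (.whilePos x p) s (len (s.reg x)) s

/-- On the given input the program halts after exactly `t` bit operations, having written the
given output. (Programs are deterministic, so `t` and `output` are unique.) -/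
def Computes (p : Prog) (input : List ℤ) (t : ℕ) (output : List ℤ) : Prop :=
  ∃ s : State, Exec p (State.init input) t s ∧ s.out = output

/-! ### Floating-point numbers -/

/-- The floating-point number `man * 2 ^ exp`. -/
structure Float2 where
  man : ℤ
  exp : ℤ

noncomputable def Float2.val (x : Float2) : ℝ := (x.man : ℝ) * (2 : ℝ) ^ x.exp

/-- `x` has an `m`-bit mantissa and it is either zero (represented with exponent `0`) or of
magnitude between `2 ^ (-τ)` and `2 ^ τ`. -/
def Float2.Valid (m τ : ℕ) (x : Float2) : Prop :=
  |x.man| < 2 ^ m ∧ (x.man = 0 → x.exp = 0) ∧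
    (x.man ≠ 0 → (2 : ℝ) ^ (-(τ : ℤ)) ≤ |x.val| ∧ |x.val| < (2 : ℝ) ^ τ)

/-- A complex floating-point number: a pair of real ones. -/
structure CFloat where
  re : Float2
  im : Float2

noncomputable def CFloat.val (x : CFloat) : ℂ := ⟨x.re.val, x.im.val⟩

def CFloat.Valid (m τ : ℕ) (x : CFloat) : Prop := x.re.Valid m τ ∧ x.im.Valid m τ

def Float2.encode (x : Float2) : List ℤ := [x.man, x.exp]

def CFloat.encode (x : CFloat) : List ℤ := x.re.encode ++ x.im.encode

/-! ### Polynomials -/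

/-- `fHat f x` is the maximum of `|f_j| * x ^ j` over `0 ≤ j ≤ deg f`. -/
noncomputable def fHat (f : Polynomial ℂ) (x : ℝ) : ℝ :=
  (Finset.range (f.natDegree + 1)).sup' Finset.nonempty_range_add_one
    (fun j => ‖f.coeff j‖ * x ^ j)

/-- `slice f l u` is the polynomial `f_l + f_{l+1} z + ... + f_u z ^ (u - l)`. -/
noncomputable def slice (f : Polynomial ℂ) (l u : ℕ) : Polynomial ℂ :=
  ∑ j ∈ Finset.Icc l u, Polynomial.C (f.coeff j) * Polynomial.X ^ (j - l)

/-- Input: `m`, the degree `d`, and the coefficients in the order of increasing degree. -/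
def encodeInput (m d : ℕ) (c : List CFloat) : List ℤ :=
  [(m : ℤ), (d : ℤ)] ++ c.flatMap CFloat.encode

/-! ### Rings and extracted polynomials -/

/-- The data computed for one ring: the inner radius of the ring, the pair of indices, and the list
of coefficients of the extracted polynomial. -/
structure Piece where
  inner : Float2
  lower : ℕ
  upper : ℕ
  coeffs : List CFloat

def Piece.delta (p : Piece) : ℕ := p.upper - p.lower

def Piece.encode (p : Piece) : List ℤ :=
  p.inner.encode ++ [(p.lower : ℤ), (p.upper : ℤ)] ++ p.coeffs.flatMap CFloat.encode

def encodeOutput (P : List Piece) : List ℤ := P.flatMap Piece.encode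

/-- The radii `r_0, ..., r_N`: for `n < N` the radius `r_n` is the inner radius of the ring number
`n`, and `r_N = ∞`. -/
noncomputable def radius (P : List Piece) (n : ℕ) : ℝ≥0∞ :=
  if h : n < P.length then ENNReal.ofReal P[n].inner.val else ⊤

/-- The rings between consecutive radii `0 = r_0 < r_1 < ... < r_N = ∞` partition the plane, and the
pieces carry the polynomials that are extracted from the polynomial of degree `d` with the given
coefficients `c`. -/
structure IsRingPartition (d : ℕ) (c : List CFloat) (P : List Piece) : Prop where
  inner_nonneg : ∀ p ∈ P, 0 ≤ p.inner.val
  radius_zero : radius P 0 = 0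
  radius_lt : ∀ n < P.length, radius P n < radius P (n + 1)
  lower_le_upper : ∀ p ∈ P, p.lower ≤ p.upper
  upper_le : ∀ p ∈ P, p.upper ≤ d
  coeffs_eq : ∀ p ∈ P, p.coeffs = (c.drop p.lower).take (p.delta + 1)

end RingLemma

namespace RingLemma

/-! ### Lengths of integers -/

/-! Take the upper hull of the points (j, log₂|f_j|) with f_j ≠ 0. For b < i ≤ d, where b is the
lowest index of a nonzero coefficient, let σ_i be the negated slope of the hull edge over the step
from i - 1 to i; this sequence is nondecreasing. At |z| = 2^t the hull terms grow with i exactly as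
long as σ_i ≤ t. So the hull term j lies below the largest hull term of higher index by `gSum` =
Σ_{i>j} max(t - σ_i, 0), and below the largest one of lower index by `hSum` = Σ_{i≤j} max(σ_i - t,
0). The first sum increases with t and the second decreases. With a threshold M slightly above m,
`gSum` ≥ M at t makes term j negligible at all radii from 2^t outwards (`term_le_of_gSum`), and
`hSum` ≥ M at t makes it negligible at all radii up to 2^t (`term_le_of_hSum`). A ring from t to t'
may therefore use the indices from l to u if every j < l passes the first test at t and every j > u
passes the second at t'. At most d - δ terms are then dropped, which gives (iii).

The rings are found by a greedy sweep. At t, let l be the least index not yet dismissed by the first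
test, and let the entry time e(j) be the last grid point with `hSum` at j at least M. If t < e(l+1),
a ring with δ = 0 reaches to e(l+1). Otherwise δ is the least positive number with (e(l+δ+1) - t)δ ≥
c, where c is slightly below m, and the ring reaches to t + c/δ: no index above l + δ has entered by
then, and δ(t' - t) is about c, which gives (i). The first ring, with indices (b, b), starts at
radius zero, and the last, with indices (d, d), is unbounded.

For (ii), there are at most two rings with δ = 0 more than there are values of l between b and d -
1, the unbounded one included, and this is sharpened by one where needed. The other rings are paid
for by a potential: the sum of the `hSum` and of the negated `gSum` over all j, both capped at T = M
+ 2c + d and shifted to be nonnegative. It is at most 2T(d - b) and never increases. Crossing a ring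
of width h lowers it by at least hδ(δ+2)/4 (`potential_drop`), since each i in the ring moves many
of these sums at once. As hδ ≥ c - d, the sum of δ + 1 over these rings is at most 8T(d - b)/(c - d)
≤ 64(d - b).

All this is done in integers with unit 1/I. Logarithms of coefficients are known up to one, slopes
are rounded down, and the radii come from a table of I rounded powers of 1 + 1/K with K between 256d
and 512d. The choices M = (m+3)I and c = mI - 8d absorb all errors (`term_le`,
`FineGrid.rad_ratio`).

For the cost, numbers are either small, of length V = O(log d) (up to a constant), or large, of
length W = O(m + log τ + log d). No two large numbers are ever multiplied or divided, so an
instruction costs O(VW). Every loop makes O(d) rounds, the sweep because (ii) bounds its progress. A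
symbolic length analysis, evaluated by `decide`, certifies each loop body; invariants with a
decreasing measure handle the loops (`runs_while`). -/

theorem one_le_len (a : ℤ) : 1 ≤ len a := Nat.le_add_left _ _

theorem len_mono {a b : ℤ} (h : |a| ≤ |b|) : len a ≤ len b := by
  unfold len
  have : a.natAbs ≤ b.natAbs := by zify; exact h
  exact Nat.add_le_add_right (Nat.size_le_size this) 1

theorem len_le_len {a b : ℤ} (h1 : -b ≤ a) (h2 : a ≤ b) : len a ≤ len b :=
  len_mono ((abs_le.2 ⟨h1, h2⟩).trans (le_abs_self b))

theorem len_le_of_natAbs_lt {a : ℤ} {n : ℕ} (h : a.natAbs < 2 ^ n) : len a ≤ n + 1 :=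
  Nat.add_le_add_right (Nat.size_le.2 h) 1

theorem natAbs_lt_two_pow_len (a : ℤ) : a.natAbs < 2 ^ (len a - 1) := by
  simpa [len] using Nat.lt_size_self a.natAbs

theorem len_add_le (a b : ℤ) : len (a + b) ≤ len a + len b := by
  have ha := natAbs_lt_two_pow_len a
  have hb := natAbs_lt_two_pow_len b
  obtain ⟨x, hx⟩ : ∃ x, len a = x + 1 := ⟨_, (Nat.sub_add_cancel (one_le_len a)).symm⟩
  obtain ⟨y, hy⟩ : ∃ y, len b = y + 1 := ⟨_, (Nat.sub_add_cancel (one_le_len b)).symm⟩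
  rw [hx] at ha
  rw [hy] at hb
  simp only [Nat.add_sub_cancel] at ha hb
  have h := len_le_of_natAbs_lt (a := a + b) (n := x + y + 1) (by
    have h1 : (2:ℕ) ^ x ≤ 2 ^ (x + y) := Nat.pow_le_pow_right (by norm_num) (by omega)
    have h2 : (2:ℕ) ^ y ≤ 2 ^ (x + y) := Nat.pow_le_pow_right (by norm_num) (by omega)
    have h3 := Int.natAbs_add_le a b
    rw [pow_succ]
    omega)
  omega

theorem len_neg (a : ℤ) : len (-a) = len a := by simp [len]

theorem len_sub_le (a b : ℤ) : len (a - b) ≤ len a + len b := by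
  rw [sub_eq_add_neg, ← len_neg b]; exact len_add_le _ _

theorem len_mul_le (a b : ℤ) : len (a * b) ≤ len a + len b := by
  have ha := natAbs_lt_two_pow_len a
  have hb := natAbs_lt_two_pow_len b
  have h1 := one_le_len a
  have h2 := one_le_len b
  have h := len_le_of_natAbs_lt (a := a * b) (n := (len a - 1) + (len b - 1)) (by
    rw [Int.natAbs_mul, pow_add]
    exact Nat.mul_lt_mul'' ha hb)
  omega

theorem len_ediv_le (a b : ℤ) : len (a / b) ≤ len a := by
  unfold len
  exact Nat.add_le_add_right (Nat.size_le_size (Int.natAbs_ediv_le_natAbs a b)) 1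

theorem len_size_le (a : ℤ) : len (Nat.size a.natAbs : ℤ) ≤ len a := by
  unfold len
  refine Nat.add_le_add_right (Nat.size_le_size ?_) 1
  simpa using Nat.size_le.2 Nat.lt_two_pow_self

theorem len_natCast_mono {a b : ℕ} (h : a ≤ b) : len (a : ℤ) ≤ len (b : ℤ) :=
  len_mono (by simpa using h)

/-! ### Programs without loops -/

/-- The effect of a program without loops. -/
def run : Prog → State → State
  | .instr i, s => i.eval s
  | .seq p q, s => run q (run p s)
  | .ifPos x p q, s => if 0 < s.reg x then run p s else run q s
  | .whilePos _ _, s => s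

/-- Upper bounds for the lengths of the contents of registers and arrays: `some (p, q)` stands for
the bound `p * V + q * W`, and `none` for an unknown length. -/
structure Bounds where
  reg : ℕ → Option (ℕ × ℕ)
  arr : ℕ → Option (ℕ × ℕ)

def Bounds.setReg (A : Bounds) (x : ℕ) (p : ℕ × ℕ) : Bounds :=
  { A with reg := fun y => if y = x then some p else A.reg y }

/-- After a store nothing is claimed about the array. The loop invariant supplies its bound again at
the start of the next round. -/
def Bounds.forget (A : Bounds) (a : ℕ) : Bounds :=
  { A with arr := fun b => if b = a then none else A.arr b }

def joinBound : Option (ℕ × ℕ) → Option (ℕ × ℕ) → Option (ℕ × ℕ)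
  | some p, some q => some (max p.1 q.1, max p.2 q.2)
  | _, _ => none

def Bounds.join (A B : Bounds) : Bounds :=
  ⟨fun x => joinBound (A.reg x) (B.reg x), fun a => joinBound (A.arr a) (B.arr a)⟩

structure Bounds.Fits (V W : ℕ) (A : Bounds) (s : State) : Prop where
  reg : ∀ x p, A.reg x = some p → len (s.reg x) ≤ p.1 * V + p.2 * W
  arr : ∀ a p, A.arr a = some p → ∀ i, len (s.arr a i) ≤ p.1 * V + p.2 * W
  inp : ∀ v ∈ s.inp, len v ≤ W

/-- Since `V` and `W` are both at most `V * W`, this is the bound in units of `V * W`. -/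
def wt (p : ℕ × ℕ) : ℕ := p.1 + p.2

/-- Bounds for the cost of an instruction (in units of `V * W`) and for the lengths afterwards. -/
def Instr.bounds (A : Bounds) : Instr → Option (ℕ × Bounds)
  | .const x v => some (len v, A.setReg x (len v, 0))
  | .add x y z | .sub x y z =>
      match A.reg y, A.reg z with
      | some p, some q => some (wt p + wt q, A.setReg x (p.1 + q.1, p.2 + q.2))
      | _, _ => none
  | .mul x y z =>
      match A.reg y, A.reg z with
      | some p, some q => if p.2 = 0 ∨ q.2 = 0 then
          some (wt p * wt q, A.setReg x (p.1 + q.1, p.2 + q.2)) else none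
      | _, _ => none
  | .div x y z =>
      match A.reg y, A.reg z with
      | some p, some q => if p.2 = 0 ∨ q.2 = 0 then some (wt p * wt q, A.setReg x p) else none
      | _, _ => none
  | .shl _ _ _ => none
  | .shr _ _ _ => none
  | .size x y =>
      match A.reg y with
      | some p => some (wt p, A.setReg x p)
      | none => none
  | .load x a y =>
      match A.arr a, A.reg y with
      | some p, some q => some (wt p + wt q, A.setReg x p)
      | _, _ => none
  | .store a y x =>
      match A.reg y, A.reg x with
      | some p, some q => some (wt p + wt q, A.forget a)
      | _, _ => none
  | .read x => some (1, A.setReg x (0, 1))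
  | .write x =>
      match A.reg x with
      | some p => some (wt p, A)
      | none => none

/-- The failure value `none` marks everything outside the analysis: loops, shifts, operands of
unknown length, and products or quotients of two large numbers. -/
def Prog.bounds : Prog → Bounds → Option (ℕ × Bounds)
  | .instr i, A => i.bounds A
  | .seq p q, A =>
      match p.bounds A with
      | some (c, A') =>
          match q.bounds A' with
          | some (c', A'') => some (c + c', A'')
          | none => none
      | none => none
  | .ifPos x p q, A =>
      match A.reg x, p.bounds A, q.bounds A with
      | some r, some (c, A'), some (c', A'') => some (wt r + c + c', A'.join A'')
      | _, _, _ => none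
  | .whilePos _ _, _ => none

theorem wt_bound {V W : ℕ} (hV : 1 ≤ V) (hVW : V ≤ W) (p : ℕ × ℕ) :
    p.1 * V + p.2 * W ≤ wt p * (V * W) := by
  have hW : 1 ≤ W := hV.trans hVW
  have h1 : V ≤ V * W := Nat.le_mul_of_pos_right _ hW
  have h2 : W ≤ V * W := Nat.le_mul_of_pos_left _ hV
  unfold wt
  nlinarith [Nat.mul_le_mul_left p.1 h1, Nat.mul_le_mul_left p.2 h2]

/-- One factor is small, so the product of the lengths contains no `W * W`. This is what keeps the
total cost linear in `W`. -/
theorem wt_mul_bound {V W : ℕ} (hVW : V ≤ W) {p q : ℕ × ℕ}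
    (h : p.2 = 0 ∨ q.2 = 0) :
    (p.1 * V + p.2 * W) * (q.1 * V + q.2 * W) ≤ wt p * wt q * (V * W) := by
  have key : ∀ p q : ℕ × ℕ, p.2 = 0 →
      (p.1 * V + p.2 * W) * (q.1 * V + q.2 * W) ≤ wt p * wt q * (V * W) := by
    intro p q hp
    unfold wt
    rw [hp]
    have : q.1 * V + q.2 * W ≤ (q.1 + q.2) * W := by nlinarith [Nat.mul_le_mul_left q.1 hVW]
    calc (p.1 * V + 0 * W) * (q.1 * V + q.2 * W) ≤ (p.1 * V) * ((q.1 + q.2) * W) := by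
          rw [zero_mul, add_zero]; exact Nat.mul_le_mul_left _ this
      _ = _ := by ring
  rcases h with h | h
  · exact key p q h
  · have := key q p h
    rw [mul_comm, mul_comm (wt p)]
    exact this

section sound
variable {V W : ℕ} {A A' : Bounds} {s : State}

theorem Bounds.Fits.setReg (h : A.Fits V W s) {x : ℕ} {v : ℤ} {p : ℕ × ℕ}
    (hv : len v ≤ p.1 * V + p.2 * W) : (A.setReg x p).Fits V W (s.set x v) := by
  refine ⟨fun y q hq => ?_, h.arr, h.inp⟩
  simp only [Bounds.setReg] at hq
  split_ifs at hq with hxy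
  · cases hq; subst hxy; simpa [State.set] using hv
  · simpa [State.set, hxy] using h.reg y q hq

theorem Instr.bounds_sound (hV : 1 ≤ V) (hVW : V ≤ W) (h : A.Fits V W s) (i : Instr) {c : ℕ}
    (hi : i.bounds A = some (c, A')) : i.cost s ≤ c * (V * W) ∧ A'.Fits V W (i.eval s) := by
  have hW : 1 ≤ W := hV.trans hVW
  have hVW1 : 1 ≤ V * W := Nat.mul_pos hV hW
  cases i with
  | const x v =>
    simp only [Instr.bounds, Option.some.injEq, Prod.mk.injEq] at hi
    obtain ⟨rfl, rfl⟩ := hi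
    refine ⟨Nat.le_mul_of_pos_right _ hVW1, h.setReg ?_⟩
    simpa using Nat.le_mul_of_pos_right _ hV
  | add x y z =>
    simp only [Instr.bounds] at hi
    split at hi
    · rename_i p q hp hq
      simp only [Option.some.injEq, Prod.mk.injEq] at hi
      obtain ⟨rfl, rfl⟩ := hi
      have h1 := h.reg _ _ hp
      have h2 := h.reg _ _ hq
      refine ⟨?_, h.setReg ?_⟩
      · have := wt_bound hV hVW p
        have := wt_bound hV hVW q
        simp only [Instr.cost]; rw [add_mul]; omega
      · refine (len_add_le _ _).trans ?_
        simp only [add_mul]; omega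
    · cases hi
  | sub x y z =>
    simp only [Instr.bounds] at hi
    split at hi
    · rename_i p q hp hq
      simp only [Option.some.injEq, Prod.mk.injEq] at hi
      obtain ⟨rfl, rfl⟩ := hi
      have h1 := h.reg _ _ hp
      have h2 := h.reg _ _ hq
      refine ⟨?_, h.setReg ?_⟩
      · have := wt_bound hV hVW p
        have := wt_bound hV hVW q
        simp only [Instr.cost]; rw [add_mul]; omega
      · refine (len_sub_le _ _).trans ?_
        simp only [add_mul]; omega
    · cases hi
  | mul x y z =>
    simp only [Instr.bounds] at hi
    split at hi
    · rename_i p q hp hq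
      split_ifs at hi with hpq
      simp only [Option.some.injEq, Prod.mk.injEq] at hi
      obtain ⟨rfl, rfl⟩ := hi
      have h1 := h.reg _ _ hp
      have h2 := h.reg _ _ hq
      refine ⟨(Nat.mul_le_mul h1 h2).trans (wt_mul_bound hVW hpq), h.setReg ?_⟩
      refine (len_mul_le _ _).trans ?_
      simp only [add_mul]; omega
    · cases hi
  | div x y z =>
    simp only [Instr.bounds] at hi
    split at hi
    · rename_i p q hp hq
      split_ifs at hi with hpq
      simp only [Option.some.injEq, Prod.mk.injEq] at hi
      obtain ⟨rfl, rfl⟩ := hi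
      have h1 := h.reg _ _ hp
      have h2 := h.reg _ _ hq
      exact ⟨(Nat.mul_le_mul h1 h2).trans (wt_mul_bound hVW hpq),
        h.setReg ((len_ediv_le _ _).trans h1)⟩
    · cases hi
  | shl x y z => cases hi
  | shr x y z => cases hi
  | size x y =>
    simp only [Instr.bounds] at hi
    split at hi
    · rename_i p hp
      simp only [Option.some.injEq, Prod.mk.injEq] at hi
      obtain ⟨rfl, rfl⟩ := hi
      have h1 := h.reg _ _ hp
      exact ⟨h1.trans (wt_bound hV hVW p), h.setReg ((len_size_le _).trans h1)⟩
    · cases hi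
  | load x a y =>
    simp only [Instr.bounds] at hi
    split at hi
    · rename_i p q hp hq
      simp only [Option.some.injEq, Prod.mk.injEq] at hi
      obtain ⟨rfl, rfl⟩ := hi
      have h1 := h.arr _ _ hp (s.reg y)
      have h2 := h.reg _ _ hq
      refine ⟨?_, h.setReg h1⟩
      have := wt_bound hV hVW p
      have := wt_bound hV hVW q
      simp only [Instr.cost]; rw [add_mul]; omega
    · cases hi
  | store a y x =>
    simp only [Instr.bounds] at hi
    split at hi
    · rename_i p q hp hq
      simp only [Option.some.injEq, Prod.mk.injEq] at hi
      obtain ⟨rfl, rfl⟩ := hi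
      have h1 := h.reg _ _ hp
      have h2 := h.reg _ _ hq
      refine ⟨?_, h.reg, fun b r hr i => ?_, h.inp⟩
      · have := wt_bound hV hVW p
        have := wt_bound hV hVW q
        simp only [Instr.cost]; rw [add_mul]; omega
      · simp only [Bounds.forget] at hr
        split_ifs at hr with hb
        simpa [Instr.eval, hb] using h.arr b r hr i
    · cases hi
  | read x =>
    simp only [Instr.bounds, Option.some.injEq, Prod.mk.injEq] at hi
    obtain ⟨rfl, rfl⟩ := hi
    have h1 : len (s.inp.headD 0) ≤ W := by
      rcases hl : s.inp with _ | ⟨v, l⟩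
      · simpa [len] using hW
      · simpa using h.inp v (by simp [hl])
    have h2 : (A.setReg x (0, 1)).Fits V W (s.set x (s.inp.headD 0)) := h.setReg (by simpa using h1)
    refine ⟨?_, h2.reg, h2.arr, fun v hv => h.inp v (List.mem_of_mem_tail hv)⟩
    have : W ≤ V * W := Nat.le_mul_of_pos_left _ hV
    simp only [Instr.cost]; omega
  | write x =>
    simp only [Instr.bounds] at hi
    split at hi
    · rename_i p hp
      simp only [Option.some.injEq, Prod.mk.injEq] at hi
      obtain ⟨rfl, rfl⟩ := hi
      exact ⟨(h.reg _ _ hp).trans (wt_bound hV hVW p), h.reg, h.arr, h.inp⟩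
    · cases hi

theorem joinBound_left {V W n : ℕ} {a b : Option (ℕ × ℕ)} {p : ℕ × ℕ} (h : joinBound a b = some p)
    (ha : ∀ q, a = some q → n ≤ q.1 * V + q.2 * W) : n ≤ p.1 * V + p.2 * W := by
  unfold joinBound at h
  split at h
  · rename_i q r
    cases h
    have := ha q rfl
    have := Nat.mul_le_mul_right V (le_max_left q.1 r.1)
    have := Nat.mul_le_mul_right W (le_max_left q.2 r.2)
    dsimp only
    omega
  · cases h

theorem joinBound_comm (a b : Option (ℕ × ℕ)) : joinBound a b = joinBound b a := by
  cases a <;> cases b <;> simp [joinBound, max_comm]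

theorem Bounds.Fits.join_left (h : A.Fits V W s) (B : Bounds) : (A.join B).Fits V W s :=
  ⟨fun x _ hp => joinBound_left hp (h.reg x),
    fun a _ hp i => joinBound_left hp fun q hq => h.arr a q hq i, h.inp⟩

theorem Bounds.Fits.join_right (h : A.Fits V W s) (B : Bounds) : (B.join A).Fits V W s := by
  have : B.join A = A.join B := by simp [Bounds.join, joinBound_comm]
  rw [this]; exact h.join_left B

/-- `Runs p s T s'`: started in `s`, the program `p` halts in `s'` after at most `T` steps. -/
def Runs (p : Prog) (s : State) (T : ℕ) (s' : State) : Prop := ∃ t ≤ T, Exec p s t s'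

theorem Runs.seq {p q : Prog} {s₁ s₂ s₃ : State} {T₁ T₂ : ℕ} (h₁ : Runs p s₁ T₁ s₂)
    (h₂ : Runs q s₂ T₂ s₃) : Runs (.seq p q) s₁ (T₁ + T₂) s₃ := by
  obtain ⟨t₁, h₁, e₁⟩ := h₁
  obtain ⟨t₂, h₂, e₂⟩ := h₂
  exact ⟨_, Nat.add_le_add h₁ h₂, e₁.seq e₂⟩

theorem Runs.mono {p : Prog} {s s' : State} {T T' : ℕ} (h : Runs p s T s') (hT : T ≤ T') :
    Runs p s T' s' := by
  obtain ⟨t, ht, e⟩ := h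
  exact ⟨t, ht.trans hT, e⟩

theorem Prog.bounds_sound (hV : 1 ≤ V) (hVW : V ≤ W) (p : Prog) : ∀ {A A' : Bounds} {s : State}
    {c : ℕ}, A.Fits V W s → p.bounds A = some (c, A') →
    Runs p s (c * (V * W)) (run p s) ∧ A'.Fits V W (run p s) := by
  induction p with
  | instr i =>
    intro A A' s c h hp
    obtain ⟨h1, h2⟩ := Instr.bounds_sound hV hVW h i hp
    exact ⟨⟨_, h1, Exec.instr i s⟩, h2⟩
  | seq p q ihp ihq =>
    intro A A' s c h hp
    simp only [Prog.bounds] at hp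
    split at hp
    · rename_i c1 A1 h1
      split at hp
      · rename_i c2 A2 h2
        simp only [Option.some.injEq, Prod.mk.injEq] at hp
        obtain ⟨rfl, rfl⟩ := hp
        obtain ⟨r1, f1⟩ := ihp h h1
        obtain ⟨r2, f2⟩ := ihq f1 h2
        exact ⟨by rw [add_mul]; exact r1.seq r2, f2⟩
      · cases hp
    · cases hp
  | ifPos x p q ihp ihq =>
    intro A A' s c h hp
    simp only [Prog.bounds] at hp
    split at hp
    · rename_i r c1 A1 c2 A2 hr h1 h2
      simp only [Option.some.injEq, Prod.mk.injEq] at hp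
      obtain ⟨rfl, rfl⟩ := hp
      have hx := (h.reg _ _ hr).trans (wt_bound hV hVW r)
      by_cases hpos : 0 < s.reg x
      · obtain ⟨⟨t, ht, e⟩, f1⟩ := ihp h h1
        simp only [run, if_pos hpos]
        refine ⟨⟨_, ?_, Exec.ifTrue hpos e⟩, f1.join_left _⟩
        simp only [add_mul]; omega
      · obtain ⟨⟨t, ht, e⟩, f1⟩ := ihq h h2
        simp only [run, if_neg hpos]
        refine ⟨⟨_, ?_, Exec.ifFalse (not_lt.1 hpos) e⟩, f1.join_right _⟩
        simp only [add_mul]; omega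
    · cases hp
  | whilePos x p _ => intro A A' s c h hp; cases hp

end sound

/-! ### Loops: cost from an invariant and a decreasing measure -/

/-- The bounds with small registers `S`, large registers `L`, small arrays `SA` and large arrays
`LA`. -/
def Bounds.mk' (S L SA LA : List ℕ) : Bounds :=
  ⟨fun x => if x ∈ S then some (1, 0) else if x ∈ L then some (0, 1) else none,
    fun a => if a ∈ SA then some (1, 0) else if a ∈ LA then some (0, 1) else none⟩

theorem Bounds.fits_mk' {V W : ℕ} {S L SA LA : List ℕ} {s : State}
    (h1 : ∀ x ∈ S, len (s.reg x) ≤ V) (h2 : ∀ x ∈ L, len (s.reg x) ≤ W)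
    (h3 : ∀ a ∈ SA, ∀ i, len (s.arr a i) ≤ V) (h4 : ∀ a ∈ LA, ∀ i, len (s.arr a i) ≤ W)
    (h5 : ∀ v ∈ s.inp, len v ≤ W) : (Bounds.mk' S L SA LA).Fits V W s := by
  refine ⟨fun x p hp => ?_, fun a p hp i => ?_, h5⟩
  · simp only [Bounds.mk'] at hp
    split_ifs at hp with ha hb
    · cases hp; simpa using h1 x ha
    · cases hp; simpa using h2 x hb
  · simp only [Bounds.mk'] at hp
    split_ifs at hp with ha hb
    · cases hp; simpa using h3 a ha i
    · cases hp; simpa using h4 a hb i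

/-- The cost of a program without loops in units of `V * W`. -/
def Prog.weight (p : Prog) (A : Bounds) : ℕ := ((p.bounds A).map Prod.fst).getD 0

theorem runs_of_fits {V W : ℕ} (hV : 1 ≤ V) (hVW : V ≤ W) {p : Prog} {A : Bounds} {s : State}
    (h : A.Fits V W s) (hp : (p.bounds A).isSome = true) :
    Runs p s (p.weight A * (V * W)) (run p s) := by
  obtain ⟨⟨c, A'⟩, hc⟩ := Option.isSome_iff_exists.1 hp
  have := (p.bounds_sound hV hVW h hc).1
  simpa [Prog.weight, hc] using this

/-- The cost of one round of a loop in units of `V * W`. -/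
def loopWeight (x : ℕ) (p : Prog) (A : Bounds) : ℕ := p.weight A + ((A.reg x).map wt).getD 0

/-- The natural number in `Inv` is the measure. The invariant gives the length bounds `A` anew in
every round, so all rounds have the same certified cost; the extra unit in `n + 1` pays for the
failing test. -/
theorem runs_while {V W : ℕ} (hV : 1 ≤ V) (hVW : V ≤ W) {x : ℕ} {p : Prog} {A : Bounds}
    (hp : (p.bounds A).isSome = true) (hx : (A.reg x).isSome = true) {Inv : ℕ → State → Prop}
    (hfit : ∀ n s, Inv n s → A.Fits V W s)
    (hstep : ∀ n s, Inv n s → 0 < s.reg x → ∃ n' < n, Inv n' (run p s)) :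
    ∀ n s, Inv n s → ∃ s', Runs (.whilePos x p) s ((n + 1) * (loopWeight x p A * (V * W))) s' ∧
      s'.reg x ≤ 0 ∧ ∃ n', Inv n' s' := by
  obtain ⟨r, hr⟩ := Option.isSome_iff_exists.1 hx
  have hlen : ∀ n s, Inv n s → len (s.reg x) ≤ wt r * (V * W) := fun n s h =>
    ((hfit n s h).reg _ _ hr).trans (wt_bound hV hVW r)
  have hw : loopWeight x p A * (V * W) = p.weight A * (V * W) + wt r * (V * W) := by
    simp [loopWeight, hr, add_mul]
  intro n
  induction n using Nat.strong_induction_on with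
  | _ n ih =>
    intro s hs
    by_cases hpos : 0 < s.reg x
    · obtain ⟨n', hn', h'⟩ := hstep n s hs hpos
      obtain ⟨s', ⟨t, ht, e⟩, hx', hI⟩ := ih n' hn' _ h'
      obtain ⟨t1, ht1, e1⟩ := runs_of_fits hV hVW (hfit n s hs) hp
      refine ⟨s', ⟨_, ?_, Exec.whileTrue hpos e1 e⟩, hx', hI⟩
      have h1 := hlen n s hs
      have h2 : (n' + 1) * (loopWeight x p A * (V * W)) ≤ n * (loopWeight x p A * (V * W)) :=
        Nat.mul_le_mul_right _ hn'
      rw [add_mul, one_mul]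
      omega
    · refine ⟨s, ⟨_, ?_, Exec.whileFalse (not_lt.1 hpos)⟩, not_lt.1 hpos, n, hs⟩
      have h1 := hlen n s hs
      rw [add_mul, one_mul]
      omega

/-! ### What a program leaves unchanged -/

def Instr.outReg : Instr → List ℕ
  | .const x _ | .add x _ _ | .sub x _ _ | .mul x _ _ | .div x _ _ | .shl x _ _ | .shr x _ _
  | .size x _ | .load x _ _ | .read x => [x]
  | .store _ _ _ | .write _ => []

def Instr.outArr : Instr → List ℕ
  | .store a _ _ => [a]
  | _ => []

def Instr.io : Instr → Bool
  | .read _ | .write _ => true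
  | _ => false

def Prog.outReg : Prog → List ℕ
  | .instr i => i.outReg
  | .seq p q | .ifPos _ p q => p.outReg ++ q.outReg
  | .whilePos _ p => p.outReg

def Prog.outArr : Prog → List ℕ
  | .instr i => i.outArr
  | .seq p q | .ifPos _ p q => p.outArr ++ q.outArr
  | .whilePos _ p => p.outArr

def Prog.io : Prog → Bool
  | .instr i => i.io
  | .seq p q | .ifPos _ p q => p.io || q.io
  | .whilePos _ p => p.io

/-- A frame condition: each phase is verified in isolation, and what earlier phases left behind is
carried across it by deciding membership in lists of names. -/
structure SameExcept (R A : List ℕ) (io : Bool) (s s' : State) : Prop where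
  reg : ∀ x, x ∉ R → s'.reg x = s.reg x
  arr : ∀ a, a ∉ A → s'.arr a = s.arr a
  inp : io = false → s'.inp = s.inp
  out : io = false → s'.out = s.out

theorem SameExcept.mono {R R' A A' : List ℕ} {io io' : Bool} {s s' : State}
    (h : SameExcept R A io s s') (hR : R ⊆ R') (hA : A ⊆ A') (hio : io' = false → io = false) :
    SameExcept R' A' io' s s' :=
  ⟨fun x hx => h.reg x fun h' => hx (hR h'), fun a ha => h.arr a fun h' => ha (hA h'),
    fun h' => h.inp (hio h'), fun h' => h.out (hio h')⟩

theorem SameExcept.trans {R A : List ℕ} {io : Bool} {s s' s'' : State}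
    (h : SameExcept R A io s s') (h' : SameExcept R A io s' s'') : SameExcept R A io s s'' :=
  ⟨fun x hx => (h'.reg x hx).trans (h.reg x hx), fun a ha => (h'.arr a ha).trans (h.arr a ha),
    fun e => (h'.inp e).trans (h.inp e), fun e => (h'.out e).trans (h.out e)⟩

theorem Exec.sameExcept {p : Prog} {s s' : State} {t : ℕ} (h : Exec p s t s') :
    SameExcept p.outReg p.outArr p.io s s' := by
  induction h with
  | instr i s =>
    cases i <;> constructor <;>
      simp +contextual [Instr.eval, Instr.outReg, Instr.outArr, Instr.io, Prog.outReg, Prog.outArr,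
        Prog.io, State.set]
  | seq _ _ ih₁ ih₂ =>
    exact (ih₁.mono (List.subset_append_left _ _) (List.subset_append_left _ _)
      (by simp +contextual [Prog.io])).trans (ih₂.mono (List.subset_append_right _ _)
        (List.subset_append_right _ _) (by simp +contextual [Prog.io]))
  | ifTrue _ _ ih =>
    exact ih.mono (List.subset_append_left _ _) (List.subset_append_left _ _)
      (by simp +contextual [Prog.io])
  | ifFalse _ _ ih =>
    exact ih.mono (List.subset_append_right _ _) (List.subset_append_right _ _)
      (by simp +contextual [Prog.io])
  | whileTrue _ _ _ ih₁ ih₂ => exact ih₁.trans ih₂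
  | whileFalse _ => exact ⟨fun _ _ => rfl, fun _ _ => rfl, fun _ => rfl, fun _ => rfl⟩

theorem Runs.sameExcept {p : Prog} {s s' : State} {T : ℕ} (h : Runs p s T s') :
    SameExcept p.outReg p.outArr p.io s s' := by
  obtain ⟨_, _, e⟩ := h
  exact e.sameExcept

theorem run_sameExcept (p : Prog) (s : State) :
    SameExcept p.outReg p.outArr p.io s (run p s) := by
  induction p generalizing s with
  | instr i => exact (Exec.instr i s).sameExcept
  | seq p q ihp ihq =>
    exact ((ihp s).mono (List.subset_append_left _ _) (List.subset_append_left _ _)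
      (by simp +contextual [Prog.io])).trans ((ihq _).mono (List.subset_append_right _ _)
        (List.subset_append_right _ _) (by simp +contextual [Prog.io]))
  | ifPos x p q ihp ihq =>
    rw [run]
    split_ifs
    · exact (ihp s).mono (List.subset_append_left _ _) (List.subset_append_left _ _)
        (by simp +contextual [Prog.io])
    · exact (ihq s).mono (List.subset_append_right _ _) (List.subset_append_right _ _)
        (by simp +contextual [Prog.io])
  | whilePos x p _ => exact ⟨fun _ _ => rfl, fun _ _ => rfl, fun _ => rfl, fun _ => rfl⟩

/-- The output loop writes, so `SameExcept` is silent about its input; this finer test shows that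
the input stays empty. -/
def Instr.noRead : Instr → Bool
  | .read _ => false
  | _ => true

def Prog.noRead : Prog → Bool
  | .instr i => i.noRead
  | .seq p q | .ifPos _ p q => p.noRead && q.noRead
  | .whilePos _ p => p.noRead

theorem run_inp (p : Prog) (hp : p.noRead = true) (s : State) : (run p s).inp = s.inp := by
  induction p generalizing s with
  | instr i => cases i <;> first | rfl | cases hp
  | seq p q ihp ihq =>
    rw [Prog.noRead, Bool.and_eq_true] at hp
    rw [run, ihq hp.2, ihp hp.1]
  | ifPos x p q ihp ihq =>
    rw [Prog.noRead, Bool.and_eq_true] at hp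
    rw [run]
    split_ifs
    exacts [ihp hp.1 s, ihq hp.2 s]
  | whilePos x p _ => rfl

/-- Sequential composition of a nonempty list of programs. -/
def block : Prog → List Prog → Prog
  | p, [] => p
  | p, q :: l => .seq p (block q l)

/-! ### Sums of distances to a sorted sequence -/

open Finset in
/-- The sum of the distances from `t` to those `s i` below `t` with `j < i ≤ d`. -/
def gSum (d : ℕ) (s : ℕ → ℤ) (j : ℕ) (t : ℤ) : ℤ := ∑ i ∈ Ioc j d, max (t - s i) 0

open Finset in
/-- The sum of the distances from `t` to those `s i` above `t` with `b < i ≤ j`. -/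
def hSum (b : ℕ) (s : ℕ → ℤ) (j : ℕ) (t : ℤ) : ℤ := ∑ i ∈ Ioc b j, max (s i - t) 0

open Finset in
-- For the sequence of negated slopes this is the descent of the hull from `b` to `j`.
def pre (b : ℕ) (s : ℕ → ℤ) (j : ℕ) : ℤ := ∑ i ∈ Ioc b j, s i

def SortedOn (b d : ℕ) (s : ℕ → ℤ) : Prop := ∀ i j, b < i → i ≤ j → j ≤ d → s i ≤ s j

theorem pre_self (b : ℕ) (s : ℕ → ℤ) : pre b s b = 0 := by simp [pre]

theorem pre_succ {b j : ℕ} (s : ℕ → ℤ) (h : b ≤ j) : pre b s (j + 1) = pre b s j + s (j + 1) :=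
  Finset.sum_Ioc_succ_top h _

theorem pre_sub {b p j : ℕ} (s : ℕ → ℤ) (h : b ≤ p) (h' : p ≤ j) :
    pre b s j - pre b s p = ∑ i ∈ Finset.Ioc p j, s i := by
  unfold pre
  rw [← Finset.sum_Ioc_consecutive s h h', add_sub_cancel_left]

theorem hSum_nonneg (b : ℕ) (s : ℕ → ℤ) (j : ℕ) (t : ℤ) : 0 ≤ hSum b s j t :=
  Finset.sum_nonneg fun _ _ => le_max_right _ _

theorem gSum_nonneg (d : ℕ) (s : ℕ → ℤ) (j : ℕ) (t : ℤ) : 0 ≤ gSum d s j t :=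
  Finset.sum_nonneg fun _ _ => le_max_right _ _

theorem hSum_anti {b : ℕ} {s : ℕ → ℤ} {j : ℕ} {t t' : ℤ} (h : t ≤ t') :
    hSum b s j t' ≤ hSum b s j t :=
  Finset.sum_le_sum fun _ _ => max_le_max_right _ (by omega)

theorem gSum_mono {d : ℕ} {s : ℕ → ℤ} {j : ℕ} {t t' : ℤ} (h : t ≤ t') :
    gSum d s j t ≤ gSum d s j t' :=
  Finset.sum_le_sum fun _ _ => max_le_max_right _ (by omega)

theorem hSum_mono_index {b : ℕ} {s : ℕ → ℤ} {j j' : ℕ} (h : j ≤ j') (t : ℤ) :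
    hSum b s j t ≤ hSum b s j' t :=
  Finset.sum_le_sum_of_subset_of_nonneg (Finset.Ioc_subset_Ioc_right h)
    fun _ _ _ => le_max_right _ _

theorem gSum_anti_index {d : ℕ} {s : ℕ → ℤ} {j j' : ℕ} (h : j ≤ j') (t : ℤ) :
    gSum d s j' t ≤ gSum d s j t :=
  Finset.sum_le_sum_of_subset_of_nonneg (Finset.Ioc_subset_Ioc_left h)
    fun _ _ _ => le_max_right _ _

/-- For a sorted sequence one index `p` separates the terms up to `t` from those above, so that
`hSum` is affine in `t` with coefficients read off the partial sums. `gSum_eq` is the mirror image.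
-/
theorem hSum_eq {b p j : ℕ} {s : ℕ → ℤ} {t : ℤ} (hbp : b ≤ p) (hpj : p ≤ j)
    (h1 : ∀ i, b < i → i ≤ p → s i ≤ t) (h2 : ∀ i, p < i → i ≤ j → t ≤ s i) :
    hSum b s j t = pre b s j - pre b s p - ((j : ℤ) - p) * t := by
  unfold hSum
  rw [← Finset.sum_Ioc_consecutive _ hbp hpj, pre_sub s hbp hpj,
    Finset.sum_eq_zero (s := Finset.Ioc b p), zero_add]
  · rw [Finset.sum_congr rfl (g := fun i => s i - t)]
    · rw [Finset.sum_sub_distrib, Finset.sum_const, Nat.card_Ioc, nsmul_eq_mul, Nat.cast_sub hpj]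
    · intro i hi
      rw [Finset.mem_Ioc] at hi
      exact max_eq_left (by linarith [h2 i hi.1 hi.2])
  · intro i hi
    rw [Finset.mem_Ioc] at hi
    exact max_eq_right (by linarith [h1 i hi.1 hi.2])

theorem gSum_eq {b j k d : ℕ} {s : ℕ → ℤ} {t : ℤ} (hbj : b ≤ j) (hjk : j ≤ k) (hkd : k ≤ d)
    (h1 : ∀ i, j < i → i ≤ k → s i ≤ t) (h2 : ∀ i, k < i → i ≤ d → t ≤ s i) :
    gSum d s j t = ((k : ℤ) - j) * t - (pre b s k - pre b s j) := by
  unfold gSum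
  rw [← Finset.sum_Ioc_consecutive _ hjk hkd, pre_sub s hbj hjk,
    Finset.sum_eq_zero (s := Finset.Ioc k d), add_zero]
  · rw [Finset.sum_congr rfl (g := fun i => t - s i)]
    · rw [Finset.sum_sub_distrib, Finset.sum_const, Nat.card_Ioc, nsmul_eq_mul, Nat.cast_sub hjk]
    · intro i hi
      rw [Finset.mem_Ioc] at hi
      exact max_eq_left (by linarith [h1 i hi.1 hi.2])
  · intro i hi
    rw [Finset.mem_Ioc] at hi
    exact max_eq_right (by linarith [h2 i hi.1 hi.2])

/-- `e` is the last integer with `M ≤ hSum b s j e`. -/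
def IsEntry (b : ℕ) (s : ℕ → ℤ) (M : ℤ) (j : ℕ) (e : ℤ) : Prop :=
  M ≤ hSum b s j e ∧ hSum b s j (e + 1) < M

/-- At both `t` and `t + 1` exactly the indices above `p` contribute, so the same affine formula
holds at both, and the rounded quotient is the last integer where it is at least `M`. -/
theorem isEntry_of_ediv {b d p j : ℕ} {s : ℕ → ℤ} {M t : ℤ} (hs : SortedOn b d s) (hbp : b ≤ p)
    (hpj : p < j) (hjd : j ≤ d) (ht : t = (pre b s j - pre b s p - M) / ((j : ℤ) - p))
    (h1 : t < s (p + 1)) (h2 : b < p → s p ≤ t) : IsEntry b s M j t := by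
  have hpos : (0 : ℤ) < (j : ℤ) - p := by omega
  have hA := Int.mul_ediv_self_le (x := pre b s j - pre b s p - M) (k := (j : ℤ) - p) hpos.ne'
  have hB := Int.lt_mul_ediv_self_add (x := pre b s j - pre b s p - M) (k := (j : ℤ) - p) hpos
  rw [← ht] at hA hB
  have hlow : ∀ i, b < i → i ≤ p → s i ≤ t := fun i hi hip =>
    (hs i p hi hip (by omega)).trans (h2 (by omega))
  have hup : ∀ i, p < i → i ≤ j → t + 1 ≤ s i := fun i hi hij =>
    Int.add_one_le_iff.2 (h1.trans_le (hs (p + 1) i (by omega) hi (by omega)))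
  constructor
  · rw [hSum_eq hbp hpj.le hlow fun i a c => by linarith [hup i a c]]
    linarith
  · rw [hSum_eq hbp hpj.le (fun i a c => by linarith [hlow i a c]) hup]
    linarith

theorem IsEntry.lt {b d j : ℕ} {s : ℕ → ℤ} {M e : ℤ} (hs : SortedOn b d s) (hM : 0 < M)
    (hjd : j ≤ d) (h : IsEntry b s M j e) : e < s j := by
  by_contra! hcon
  have : hSum b s j e = 0 := Finset.sum_eq_zero fun i hi => by
    rw [Finset.mem_Ioc] at hi
    exact max_eq_right (by linarith [hs i j hi.1 hi.2 hjd])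
  linarith [h.1]

/-! ### The potential -/

/-- Removing the two outer terms, both equal to one, lowers every other term by one. Hence the
induction in steps of two. -/
theorem four_mul_sum_min (n : ℕ) :
    n * (n + 2) ≤ 4 * ∑ p ∈ Finset.range n, min (p + 1) (n - p) := by
  induction n using Nat.strong_induction_on with
  | _ n ih =>
    match n with
    | 0 => simp
    | 1 => simp
    | n + 2 =>
      have h := ih n (by omega)
      rw [Finset.sum_range_succ, Finset.sum_range_succ']
      have : ∑ p ∈ Finset.range n, min (p + 1 + 1) (n + 2 - (p + 1))
          = ∑ p ∈ Finset.range n, min (p + 1) (n - p) + n := by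
        have e : ∀ p ∈ Finset.range n, min (p + 1 + 1) (n + 2 - (p + 1))
            = min (p + 1) (n - p) + 1 := by
          intro p hp
          rw [Finset.mem_range] at hp
          omega
        rw [Finset.sum_congr rfl e, Finset.sum_add_distrib]; simp
      rw [this]
      have h3 : min (0 + 1) (n + 2 - 0) = 1 := by omega
      have h4 : min (n + 1 + 1) (n + 2 - (n + 1)) = 1 := by omega
      rw [h3, h4]
      nlinarith

/-- Exchange the summations: `x i` is counted `i - l` times and `h - x i` is counted `u + 1 - i`
times, so together they weigh at least `h * min (i - l) (u + 1 - i)`. -/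
theorem sum_weighted_ge {l u : ℕ} (hlu : l ≤ u) {x : ℕ → ℤ} {h : ℤ} (hx0 : ∀ i, 0 ≤ x i)
    (hxh : ∀ i, x i ≤ h) (hh : 0 ≤ h) :
    h * (((u : ℤ) - l) * ((u : ℤ) - l + 2)) ≤
      4 * (∑ j ∈ Finset.Ico l u, ∑ i ∈ Finset.Ioc j u, x i +
        ∑ j ∈ Finset.Ioc l u, ∑ i ∈ Finset.Ioc l j, (h - x i)) := by
  have e1 : ∑ j ∈ Finset.Ico l u, ∑ i ∈ Finset.Ioc j u, x i
      = ∑ i ∈ Finset.Ioc l u, ((i : ℤ) - l) * x i := by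
    rw [Finset.sum_comm' (t' := Finset.Ioc l u) (s' := fun i => Finset.Ico l i)]
    · refine Finset.sum_congr rfl fun i hi => ?_
      rw [Finset.mem_Ioc] at hi
      rw [Finset.sum_const, Nat.card_Ico, nsmul_eq_mul, Nat.cast_sub hi.1.le]
    · intro j i
      simp only [Finset.mem_Ico, Finset.mem_Ioc]; omega
  have e2 : ∑ j ∈ Finset.Ioc l u, ∑ i ∈ Finset.Ioc l j, (h - x i)
      = ∑ i ∈ Finset.Ioc l u, ((u : ℤ) + 1 - i) * (h - x i) := by
    rw [Finset.sum_comm' (t' := Finset.Ioc l u) (s' := fun i => Finset.Icc i u)]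
    · refine Finset.sum_congr rfl fun i hi => ?_
      rw [Finset.mem_Ioc] at hi
      rw [Finset.sum_const, Nat.card_Icc, nsmul_eq_mul, Nat.cast_sub (by omega)]
      push_cast; ring
    · intro j i
      simp only [Finset.mem_Icc, Finset.mem_Ioc]; omega
  rw [e1, e2, ← Finset.sum_add_distrib]
  have e3 : h * ∑ i ∈ Finset.Ioc l u, min ((i : ℤ) - l) ((u : ℤ) + 1 - i) ≤
      ∑ i ∈ Finset.Ioc l u, (((i : ℤ) - l) * x i + ((u : ℤ) + 1 - i) * (h - x i)) := by
    rw [Finset.mul_sum]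
    refine Finset.sum_le_sum fun i hi => ?_
    have a1 := mul_le_mul_of_nonneg_right (min_le_left ((i : ℤ) - l) ((u : ℤ) + 1 - i)) (hx0 i)
    have a2 := mul_le_mul_of_nonneg_right (min_le_right ((i : ℤ) - l) ((u : ℤ) + 1 - i))
      (sub_nonneg.2 (hxh i))
    linarith
  have e4 : ∑ i ∈ Finset.Ioc l u, min ((i : ℤ) - l) ((u : ℤ) + 1 - i)
      = ((∑ p ∈ Finset.range (u - l), min (p + 1) (u - l - p) : ℕ) : ℤ) := by
    push_cast
    symm
    refine Finset.sum_bij (fun p _ => l + p + 1) ?_ ?_ ?_ ?_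
    · intro p hp; rw [Finset.mem_range] at hp; rw [Finset.mem_Ioc]; omega
    · intro p _ q _ hpq; omega
    · intro i hi
      rw [Finset.mem_Ioc] at hi
      exact ⟨i - l - 1, Finset.mem_range.2 (by omega), by omega⟩
    · intro p hp; rw [Finset.mem_range] at hp; push_cast; omega
  have e5 := four_mul_sum_min (u - l)
  rw [e4] at e3
  zify at e5
  rw [Nat.cast_sub hlu] at e5
  have := mul_le_mul_of_nonneg_left e5 hh
  push_cast at e3
  nlinarith

open Finset in
/-- The potential that pays for the rings. -/
def potential (b d : ℕ) (s : ℕ → ℤ) (T t : ℤ) : ℤ :=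
  ∑ j ∈ Ico b d, (T - min T (gSum d s j t)) + ∑ j ∈ Ioc b d, min T (hSum b s j t)

theorem potential_nonneg {b d : ℕ} {s : ℕ → ℤ} {T t : ℤ} (hT : 0 ≤ T) :
    0 ≤ potential b d s T t :=
  add_nonneg (Finset.sum_nonneg fun _ _ => sub_nonneg.2 (min_le_left _ _))
    (Finset.sum_nonneg fun _ _ => le_min hT (hSum_nonneg _ _ _ _))

theorem potential_anti {b d : ℕ} {s : ℕ → ℤ} {T t t' : ℤ} (h : t ≤ t') :
    potential b d s T t' ≤ potential b d s T t :=
  add_le_add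
    (Finset.sum_le_sum fun _ _ => sub_le_sub_left (min_le_min_left _ (gSum_mono h)) _)
    (Finset.sum_le_sum fun _ _ => min_le_min_left _ (hSum_anti h))

theorem potential_le {b d : ℕ} {s : ℕ → ℤ} {T t : ℤ} (hbd : b ≤ d) (hT : 0 ≤ T) :
    potential b d s T t ≤ 2 * T * ((d : ℤ) - b) := by
  unfold potential
  have h1 : ∑ j ∈ Finset.Ico b d, (T - min T (gSum d s j t)) ≤ ∑ j ∈ Finset.Ico b d, T :=
    Finset.sum_le_sum fun j _ => by linarith [le_min hT (gSum_nonneg d s j t)]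
  have h2 : ∑ j ∈ Finset.Ioc b d, min T (hSum b s j t) ≤ ∑ j ∈ Finset.Ioc b d, T :=
    Finset.sum_le_sum fun _ _ => min_le_left _ _
  rw [Finset.sum_const, Nat.card_Ico, nsmul_eq_mul, Nat.cast_sub hbd] at h1
  rw [Finset.sum_const, Nat.card_Ioc, nsmul_eq_mul, Nat.cast_sub hbd] at h2
  linarith

/-- Of the width `h`, the part `x i` beyond `s i` raises `gSum` at all `j` from `l` to `i - 1`, and
the rest lowers `hSum` at all `j` from `i` to `u`. The two hypotheses at the ends `l` and `u` keep
the caps inactive in between; the remaining summands of the potential cannot increase. -/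
theorem potential_drop {b d l u : ℕ} {s : ℕ → ℤ} {T t h : ℤ} (hbl : b ≤ l) (hlu : l ≤ u)
    (hud : u ≤ d) (hh : 0 ≤ h) (hg : gSum d s l (t + h) ≤ T) (hH : hSum b s u t ≤ T) :
    h * (((u : ℤ) - l) * ((u : ℤ) - l + 2)) + 4 * potential b d s T (t + h) ≤
      4 * potential b d s T t := by
  set x : ℕ → ℤ := fun i => max (t + h - s i) 0 - max (t - s i) 0 with hx
  have hx0 : ∀ i, 0 ≤ x i := fun i => sub_nonneg.2 (max_le_max_right _ (by omega))
  have hxh : ∀ i, x i ≤ h := fun i => by simp only [hx]; omega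
  have hxs : ∀ i, max (s i - t) 0 - max (s i - (t + h)) 0 = h - x i := fun i => by
    simp only [hx]; omega
  have key := sum_weighted_ge hlu hx0 hxh hh
  have hG : ∑ j ∈ Finset.Ico l u, ∑ i ∈ Finset.Ioc j u, x i ≤
      ∑ j ∈ Finset.Ico b d, ((T - min T (gSum d s j t)) - (T - min T (gSum d s j (t + h)))) := by
    refine le_trans ?_ (Finset.sum_le_sum_of_subset_of_nonneg
      (Finset.Ico_subset_Ico hbl hud) fun j _ _ => ?_)
    · refine Finset.sum_le_sum fun j hj => ?_
      rw [Finset.mem_Ico] at hj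
      have h1 : gSum d s j (t + h) ≤ T := (gSum_anti_index hj.1 _).trans hg
      have h2 : gSum d s j t ≤ T := (gSum_mono (by omega)).trans h1
      rw [min_eq_right h1, min_eq_right h2]
      have h3 : gSum d s j (t + h) - gSum d s j t = ∑ i ∈ Finset.Ioc j d, x i := by
        unfold gSum; rw [← Finset.sum_sub_distrib]
      have h4 : ∑ i ∈ Finset.Ioc j u, x i ≤ ∑ i ∈ Finset.Ioc j d, x i :=
        Finset.sum_le_sum_of_subset_of_nonneg (Finset.Ioc_subset_Ioc_right hud) fun i _ _ => hx0 i
      linarith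
    · have := min_le_min_left T (gSum_mono (d := d) (s := s) (j := j) (by omega : t ≤ t + h))
      linarith
  have hH' : ∑ j ∈ Finset.Ioc l u, ∑ i ∈ Finset.Ioc l j, (h - x i) ≤
      ∑ j ∈ Finset.Ioc b d, (min T (hSum b s j t) - min T (hSum b s j (t + h))) := by
    refine le_trans ?_ (Finset.sum_le_sum_of_subset_of_nonneg
      (Finset.Ioc_subset_Ioc hbl hud) fun j _ _ => ?_)
    · refine Finset.sum_le_sum fun j hj => ?_
      rw [Finset.mem_Ioc] at hj
      have h1 : hSum b s j t ≤ T := (hSum_mono_index hj.2 _).trans hH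
      have h2 : hSum b s j (t + h) ≤ T := (hSum_anti (by omega)).trans h1
      rw [min_eq_right h1, min_eq_right h2]
      have h3 : hSum b s j t - hSum b s j (t + h) = ∑ i ∈ Finset.Ioc b j, (h - x i) := by
        unfold hSum; rw [← Finset.sum_sub_distrib]; exact Finset.sum_congr rfl fun i _ => hxs i
      have h4 : ∑ i ∈ Finset.Ioc l j, (h - x i) ≤ ∑ i ∈ Finset.Ioc b j, (h - x i) :=
        Finset.sum_le_sum_of_subset_of_nonneg (Finset.Ioc_subset_Ioc_left hbl)
          fun i _ _ => sub_nonneg.2 (hxh i)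
      linarith
    · have := min_le_min_left T (hSum_anti (b := b) (s := s) (j := j) (by omega : t ≤ t + h))
      linarith
  have : potential b d s T t - potential b d s T (t + h) =
      ∑ j ∈ Finset.Ico b d, ((T - min T (gSum d s j t)) - (T - min T (gSum d s j (t + h)))) +
      ∑ j ∈ Finset.Ioc b d, (min T (hSum b s j t) - min T (hSum b s j (t + h))) := by
    unfold potential
    simp only [Finset.sum_sub_distrib]
    ring
  linarith

/-- The caps of the potential are not exceeded while a ring is crossed. -/
theorem gSum_add_le {d l u : ℕ} {s : ℕ → ℤ} {M t h : ℤ} (hlu : l ≤ u) (hud : u ≤ d) (hh : 0 ≤ h)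
    (hg : gSum d s l t ≤ M) (hu : ∀ i, u < i → i ≤ d → t + h ≤ s i) :
    gSum d s l (t + h) ≤ M + ((u : ℤ) - l) * h := by
  have h1 : gSum d s l (t + h) ≤ ∑ i ∈ Finset.Ioc l d, (max (t - s i) 0) +
      ∑ i ∈ Finset.Ioc l u, h := by
    unfold gSum
    rw [← Finset.sum_Ioc_consecutive _ hlu hud, ← Finset.sum_Ioc_consecutive _ hlu hud]
    have a1 : ∑ i ∈ Finset.Ioc l u, max (t + h - s i) 0 ≤
        ∑ i ∈ Finset.Ioc l u, max (t - s i) 0 + ∑ i ∈ Finset.Ioc l u, h := by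
      rw [← Finset.sum_add_distrib]
      exact Finset.sum_le_sum fun i _ => by omega
    have a2 : ∑ i ∈ Finset.Ioc u d, max (t + h - s i) 0 ≤
        ∑ i ∈ Finset.Ioc u d, max (t - s i) 0 :=
      Finset.sum_le_sum fun i hi => by
        rw [Finset.mem_Ioc] at hi
        have := hu i hi.1 hi.2
        omega
    linarith
  rw [Finset.sum_const, Nat.card_Ioc, nsmul_eq_mul, Nat.cast_sub hlu] at h1
  exact h1.trans (add_le_add_left hg _)

theorem hSum_sub_le {b l u : ℕ} {s : ℕ → ℤ} {M t h : ℤ} (hbl : b ≤ l) (hlu : l ≤ u) (hh : 0 ≤ h)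
    (hH : hSum b s u (t + h) ≤ M) (hl : ∀ i, b < i → i ≤ l → s i ≤ t) :
    hSum b s u t ≤ M + ((u : ℤ) - l) * h := by
  have h1 : hSum b s u t ≤ ∑ i ∈ Finset.Ioc b u, (max (s i - (t + h)) 0) +
      ∑ i ∈ Finset.Ioc l u, h := by
    unfold hSum
    rw [← Finset.sum_Ioc_consecutive _ hbl hlu, ← Finset.sum_Ioc_consecutive _ hbl hlu]
    have a1 : ∑ i ∈ Finset.Ioc l u, max (s i - t) 0 ≤
        ∑ i ∈ Finset.Ioc l u, max (s i - (t + h)) 0 + ∑ i ∈ Finset.Ioc l u, h := by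
      rw [← Finset.sum_add_distrib]
      exact Finset.sum_le_sum fun i _ => by omega
    have a2 : ∑ i ∈ Finset.Ioc b l, max (s i - t) 0 ≤
        ∑ i ∈ Finset.Ioc b l, max (s i - (t + h)) 0 :=
      Finset.sum_le_sum fun i hi => by
        rw [Finset.mem_Ioc] at hi
        have := hl i hi.1 hi.2
        omega
    linarith
  rw [Finset.sum_const, Nat.card_Ioc, nsmul_eq_mul, Nat.cast_sub hlu] at h1
  exact h1.trans (add_le_add_left hH _)

/-! ### The entry times, computed with two pointers -/

theorem len_le_of_abs_le {a X : ℤ} {W : ℕ} (hX : len X ≤ W) (h : |a| ≤ X) : len a ≤ W :=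
  (len_mono (h.trans (le_abs_self X))).trans hX

/-- One round of the computation of the entry times: register 50 holds the index `j`, register 51
the number `p` of terms that do not exceed the entry time. -/
def entryBody : Prog :=
  block (.instr (.load 53 9 50)) [.instr (.load 54 9 51), .instr (.sub 53 53 54),
    .instr (.sub 53 53 5), .instr (.sub 54 50 51), .instr (.div 53 53 54), .instr (.add 55 51 7),
    .instr (.load 56 8 55), .instr (.add 57 53 7), .instr (.sub 57 57 56),
    .ifPos 57 (.instr (.add 51 51 7)) (.seq (.instr (.store 10 50 53)) (.instr (.add 50 50 7))),
    .instr (.add 52 1 7), .instr (.sub 52 52 50)]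

def entryBounds : Bounds := Bounds.mk' [1, 7, 50, 51, 52] [5] [] [8, 9]

/-- The inequality on `σ p` in `idx` says that the trial value for `j` is at least `σ p`. Neither
pointer ever moves back, which makes the number of rounds linear in `d`. -/
structure EntryInv (b d : ℕ) (σ : ℕ → ℤ) (M X : ℤ) (n : ℕ) (s : State) : Prop where
  r1 : s.reg 1 = d
  r5 : s.reg 5 = M
  r7 : s.reg 7 = 1
  arr8 : ∀ i : ℕ, b < i → i ≤ d → s.arr 8 i = σ i
  arr9 : ∀ i : ℕ, b ≤ i → i ≤ d → s.arr 9 i = pre b σ i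
  le8 : ∀ i, |s.arr 8 i| ≤ X
  le9 : ∀ i, |s.arr 9 i| ≤ X
  le10 : ∀ i, |s.arr 10 i| ≤ X
  idx : ∃ j p : ℕ, s.reg 50 = j ∧ s.reg 51 = p ∧ s.reg 52 = d + 1 - j ∧ b ≤ p ∧ p < j ∧
    j ≤ d + 1 ∧ n = (d + 1 - j) + (d - p) ∧
    (b < p → j ≤ d → ((j : ℤ) - p) * σ p ≤ pre b σ j - pre b σ p - M) ∧
    ∀ i : ℕ, b < i → i < j → IsEntry b σ M i (s.arr 10 i)
  inp : s.inp = []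

theorem entry_step {b d : ℕ} {σ : ℕ → ℤ} {M X : ℤ} (hσ : SortedOn b d σ) (hM : 0 < M)
    (hX : ∀ j p, b ≤ p → p < j → j ≤ d → |pre b σ j - pre b σ p - M| ≤ X) (n : ℕ) (s : State)
    (h : EntryInv b d σ M X n s) (hpos : 0 < s.reg 52) :
    ∃ n' < n, EntryInv b d σ M X n' (run entryBody s) := by
  obtain ⟨r1, r5, r7, arr8, arr9, le8, le9, le10, ⟨j, p, hj, hp, hx, hbp, hpj, hjd, hn, hlow, hE⟩,
    inp⟩ := h
  have hjd' : j ≤ d := by omega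
  have e1 := arr9 j (by omega) hjd'
  have e2 := arr9 p (by omega) (by omega)
  have e3 := arr8 (p + 1) (by omega) (by omega)
  push_cast at e3
  set t : ℤ := (pre b σ j - pre b σ p - M) / ((j : ℤ) - p) with ht
  have habs : |t| ≤ X := le_trans (by
    have := Int.natAbs_ediv_le_natAbs (pre b σ j - pre b σ p - M) ((j : ℤ) - p)
    zify at this; exact this) (hX j p hbp hpj hjd')
  have hpos' : (0 : ℤ) < (j : ℤ) - p := by omega
  by_cases hc : 0 < t + 1 - σ (p + 1)
  · generalize hs' : run entryBody s = s'
    simp only [entryBody, block, run, Instr.eval, State.set, Function.update_apply, hj, hp, e1, e2,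
      r5, r7, e3, ← ht, hc, reduceIte, Nat.reduceEqDiff] at hs'
    have hle : σ (p + 1) * ((j : ℤ) - p) ≤ pre b σ j - pre b σ p - M :=
      (Int.le_ediv_iff_mul_le hpos').1 (by omega)
    -- For `j = p + 1` the inequality `hle` would read `M ≤ 0`.
    have hpj' : p + 1 < j := by
      by_contra hcon
      obtain rfl : j = p + 1 := by omega
      rw [pre_succ σ hbp] at hle
      push_cast at hle
      linarith
    refine ⟨n - 1, by omega, ?_⟩
    subst hs'
    constructor <;> try simpa [Function.update_apply]
    refine ⟨j, p + 1, ?_, ?_, ?_, by omega, hpj', by omega, by omega, fun _ _ => ?_, hE⟩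
    · simp [hj]
    · simp
    · simp [r1]
    · have := pre_succ σ hbp
      push_cast
      linarith
  · generalize hs' : run entryBody s = s'
    simp only [entryBody, block, run, Instr.eval, State.set, Function.update_apply, hj, hp, e1, e2,
      r5, r7, e3, ← ht, hc, reduceIte, Nat.reduceEqDiff] at hs'
    have hent : IsEntry b σ M j t := isEntry_of_ediv hσ hbp hpj hjd' ht (by omega) fun hb =>
      (Int.le_ediv_iff_mul_le hpos').2 (by linarith [hlow hb hjd'])
    refine ⟨n - 1, by omega, ?_⟩
    subst hs'
    constructor <;> try simpa [Function.update_apply]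
    · intro i
      simp only [Function.update_apply, reduceIte]
      split_ifs
      · exact habs
      · exact le10 i
    refine ⟨j + 1, p, ?_, ?_, ?_, by omega, by omega, by omega, by omega, fun h1 h2 => ?_,
      fun i h1 h2 => ?_⟩
    · simp
    · simp [hp]
    · simp [r1]
    -- The new term `σ (j + 1)` is at least `σ p`, so `p` remains admissible for the next index.
    · have h3 := hlow h1 hjd'
      have h4 := pre_succ σ (by omega : b ≤ j)
      have h5 := hσ p (j + 1) h1 (by omega) h2
      push_cast
      linarith
    · simp only [Function.update_apply, reduceIte, Nat.cast_inj]
      split_ifs with hij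
      · rw [hij]; exact hent
      · exact hE i h1 (by omega)

theorem cost_le {a b n k d Q : ℕ} (hn : n + 1 ≤ k * d) (hd : 1 ≤ d) :
    a * Q + (n + 1) * (b * Q) ≤ (a + k * b) * (d * Q) := by
  have h1 : a * Q ≤ a * (d * Q) := Nat.mul_le_mul_left _ (Nat.le_mul_of_pos_left _ hd)
  have h2 : (n + 1) * (b * Q) ≤ k * d * (b * Q) := Nat.mul_le_mul_right _ hn
  calc a * Q + (n + 1) * (b * Q) ≤ a * (d * Q) + k * d * (b * Q) := add_le_add h1 h2
    _ = _ := by ring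

def entryInit : Prog :=
  block (.instr (.add 50 8 7)) [.instr (.sub 51 50 7), .instr (.add 52 1 7),
    .instr (.sub 52 52 50)]

def entryPhase : Prog := .seq entryInit (.whilePos 52 entryBody)

def entryCost : ℕ :=
  entryInit.weight (Bounds.mk' [1, 7, 8] [] [] []) + 4 * loopWeight 52 entryBody entryBounds

theorem entryPhase_runs {V W b d : ℕ} {σ : ℕ → ℤ} {M X : ℤ} {s : State} (hV : 1 ≤ V) (hVW : V ≤ W)
    (hXW : len X ≤ W) (hdV : len ((d : ℤ) + 1) ≤ V) (hbd : b ≤ d) (hd : 1 ≤ d)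
    (hσ : SortedOn b d σ) (hM : 0 < M)
    (hX : ∀ j p, b ≤ p → p < j → j ≤ d → |pre b σ j - pre b σ p - M| ≤ X) (hMX : M ≤ X)
    (r1 : s.reg 1 = d) (r5 : s.reg 5 = M) (r7 : s.reg 7 = 1) (r8 : s.reg 8 = b)
    (arr8 : ∀ i : ℕ, b < i → i ≤ d → s.arr 8 i = σ i)
    (arr9 : ∀ i : ℕ, b ≤ i → i ≤ d → s.arr 9 i = pre b σ i)
    (le8 : ∀ i, |s.arr 8 i| ≤ X) (le9 : ∀ i, |s.arr 9 i| ≤ X) (le10 : ∀ i, |s.arr 10 i| ≤ X)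
    (inp : s.inp = []) :
    ∃ s', Runs entryPhase s (entryCost * (d * (V * W))) s' ∧ (∀ i, |s'.arr 10 i| ≤ X) ∧
      ∀ i : ℕ, b < i → i ≤ d → IsEntry b σ M i (s'.arr 10 i) := by
  have hsm : ∀ a : ℤ, -((d : ℤ) + 1) ≤ a → a ≤ (d : ℤ) + 1 → len a ≤ V := fun a h1 h2 =>
    (len_le_len h1 h2).trans hdV
  have hf : (Bounds.mk' [1, 7, 8] [] [] []).Fits V W s := by
    refine Bounds.fits_mk' ?_ (by simp) (by simp) (by simp) (by simp [inp])
    simp only [List.forall_mem_cons, r1, r7, r8]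
    refine ⟨?_, ?_, ?_, by simp⟩ <;> apply hsm <;> omega
  have hrun := runs_of_fits hV hVW hf (p := entryInit) (by decide)
  have hI : EntryInv b d σ M X ((d - b) + (d - b)) (run entryInit s) := by
    generalize hs' : run entryInit s = s'
    simp only [entryInit, block, run, Instr.eval, State.set, Function.update_apply, r1, r7, r8,
      reduceIte, Nat.reduceEqDiff] at hs'
    subst hs'
    constructor <;> try simpa
    refine ⟨b + 1, b, by simp, by simp, by simp, le_rfl, by omega, by omega, by omega,
      fun h => by omega, fun i h1 h2 => by omega⟩
  have hfit : ∀ n s, EntryInv b d σ M X n s → entryBounds.Fits V W s := fun n s h => by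
    obtain ⟨r1, r5, r7, arr8, arr9, le8, le9, le10, ⟨j, p, hj, hp, hx, hbp, hpj, hjd, hn, hlow, hE⟩,
      inp⟩ := h
    refine Bounds.fits_mk' ?_ ?_ ?_ ?_ (by simp [inp])
    · simp only [List.forall_mem_cons, r1, r7, hj, hp, hx]
      refine ⟨?_, ?_, ?_, ?_, ?_, by simp⟩ <;> apply hsm <;> omega
    · simp only [List.forall_mem_cons, r5]
      exact ⟨len_le_of_abs_le hXW (by rw [abs_of_pos hM]; exact hMX), by simp⟩
    · simp
    · simp only [List.forall_mem_cons]
      exact ⟨fun i => len_le_of_abs_le hXW (le8 i), fun i => len_le_of_abs_le hXW (le9 i), by simp⟩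
  obtain ⟨s', h1, h2, n', h3⟩ := runs_while hV hVW (x := 52) (p := entryBody) (A := entryBounds)
    (by decide) (by decide) hfit (entry_step hσ hM hX) _ _ hI
  refine ⟨s', (hrun.seq h1).mono (cost_le (by omega) hd), h3.le10, fun i hi hid => ?_⟩
  obtain ⟨j, p, -, -, hx, -, -, hjd, -, -, hE⟩ := h3.idx
  exact hE i hi (by omega)

/-! ### The rings on the logarithmic grid -/

/-- The requirements on a ring between the grid points `t` and `t'` with the index pair
`(l, u)`. -/
structure RingStep (b d : ℕ) (σ : ℕ → ℤ) (M c t t' : ℤ) (l u : ℕ) : Prop where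
  lt : t < t'
  bl : b ≤ l
  lu : l ≤ u
  ud : u ≤ d
  lower : l < u → c - ((u : ℤ) - l) < ((u : ℤ) - l) * (t' - t)
  upper : l < u → ((u : ℤ) - l) * (t' - t) ≤ c
  below : ∀ j, b ≤ j → j < l → M ≤ gSum d σ j t
  above : ∀ j, u < j → j ≤ d → M ≤ hSum b σ j t'

/-- The first `N` rings, number `n` between the grid points `T n` and `T (n + 1)`, except that the
first ring begins at radius zero. -/
structure Sweep (b d : ℕ) (σ : ℕ → ℤ) (M c : ℤ) (T : ℕ → ℤ) (Lo Up : ℕ → ℕ) (N : ℕ) : Prop where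
  one_le : 1 ≤ N
  lo0 : Lo 0 = b
  up0 : Up 0 = b
  above0 : ∀ j, b < j → j ≤ d → M ≤ hSum b σ j (T 1)
  step : ∀ n, 1 ≤ n → n < N → RingStep b d σ M c (T n) (T (n + 1)) (Lo n) (Up n)

theorem Sweep.snoc {b d : ℕ} {σ : ℕ → ℤ} {M c : ℤ} {T : ℕ → ℤ} {Lo Up : ℕ → ℕ} {N : ℕ} {t' : ℤ}
    {l u : ℕ} (h : Sweep b d σ M c T Lo Up N) (h' : RingStep b d σ M c (T N) t' l u) :
    Sweep b d σ M c (Function.update T (N + 1) t') (Function.update Lo N l)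
      (Function.update Up N u) (N + 1) := by
  have hN := h.one_le
  refine ⟨by omega, ?_, ?_, ?_, fun n h1 h2 => ?_⟩
  · rw [Function.update_of_ne (by omega)]; exact h.lo0
  · rw [Function.update_of_ne (by omega)]; exact h.up0
  · rw [Function.update_of_ne (by omega)]; exact h.above0
  · rw [Function.update_of_ne (by omega : n ≠ N + 1)]
    rcases eq_or_ne n N with rfl | hn
    · simpa using h'
    · rw [Function.update_of_ne (by omega : n + 1 ≠ N + 1), Function.update_of_ne hn,
        Function.update_of_ne hn]
      exact h.step n h1 (by omega)

theorem sum_update {Lo Up : ℕ → ℕ} {N l u : ℕ} :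
    ∑ n ∈ Finset.range (N + 1), (Function.update Up N u n - Function.update Lo N l n + 1)
      = ∑ n ∈ Finset.range N, (Up n - Lo n + 1) + (u - l + 1) := by
  rw [Finset.sum_range_succ]
  congr 1
  · refine Finset.sum_congr rfl fun n hn => ?_
    rw [Finset.mem_range] at hn
    rw [Function.update_of_ne hn.ne, Function.update_of_ne hn.ne]
  · simp

/-- The hypotheses on the sorted sequence `σ` and the entry times `e` of the indices. -/
structure SweepData (b d : ℕ) (σ e : ℕ → ℤ) (M c Z X : ℤ) : Prop where
  sorted : SortedOn b d σ
  M_pos : 0 < M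
  bd : b ≤ d
  dc : (d : ℤ) < c
  Mc : M + 9 * d ≤ 6 * c
  entry : ∀ i, b < i → i ≤ d → IsEntry b σ M i (e i)
  eZ : e (d + 1) = Z
  sZ : σ (d + 1) = Z + 1
  Z_large : b < d → σ d + M + 2 * c + 1 ≤ Z
  Z_le : |Z| ≤ X
  e_ge : -X ≤ e (b + 1)

/-- The sweep stands at `t`: indices below `l` are dismissed, the slopes up to index `k` do not
exceed `t`, and `del` is the trial value for the index width of the next ring. The second case of
`search` records that the trial value `del - 1` has failed. The output size is split into `zs`, from
rings with equal indices, and `ps`, from all others. In `pot` each unit of `ps` is paid with `c -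
d`; in `zs_le` each value of `l` accounts for one ring with equal indices, the second case meaning
that the one for the current `l` may already be used. -/
structure SweepState (b d : ℕ) (σ e : ℕ → ℤ) (M c Z X : ℤ) (t : ℤ) (l k del N : ℕ) (T : ℕ → ℤ)
    (Lo Up : ℕ → ℕ) (zs ps : ℕ) : Prop where
  bl : b ≤ l
  lk : l ≤ k
  kd : k ≤ d
  sk : ∀ i, b < i → i ≤ k → σ i ≤ t
  below : ∀ j, b ≤ j → j < l → M ≤ gSum d σ j t
  one_le : 1 ≤ del
  search : del = 1 ∨ (l + del ≤ d ∧ t < σ (k + 1) ∧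
    ((k : ℤ) - l) * t - (pre b σ k - pre b σ l) < M ∧ e (l + 1) ≤ t ∧
    (e (l + del) - t) * ((del : ℤ) - 1) < c)
  t_ge : -X ≤ t
  t_le : b < d ∧ t ≤ σ d + M + c ∨ b = d ∧ t = Z
  sweep : Sweep b d σ M c T Lo Up N
  TN : T N = t
  sum : ∑ n ∈ Finset.range N, (Up n - Lo n + 1) = zs + ps
  pot : (c - d) * ps + 4 * potential b d σ (M + 2 * c + d) t ≤
    8 * (M + 2 * c + d) * ((d : ℤ) - b)
  zs_le : zs ≤ l - b ∨ (e (l + 1) ≤ t ∧ zs ≤ l - b + 1)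

section
variable {b d : ℕ} {σ e : ℕ → ℤ} {M c Z X : ℤ} {t : ℤ} {l k del N : ℕ} {T : ℕ → ℤ}
  {Lo Up : ℕ → ℕ} {zs ps : ℕ}

theorem SweepState.t_le_Z (D : SweepData b d σ e M c Z X)
    (h : SweepState b d σ e M c Z X t l k del N T Lo Up zs ps) : t ≤ Z := by
  have := D.dc
  rcases h.t_le with ⟨h1, h2⟩ | ⟨_, h2⟩
  · linarith [D.Z_large h1]
  · exact h2.le

theorem SweepState.abs_le (D : SweepData b d σ e M c Z X)
    (h : SweepState b d σ e M c Z X t l k del N T Lo Up zs ps) : |t| ≤ X :=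
  _root_.abs_le.2 ⟨h.t_ge, (h.t_le_Z D).trans ((le_abs_self _).trans D.Z_le)⟩

theorem SweepState.ps_le (D : SweepData b d σ e M c Z X)
    (h : SweepState b d σ e M c Z X t l k del N T Lo Up zs ps) : ps ≤ 64 * (d - b) := by
  have h1 := h.pot
  have hM := D.M_pos
  have hdc := D.dc
  have h2 : 0 ≤ potential b d σ (M + 2 * c + d) t := potential_nonneg (by linarith)
  have hbd : (0 : ℤ) ≤ (d : ℤ) - b := by have := D.bd; omega
  -- The hypothesis `Mc` is the inequality `M + 2 * c + d ≤ 8 * (c - d)`.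
  have h3 : 8 * (M + 2 * c + d) * ((d : ℤ) - b) ≤ (c - d) * (64 * ((d : ℤ) - b)) := by
    nlinarith [D.Mc]
  have h4 : (ps : ℤ) ≤ 64 * ((d : ℤ) - b) :=
    le_of_mul_le_mul_left (by linarith) (by linarith : (0 : ℤ) < c - d)
  have := D.bd
  omega

theorem SweepState.zs_le' (h : SweepState b d σ e M c Z X t l k del N T Lo Up zs ps) :
    zs ≤ d - b + 1 := by
  have := h.lk
  have := h.kd
  rcases h.zs_le with h | h <;> omega

theorem SweepState.sum_le (D : SweepData b d σ e M c Z X)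
    (h : SweepState b d σ e M c Z X t l k del N T Lo Up zs ps) : zs + ps ≤ 65 * d + 1 := by
  have := h.ps_le D
  have := h.zs_le'
  omega

theorem SweepState.gSum_eq (D : SweepData b d σ e M c Z X)
    (h : SweepState b d σ e M c Z X t l k del N T Lo Up zs ps) (ht : t < σ (k + 1)) :
    gSum d σ l t = ((k : ℤ) - l) * t - (pre b σ k - pre b σ l) := by
  have := h.bl
  exact RingLemma.gSum_eq h.bl h.lk h.kd (fun i h1 h2 => h.sk i (by omega) h2) fun i h1 h2 =>
    ht.le.trans (D.sorted (k + 1) i (by have := h.lk; omega) h1 h2)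

theorem SweepState.lt_of_index_lt
    (h : SweepState b d σ e M c Z X t l k del N T Lo Up zs ps) (hl : l < d) :
    b < d ∧ t ≤ σ d + M + c := by
  rcases h.t_le with h' | h'
  · exact h'
  · exact absurd h'.1 (by have := h.bl; omega)

/-- The sentinel `σ (d + 1) = Z + 1` is beyond every `t`, so `k` cannot leave the range. A search
under way would have required `t < σ (k + 1)`, whence `del = 1`. -/
theorem SweepState.advance_k (D : SweepData b d σ e M c Z X)
    (h : SweepState b d σ e M c Z X t l k del N T Lo Up zs ps) (ht : σ (k + 1) ≤ t) :
    k < d ∧ del = 1 ∧ SweepState b d σ e M c Z X t l (k + 1) del N T Lo Up zs ps := by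
  have hk : k < d := by
    by_contra hcon
    have := h.kd
    obtain rfl : k = d := by omega
    have := h.t_le_Z D
    have := D.sZ
    omega
  have hdel : del = 1 := by
    rcases h.search with h1 | h1
    · exact h1
    · omega
  refine ⟨hk, hdel, { h with lk := h.lk.trans (Nat.le_succ k), kd := hk, sk := ?_, search := ?_ }⟩
  · intro i h1 h2
    rcases Nat.lt_or_ge k i with h3 | h3
    · obtain rfl : i = k + 1 := by omega
      exact ht
    · exact h.sk i h1 h3
  · exact Or.inl hdel

theorem SweepState.advance_l (D : SweepData b d σ e M c Z X)
    (h : SweepState b d σ e M c Z X t l k del N T Lo Up zs ps) (ht : t < σ (k + 1))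
    (hg : M ≤ ((k : ℤ) - l) * t - (pre b σ k - pre b σ l)) :
    l < d ∧ del = 1 ∧ SweepState b d σ e M c Z X t (l + 1) k del N T Lo Up zs ps := by
  have hlk : l < k := by
    by_contra hcon
    have := h.lk
    obtain rfl : l = k := by omega
    have := D.M_pos
    simp only [sub_self, zero_mul] at hg
    omega
  have hdel : del = 1 := by
    rcases h.search with h1 | h1
    · exact h1
    · omega
  have hbl := h.bl
  refine ⟨hlk.trans_le h.kd, hdel, { h with
    bl := h.bl.trans (Nat.le_succ l), lk := hlk, below := ?_, search := ?_, zs_le := ?_ }⟩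
  · intro j h1 h2
    rcases Nat.lt_or_ge j l with h3 | h3
    · exact h.below j h1 h3
    · obtain rfl : j = l := by omega
      rw [h.gSum_eq D ht]
      exact hg
  · exact Or.inl hdel
  · left
    rcases h.zs_le with h1 | h1 <;> omega

/-- No index above `l` has entered before `e (l + 1)`, so term `l` alone suffices up to there.
Afterwards `l + 1` has entered, so this happens at most once for each `l`. -/
theorem SweepState.emit_zero (D : SweepData b d σ e M c Z X)
    (h : SweepState b d σ e M c Z X t l k del N T Lo Up zs ps)
    (hl : l < d) (he : t < e (l + 1)) :
    SweepState b d σ e M c Z X (e (l + 1)) l k del (N + 1) (Function.update T (N + 1) (e (l + 1)))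
      (Function.update Lo N l) (Function.update Up N l) (zs + 1) ps := by
  have hbl := h.bl
  have hE := D.entry (l + 1) (by omega) hl
  have hdel : del = 1 := by
    rcases h.search with h1 | h1
    · exact h1
    · omega
  obtain ⟨hb, -⟩ := h.lt_of_index_lt hl
  have hdc := D.dc
  refine ⟨h.bl, h.lk, h.kd, fun i h1 h2 => (h.sk i h1 h2).trans he.le,
    fun j h1 h2 => (h.below j h1 h2).trans (gSum_mono he.le), h.one_le, Or.inl hdel,
    h.t_ge.trans he.le, Or.inl ⟨hb, ?_⟩, h.sweep.snoc ?_, by simp, ?_, ?_, ?_⟩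
  · have h1 := hE.lt D.sorted D.M_pos hl
    have h2 := D.sorted (l + 1) d (by omega) hl le_rfl
    have := D.M_pos
    linarith
  · refine ⟨by rw [h.TN]; exact he, h.bl, le_rfl, hl.le, fun h => by omega, fun h => by omega, ?_,
      fun j h1 h2 => ?_⟩
    · rw [h.TN]; exact h.below
    · exact hE.1.trans (hSum_mono_index h1 _)
  · rw [sum_update, h.sum]; omega
  · have := h.pot
    have := potential_anti (b := b) (d := d) (s := σ) (T := M + 2 * c + d) he.le
    linarith
  · right
    rcases h.zs_le with h1 | h1
    · exact ⟨le_rfl, by omega⟩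
    · omega

theorem SweepState.extend (D : SweepData b d σ e M c Z X)
    (h : SweepState b d σ e M c Z X t l k del N T Lo Up zs ps) (hl : l < d) (ht : t < σ (k + 1))
    (hg : ((k : ℤ) - l) * t - (pre b σ k - pre b σ l) < M) (he : e (l + 1) ≤ t)
    (hc : (e (l + del + 1) - t) * del < c) :
    l + (del + 1) ≤ d ∧ SweepState b d σ e M c Z X t l k (del + 1) N T Lo Up zs ps := by
  -- At `l + del = d` the sentinel `e (d + 1) = Z` is more than `c` beyond `t`, so the trial value
  -- would have succeeded.
  have hld : l + (del + 1) ≤ d := by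
    by_contra hcon
    have h1 : l + del ≤ d := by
      rcases h.search with h1 | h1 <;> omega
    obtain h2 : l + del + 1 = d + 1 := by omega
    rw [h2, D.eZ] at hc
    obtain ⟨hb, h3⟩ := h.lt_of_index_lt hl
    have h4 := D.Z_large hb
    have h5 : (1 : ℤ) ≤ del := by exact_mod_cast h.one_le
    have := D.dc
    nlinarith
  refine ⟨hld, { h with one_le := Nat.le_add_left _ _, search := Or.inr ⟨hld, ht, hg, he, ?_⟩ }⟩
  push_cast
  rw [add_sub_cancel_right, ← add_assoc]
  exact hc

/-- By `hc` the step `c / del` ends no later than `e (l + del + 1)`, so all indices above `l + del`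
are still negligible at the outer end. The ring is paid for by `potential_drop`, once both caps are
checked. -/
theorem SweepState.emit (D : SweepData b d σ e M c Z X)
    (h : SweepState b d σ e M c Z X t l k del N T Lo Up zs ps) (hl : l < d) (ht : t < σ (k + 1))
    (hg : ((k : ℤ) - l) * t - (pre b σ k - pre b σ l) < M) (he : e (l + 1) ≤ t)
    (hc : c ≤ (e (l + del + 1) - t) * del) :
    l + del ≤ d ∧ SweepState b d σ e M c Z X (t + c / del) l k 1 (N + 1)
      (Function.update T (N + 1) (t + c / del)) (Function.update Lo N l)
      (Function.update Up N (l + del)) zs (ps + (del + 1)) := by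
  have hbl := h.bl
  have hone := h.one_le
  have hM := D.M_pos
  have hdc := D.dc
  have hld : l + del ≤ d := by
    rcases h.search with h1 | h1 <;> omega
  have hdel : (0 : ℤ) < del := by exact_mod_cast h.one_le
  obtain ⟨hb, htd⟩ := h.lt_of_index_lt hl
  have hgl := h.gSum_eq D ht
  set w := c / (del : ℤ) with hw
  have hw1 : (del : ℤ) * w ≤ c := Int.mul_ediv_self_le hdel.ne'
  have hw2 : c < del * w + del := Int.lt_mul_ediv_self_add hdel
  have hwpos : 1 ≤ w := by
    have : (del : ℤ) ≤ c := by omega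
    exact (Int.le_ediv_iff_mul_le hdel).2 (by linarith)
  have hwe : t + w ≤ e (l + del + 1) := by
    have : (del : ℤ) * w ≤ del * (e (l + del + 1) - t) := by linarith
    have := le_of_mul_le_mul_left this hdel
    linarith
  have habove : ∀ j, l + del < j → j ≤ d → M ≤ hSum b σ j (t + w) := fun j h1 h2 =>
    (D.entry (l + del + 1) (by omega) (by omega)).1.trans
      ((hSum_mono_index h1 _).trans (hSum_anti hwe))
  have hs_up : ∀ i, l + del < i → i ≤ d → t + w ≤ σ i := fun i h1 h2 => by
    have h3 := (D.entry (l + del + 1) (by omega) (by omega)).lt D.sorted hM (by omega)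
    have h4 := D.sorted (l + del + 1) i (by omega) h1 h2
    linarith
  -- It starts below `M`, and only the `del` indices of the ring make it grow, each at rate at most
  -- one.
  have hcap1 : gSum d σ l (t + w) ≤ M + 2 * c + d := by
    have := gSum_add_le (M := M) (Nat.le_add_right l del) hld (by omega : 0 ≤ w) (by rw [hgl]; exact hg.le)
      hs_up
    push_cast at this
    rw [add_sub_cancel_left] at this
    have : (0 : ℤ) ≤ d := Int.natCast_nonneg d
    linarith
  -- Just after the entry time the sum is below `M`; going back to `t` adds at most `del * (e (l +
  -- del) + 1 - t)`. Since `del - 1` has failed, `(e (l + del) - t) * (del - 1) < c`, hence `del *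
  -- (e (l + del) - t) < 2 * c` for `del ≥ 2`. This is where the cap comes from; for `del = 1` the
  -- index has already entered.
  have hcap2 : hSum b σ (l + del) t ≤ M + 2 * c + d := by
    have hent := (D.entry (l + del) (by omega) hld).2
    have hdd : (del : ℤ) ≤ d := by omega
    rcases le_or_gt (e (l + del) + 1) t with h1 | h1
    · have := hSum_anti (b := b) (s := σ) (j := l + del) h1
      linarith
    · have h2 := hSum_sub_le (b := b) (l := l) (u := l + del) (s := σ) (M := M) (t := t)
        (h := e (l + del) + 1 - t) hbl (Nat.le_add_right l del) (by omega)
        (by rw [add_sub_cancel]; exact hent.le)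
        (fun i h3 h4 => h.sk i h3 (h4.trans h.lk))
      push_cast at h2
      rw [add_sub_cancel_left] at h2
      rcases h.search with h3 | ⟨-, -, -, -, h3⟩
      · rw [h3] at h2 h1 ⊢
        have h4 : e (l + 1) - t ≤ 0 := by omega
        rw [h3] at hdd
        push_cast at h2 hdd
        linarith
      · rcases eq_or_lt_of_le h.one_le with h5 | h5
        · rw [← h5] at h2 h1 ⊢
          have h4 : e (l + 1) - t ≤ 0 := by omega
          rw [← h5] at hdd
          push_cast at h2 hdd
          linarith
        · have h6 : (2 : ℤ) ≤ del := by exact_mod_cast h5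
          have h7 : 0 ≤ e (l + del) - t := by omega
          nlinarith [mul_nonneg h7 (by linarith : (0 : ℤ) ≤ del - 2)]
  have hdrop := potential_drop (b := b) (T := M + 2 * c + d) hbl (Nat.le_add_right l del) hld
    (by omega : 0 ≤ w) hcap1 hcap2
  push_cast at hdrop
  rw [add_sub_cancel_left] at hdrop
  refine ⟨hld, h.bl, h.lk, h.kd, fun i h1 h2 => (h.sk i h1 h2).trans (by omega),
    fun j h1 h2 => (h.below j h1 h2).trans (gSum_mono (by omega)), le_rfl, Or.inl rfl,
    h.t_ge.trans (by omega), Or.inl ⟨hb, ?_⟩, h.sweep.snoc ?_, by simp, ?_, ?_, ?_⟩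
  -- Because `l` is not dismissed, every summand of `gSum` at `l`, in particular that of `d`, is
  -- below `M`.
  · have h1 : t - σ d < M := by
      have h2 : max (t - σ d) 0 ≤ gSum d σ l t :=
        Finset.single_le_sum (f := fun i => max (t - σ i) 0) (fun i _ => le_max_right _ _)
          (Finset.mem_Ioc.2 ⟨hl, le_rfl⟩)
      have := le_max_left (t - σ d) 0
      linarith
    have h3 : w ≤ c := by nlinarith
    linarith
  · refine ⟨by rw [h.TN]; omega, h.bl, Nat.le_add_right _ _, hld, fun _ => ?_, fun _ => ?_, ?_,
      habove⟩
    · rw [h.TN]; push_cast; rw [add_sub_cancel_left, add_sub_cancel_left]; linarith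
    · rw [h.TN]; push_cast; rw [add_sub_cancel_left, add_sub_cancel_left]; linarith
    · rw [h.TN]; exact h.below
  · rw [sum_update, h.sum]; omega
  · have := h.pot
    push_cast
    -- Rounding in `w` costs less than `del`, so `del * w ≥ c - d`.
    have h1 : (c - d) * ((del : ℤ) + 1) ≤ w * (del * (del + 2)) := by
      have h2 : c - d ≤ del * w := by
        have : (del : ℤ) ≤ d := by omega
        linarith
      have h3 : (0 : ℤ) ≤ del * w := by positivity
      nlinarith
    linarith
  · rcases h.zs_le with h1 | h1
    · exact Or.inl h1
    · exact Or.inr ⟨by omega, h1.2⟩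

/-- For `b < d` the sentinel `e (d + 1) = Z` exceeds `t`, so the ring with equal indices for `l = d`
has not been used, which leaves room for the unbounded ring. For `b = d` there are just two rings.
-/
theorem SweepState.finish (D : SweepData b d σ e M c Z X) (hd : 1 ≤ d)
    (h : SweepState b d σ e M c Z X t d k del N T Lo Up zs ps) : zs + ps + 1 ≤ 65 * d + 1 := by
  have h1 := h.ps_le D
  rcases h.zs_le with h2 | ⟨h2, h3⟩
  · have := D.bd; omega
  · rw [D.eZ] at h2
    rcases h.t_le with ⟨h4, h5⟩ | ⟨h4, h5⟩
    · have := D.Z_large h4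
      have := D.dc
      omega
    · omega

theorem SweepState.start (D : SweepData b d σ e M c Z X) {T : ℕ → ℤ} (hT : T 1 = e (b + 1))
    {Lo Up : ℕ → ℕ} (hLo : Lo 0 = b) (hUp : Up 0 = b) :
    SweepState b d σ e M c Z X (e (b + 1)) b b 1 1 T Lo Up 1 0 := by
  have hM := D.M_pos
  have hdc := D.dc
  have hent : b < d → IsEntry b σ M (b + 1) (e (b + 1)) := fun h => D.entry _ (by omega) h
  refine ⟨le_rfl, le_rfl, D.bd, fun i h1 h2 => by omega, fun j h1 h2 => by omega, le_rfl,
    Or.inl rfl, D.e_ge, ?_, ⟨le_rfl, hLo, hUp, fun j h1 h2 => ?_, fun n h1 h2 => by omega⟩, hT, ?_,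
    ?_, Or.inr ⟨le_rfl, by omega⟩⟩
  · rcases D.bd.lt_or_eq with h | h
    · have h1 := (hent h).lt D.sorted hM h
      have h2 := D.sorted (b + 1) d (by omega) h le_rfl
      exact Or.inl ⟨h, by linarith⟩
    · exact Or.inr ⟨h, by rw [h, D.eZ]⟩
  · rw [hT]
    exact (hent (by omega)).1.trans (hSum_mono_index h1 _)
  · simp [hLo, hUp]
  · have := potential_le (s := σ) (T := M + 2 * c + d) (t := e (b + 1)) D.bd (by linarith)
    push_cast
    linarith

end

/-! ### The program for the sweep -/

theorem abs_update_le {f : ℤ → ℤ} {X x v : ℤ} (hf : ∀ i, |f i| ≤ X) (hv : |v| ≤ X) (i : ℤ) :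
    |Function.update f x v i| ≤ X := by
  rw [Function.update_apply]
  split_ifs
  exacts [hv, hf i]

/-- One step of the construction of the rings. Registers 60 to 65 hold the grid point `t`, the
indices `l` and `k`, the trial value of `u - l`, the number of rings, and a flag. -/
def sweepBody : Prog :=
  block (.instr (.add 66 62 7)) [.instr (.load 67 8 66), .instr (.sub 68 60 67),
    .instr (.add 68 68 7),
    .ifPos 68 (.instr (.add 62 62 7))
      (block (.instr (.sub 69 62 61)) [.instr (.mul 69 69 60), .instr (.load 70 9 62),
        .instr (.load 71 9 61), .instr (.sub 70 70 71), .instr (.sub 69 69 70),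
        .instr (.sub 69 69 5), .instr (.add 69 69 7),
        .ifPos 69 (.instr (.add 61 61 7))
          (block (.instr (.sub 70 1 61)) [
            .ifPos 70
              (block (.instr (.add 71 61 7)) [.instr (.load 72 10 71), .instr (.sub 73 72 60),
                .ifPos 73
                  (block (.instr (.store 12 64 61)) [.instr (.store 13 64 61),
                    .instr (.add 64 64 7), .instr (.store 11 64 72), .instr (.add 60 60 73)])
                  (block (.instr (.add 70 61 63)) [.instr (.add 71 70 7), .instr (.load 72 10 71),
                    .instr (.sub 72 72 60), .instr (.mul 72 72 63), .instr (.sub 72 6 72),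
                    .ifPos 72 (.instr (.add 63 63 7))
                      (block (.instr (.store 12 64 61)) [.instr (.store 13 64 70),
                        .instr (.div 72 6 63), .instr (.add 60 60 72), .instr (.add 64 64 7),
                        .instr (.store 11 64 60), .instr (.const 63 1)])])])
              (block (.instr (.store 12 64 61)) [.instr (.store 13 64 61), .instr (.add 64 64 7),
                .instr (.const 65 0)])])])]

def sweepBounds : Bounds := Bounds.mk' [1, 7, 61, 62, 63, 64, 65] [5, 6, 60] [] [8, 9, 10]

/-- The measure adds what is left for `k`, for `l`, for the output size and for the trial value. The
second alternative in `idx` is the final state, with the unbounded ring stored. -/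
structure SweepInv (b d : ℕ) (σ e : ℕ → ℤ) (M c Z X Y : ℤ) (n : ℕ) (s : State) : Prop where
  r1 : s.reg 1 = d
  r5 : s.reg 5 = M
  r6 : s.reg 6 = c
  r7 : s.reg 7 = 1
  arr8 : ∀ i : ℕ, b < i → i ≤ d + 1 → s.arr 8 i = σ i
  arr9 : ∀ i : ℕ, b ≤ i → i ≤ d → s.arr 9 i = pre b σ i
  arr10 : ∀ i : ℕ, b < i → i ≤ d + 1 → s.arr 10 i = e i
  le8 : ∀ i, |s.arr 8 i| ≤ X
  le9 : ∀ i, |s.arr 9 i| ≤ X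
  le10 : ∀ i, |s.arr 10 i| ≤ X
  le11 : ∀ i, |s.arr 11 i| ≤ X
  le12 : ∀ i, |s.arr 12 i| ≤ Y
  le13 : ∀ i, |s.arr 13 i| ≤ Y
  inp : s.inp = []
  idx : ∃ (t : ℤ) (l k del N : ℕ) (T : ℕ → ℤ) (Lo Up : ℕ → ℕ) (zs ps : ℕ),
    SweepState b d σ e M c Z X t l k del N T Lo Up zs ps ∧ s.reg 60 = t ∧ s.reg 61 = l ∧
    s.reg 62 = k ∧ s.reg 63 = del ∧ (∀ i : ℕ, i ≤ N → s.arr 11 i = T i) ∧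
    (∀ i : ℕ, i < N → s.arr 12 i = Lo i) ∧ (∀ i : ℕ, i < N → s.arr 13 i = Up i) ∧
    (s.reg 65 = 1 ∧ s.reg 64 = N ∧
        n = (d - k) + (d - l) + (65 * d + 1 - (zs + ps)) + (d - del) + 1 ∨
      s.reg 65 = 0 ∧ s.reg 64 = N + 1 ∧ l = d ∧ s.arr 12 N = d ∧ s.arr 13 N = d)

theorem SweepState.N_le {b d : ℕ} {σ e : ℕ → ℤ} {M c Z X : ℤ} {t : ℤ} {l k del N : ℕ} {T : ℕ → ℤ}
    {Lo Up : ℕ → ℕ} {zs ps : ℕ} (D : SweepData b d σ e M c Z X)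
    (h : SweepState b d σ e M c Z X t l k del N T Lo Up zs ps) : N ≤ 65 * d + 1 := by
  have h1 := h.sum_le D
  rw [← h.sum] at h1
  refine le_trans ?_ h1
  calc N = ∑ n ∈ Finset.range N, 1 := by simp
    _ ≤ _ := Finset.sum_le_sum fun n _ => Nat.le_add_left _ _

set_option maxHeartbeats 1000000 in
theorem sweep_step {b d : ℕ} {σ e : ℕ → ℤ} {M c Z X Y : ℤ} (hd : 1 ≤ d)
    (D : SweepData b d σ e M c Z X) (hY : (d : ℤ) ≤ Y) (n : ℕ) (s : State)
    (h : SweepInv b d σ e M c Z X Y n s) (hpos : 0 < s.reg 65) :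
    ∃ n' < n, SweepInv b d σ e M c Z X Y n' (run sweepBody s) := by
  obtain ⟨r1, r5, r6, r7, arr8, arr9, arr10, le8, le9, le10, le11, le12, le13, inp,
    ⟨t, l, k, del, N, T, Lo, Up, zs, ps, S, r60, r61, r62, r63, hT, hLo, hUp, hcase⟩⟩ := h
  rcases hcase with ⟨r65, r64, hn⟩ | ⟨r65, -⟩
  swap
  · omega
  have hbl := S.bl
  have hlk := S.lk
  have hkd := S.kd
  have hsum := S.sum_le D
  have hone := S.one_le
  have a1 := arr8 (k + 1) (by omega) (by omega)
  have a2 := arr9 k (by omega) (by omega)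
  have a3 := arr9 l (by omega) (by omega)
  have a4 := arr10 (l + 1) (by omega) (by omega)
  push_cast at a1 a4
  have hlY : |(l : ℤ)| ≤ Y := by rw [Nat.abs_cast]; omega
  have hdeld : del ≤ d := by rcases S.search with h1 | h1 <;> omega
  generalize hs' : run sweepBody s = s'
  by_cases c1 : 0 < t - σ (k + 1) + 1
  · simp only [sweepBody, block, run, Instr.eval, State.set, Function.update_apply, r60, r61, r62,
      r63, r64, r1, r5, r6, r7, a1, c1, reduceIte, Nat.reduceEqDiff] at hs'
    subst hs'
    obtain ⟨h1, -, S'⟩ := S.advance_k D (by omega)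
    refine ⟨n - 1, by omega, ?_⟩
    constructor <;> try simpa
    exact ⟨t, l, k + 1, del, N, T, Lo, Up, zs, ps, S', by simp [r60], by simp [r61], by simp,
      by simp [r63], hT, hLo, hUp, Or.inl ⟨by simp [r65], by simp [r64], by omega⟩⟩
  by_cases c2 : 0 < ((k : ℤ) - l) * t - (pre b σ k - pre b σ l) - M + 1
  · simp only [sweepBody, block, run, Instr.eval, State.set, Function.update_apply, r60, r61, r62,
      r63, r64, r1, r5, r6, r7, a1, a2, a3, c1, c2, reduceIte, Nat.reduceEqDiff] at hs'
    subst hs'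
    obtain ⟨h1, -, S'⟩ := S.advance_l D (by omega) (by omega)
    refine ⟨n - 1, by omega, ?_⟩
    constructor <;> try simpa
    exact ⟨t, l + 1, k, del, N, T, Lo, Up, zs, ps, S', by simp [r60], by simp, by simp [r62],
      by simp [r63], hT, hLo, hUp, Or.inl ⟨by simp [r65], by simp [r64], by omega⟩⟩
  by_cases c3 : 0 < (d : ℤ) - l
  swap
  · simp only [sweepBody, block, run, Instr.eval, State.set, Function.update_apply, r60, r61, r62,
      r63, r64, r1, r5, r6, r7, a1, a2, a3, c1, c2, c3, reduceIte, Nat.reduceEqDiff] at hs'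
    subst hs'
    have hld : l = d := by omega
    refine ⟨0, by omega, ?_⟩
    constructor <;> try simpa
    · simpa using abs_update_le le12 hlY
    · simpa using abs_update_le le13 hlY
    refine ⟨t, l, k, del, N, T, Lo, Up, zs, ps, S, by simp [r60], by simp [r61], by simp [r62],
      by simp [r63], by simpa using hT, fun i hi => ?_, fun i hi => ?_,
      Or.inr ⟨by simp, by simp, hld, by simp [hld], by simp [hld]⟩⟩
    · have : (i : ℤ) ≠ N := by omega
      simpa [this] using hLo i hi
    · have : (i : ℤ) ≠ N := by omega
      simpa [this] using hUp i hi
  by_cases c4 : 0 < e (l + 1) - t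
  · simp only [sweepBody, block, run, Instr.eval, State.set, Function.update_apply, r60, r61, r62,
      r63, r64, r1, r5, r6, r7, a1, a2, a3, a4, c1, c2, c3, c4, reduceIte, Nat.reduceEqDiff] at hs'
    subst hs'
    have S' := S.emit_zero D (by omega) (by omega)
    have h2 := S'.sum_le D
    have h3 := S'.abs_le D
    refine ⟨n - 1, by omega, ?_⟩
    constructor <;> try simpa
    · simpa using abs_update_le le11 h3
    · simpa using abs_update_le le12 hlY
    · simpa using abs_update_le le13 hlY
    refine ⟨_, l, k, del, N + 1, _, _, _, zs + 1, ps, S', by simp, by simp [r61], by simp [r62],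
      by simp [r63], fun i hi => ?_, fun i hi => ?_, fun i hi => ?_,
      Or.inl ⟨by simp [r65], by simp, by omega⟩⟩
    · rcases eq_or_ne i (N + 1) with rfl | hi'
      · simp
      · have : (i : ℤ) ≠ (N : ℤ) + 1 := by omega
        simpa [this, hi'] using hT i (by omega)
    · rcases eq_or_ne i N with rfl | hi'
      · simp
      · have : (i : ℤ) ≠ (N : ℤ) := by omega
        simpa [this, hi'] using hLo i (by omega)
    · rcases eq_or_ne i N with rfl | hi'
      · simp
      · have : (i : ℤ) ≠ (N : ℤ) := by omega
        simpa [this, hi'] using hUp i (by omega)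
  have hldel : l + del ≤ d := by rcases S.search with h1 | h1 <;> omega
  have a5 := arr10 (l + del + 1) (by omega) (by omega)
  push_cast at a5
  by_cases c5 : 0 < c - (e (l + del + 1) - t) * del
  · simp only [sweepBody, block, run, Instr.eval, State.set, Function.update_apply, r60, r61, r62,
      r63, r64, r1, r5, r6, r7, a1, a2, a3, a4, a5, c1, c2, c3, c4, c5, reduceIte,
      Nat.reduceEqDiff] at hs'
    subst hs'
    obtain ⟨h1, S'⟩ := S.extend D (by omega) (by omega) (by omega) (by omega) (by omega)
    refine ⟨n - 1, by omega, ?_⟩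
    constructor <;> try simpa
    exact ⟨t, l, k, del + 1, N, T, Lo, Up, zs, ps, S', by simp [r60], by simp [r61], by simp [r62],
      by simp, hT, hLo, hUp, Or.inl ⟨by simp [r65], by simp [r64], by omega⟩⟩
  · simp only [sweepBody, block, run, Instr.eval, State.set, Function.update_apply, r60, r61, r62,
      r63, r64, r1, r5, r6, r7, a1, a2, a3, a4, a5, c1, c2, c3, c4, c5, reduceIte,
      Nat.reduceEqDiff] at hs'
    subst hs'
    obtain ⟨h1, S'⟩ := S.emit D (by omega) (by omega) (by omega) (by omega) (by omega)
    have h2 := S'.sum_le D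
    have h3 := S'.abs_le D
    have huY : |(l : ℤ) + del| ≤ Y := by rw [abs_of_nonneg (by positivity)]; omega
    -- Resetting `del` raises the measure by `del - 1`, but the output has grown by `del + 1`: the
    -- bound on the output also pays for the searches.
    refine ⟨n - 2, by omega, ?_⟩
    constructor <;> try simpa
    · simpa using abs_update_le le11 h3
    · simpa using abs_update_le le12 hlY
    · simpa using abs_update_le le13 huY
    refine ⟨_, l, k, 1, N + 1, _, _, _, zs, ps + (del + 1), S', by simp, by simp [r61],
      by simp [r62], by simp, fun i hi => ?_, fun i hi => ?_, fun i hi => ?_,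
      Or.inl ⟨by simp [r65], by simp, by omega⟩⟩
    · rcases eq_or_ne i (N + 1) with rfl | hi'
      · simp
      · have : (i : ℤ) ≠ (N : ℤ) + 1 := by omega
        simpa [this, hi'] using hT i (by omega)
    · rcases eq_or_ne i N with rfl | hi'
      · simp
      · have : (i : ℤ) ≠ (N : ℤ) := by omega
        simpa [this, hi'] using hLo i (by omega)
    · rcases eq_or_ne i N with rfl | hi'
      · simp
      · have : (i : ℤ) ≠ (N : ℤ) := by omega
        simpa [this, hi'] using hUp i (by omega)

/-- Store the sentinels behind the sorted sequence and behind the entry times. -/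
def sweepInit₁ : Prog :=
  block (.instr (.add 66 1 7)) [.instr (.add 44 43 5), .instr (.add 44 44 6),
    .instr (.add 44 44 6), .instr (.add 44 44 7), .instr (.store 10 66 44),
    .instr (.add 44 44 7), .instr (.store 8 66 44)]

def sweepInit₂ : Prog :=
  block (.instr (.const 67 0)) [.instr (.store 12 67 8), .instr (.store 13 67 8),
    .instr (.add 61 8 67), .instr (.add 62 8 67), .instr (.const 63 1), .instr (.const 64 1),
    .instr (.const 65 1), .instr (.add 67 8 7), .instr (.load 60 10 67), .instr (.store 11 7 60)]

def sweepPhase : Prog := block sweepInit₁ [sweepInit₂, .whilePos 65 sweepBody]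

def sweepBounds₁ : Bounds := Bounds.mk' [1, 7] [5, 6, 43] [] []

def sweepBounds₂ : Bounds := Bounds.mk' [7, 8] [] [] [10]

def sweepCost : ℕ :=
  sweepInit₁.weight sweepBounds₁ + sweepInit₂.weight sweepBounds₂ +
    70 * loopWeight 65 sweepBody sweepBounds

/-- The data that the last phase of the algorithm finds in the arrays: the rings on the grid. -/
structure RingData (b d : ℕ) (σ : ℕ → ℤ) (M c X Y : ℤ) (N : ℕ) (T : ℕ → ℤ) (Lo Up : ℕ → ℕ)
    (s : State) : Prop where
  sweep : Sweep b d σ M c T Lo Up N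
  lo_last : Lo N = d
  up_last : Up N = d
  below : ∀ j, b ≤ j → j < d → M ≤ gSum d σ j (T N)
  sum : ∑ n ∈ Finset.range (N + 1), (Up n - Lo n + 1) ≤ 65 * d + 1
  r64 : s.reg 64 = N + 1
  arr11 : ∀ i : ℕ, i ≤ N → s.arr 11 i = T i
  arr12 : ∀ i : ℕ, i ≤ N → s.arr 12 i = Lo i
  arr13 : ∀ i : ℕ, i ≤ N → s.arr 13 i = Up i
  le11 : ∀ i, |s.arr 11 i| ≤ X
  le12 : ∀ i, |s.arr 12 i| ≤ Y
  le13 : ∀ i, |s.arr 13 i| ≤ Y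

theorem sweepPhase_runs {V W b d : ℕ} {σ : ℕ → ℤ} {M c X Y sl : ℤ} {s : State}
    (hV : 1 ≤ V) (hVW : V ≤ W)
    (hXW : len X ≤ W) (hYV : len Y ≤ V) (hY : 66 * (d : ℤ) + 3 ≤ Y) (hbd : b ≤ d) (hd : 1 ≤ d)
    (hσ : SortedOn b d σ) (hM : 0 < M) (hdc : (d : ℤ) < c) (hMc : M + 9 * d ≤ 6 * c)
    (hsl : b < d → sl = σ d) (hX1 : |sl| + M + 2 * c + 2 ≤ X)
    (r1 : s.reg 1 = d) (r5 : s.reg 5 = M) (r6 : s.reg 6 = c) (r7 : s.reg 7 = 1) (r8 : s.reg 8 = b)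
    (r43 : s.reg 43 = sl)
    (arr8 : ∀ i : ℕ, b < i → i ≤ d → s.arr 8 i = σ i)
    (arr9 : ∀ i : ℕ, b ≤ i → i ≤ d → s.arr 9 i = pre b σ i)
    (arr10 : ∀ i : ℕ, b < i → i ≤ d → IsEntry b σ M i (s.arr 10 i))
    (le8 : ∀ i, |s.arr 8 i| ≤ X) (le9 : ∀ i, |s.arr 9 i| ≤ X) (le10 : ∀ i, |s.arr 10 i| ≤ X)
    (le11 : ∀ i, |s.arr 11 i| ≤ X) (le12 : ∀ i, |s.arr 12 i| ≤ Y) (le13 : ∀ i, |s.arr 13 i| ≤ Y)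
    (inp : s.inp = []) :
    ∃ s' N T Lo Up, Runs sweepPhase s (sweepCost * (d * (V * W))) s' ∧
      RingData b d σ M c X Y N T Lo Up s' := by
  have hsm : ∀ a : ℤ, -Y ≤ a → a ≤ Y → len a ≤ V := fun a h1 h2 =>
    (len_le_len h1 h2).trans hYV
  have hbig : ∀ a : ℤ, -X ≤ a → a ≤ X → len a ≤ W := fun a h1 h2 =>
    (len_le_len h1 h2).trans hXW
  have hsl1 := neg_abs_le sl
  have hsl2 := le_abs_self sl
  have hsl3 := abs_nonneg sl
  have hf₁ : sweepBounds₁.Fits V W s := by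
    refine Bounds.fits_mk' ?_ ?_ (by simp) (by simp) (by simp [inp])
    · simp only [List.forall_mem_cons, r1, r7]
      refine ⟨?_, ?_, by simp⟩ <;> apply hsm <;> omega
    · simp only [List.forall_mem_cons, r5, r6, r43]
      refine ⟨?_, ?_, ?_, by simp⟩ <;> apply hbig <;> omega
  have hrun₁ := runs_of_fits hV hVW hf₁ (p := sweepInit₁) (by decide)
  generalize hs₁ : run sweepInit₁ s = s₁ at hrun₁
  simp only [sweepInit₁, block, run, Instr.eval, State.set, Function.update_apply, r1, r5, r6, r7,
    r43, reduceIte, Nat.reduceEqDiff] at hs₁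
  set Z : ℤ := sl + M + c + c + 1 with hZ
  have hZX : |Z| ≤ X := abs_le.2 ⟨by omega, by omega⟩
  -- The sentinels sit at index `d + 1`, outside the range of `pre`, `gSum` and `hSum`, which are
  -- therefore the same for `σ` and `σ'`.
  set σ' : ℕ → ℤ := Function.update σ (d + 1) (Z + 1) with hσ'
  set e : ℕ → ℤ := fun i => if i = d + 1 then Z else s.arr 10 i with he
  have hσσ' : ∀ i, i ≤ d → σ' i = σ i := fun i hi => Function.update_of_ne (by omega) _ _
  have hpre : ∀ i, i ≤ d → pre b σ' i = pre b σ i := fun i hi =>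
    Finset.sum_congr rfl fun j hj => hσσ' j (by rw [Finset.mem_Ioc] at hj; omega)
  have hgS : ∀ j t, gSum d σ' j t = gSum d σ j t := fun j t =>
    Finset.sum_congr rfl fun i hi => by rw [Finset.mem_Ioc] at hi; rw [hσσ' i hi.2]
  have hhS : ∀ j t, j ≤ d → hSum b σ' j t = hSum b σ j t := fun j t hj =>
    Finset.sum_congr rfl fun i hi => by rw [Finset.mem_Ioc] at hi; rw [hσσ' i (by omega)]
  have D : SweepData b d σ' e M c Z X := by
    refine ⟨fun i j h1 h2 h3 => ?_, hM, hbd, hdc, hMc, fun i h1 h2 => ?_, by simp [he],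
      by simp [hσ'], fun h => ?_, hZX, ?_⟩
    · rw [hσσ' i (by omega), hσσ' j h3]; exact hσ i j h1 h2 h3
    · have : e i = s.arr 10 i := if_neg (by omega)
      rw [this]
      have := arr10 i h1 h2
      unfold IsEntry at this ⊢
      rwa [hhS i _ h2, hhS i _ h2]
    · rw [hσσ' d le_rfl, ← hsl h]; omega
    · simp only [he]
      split_ifs
      · exact (abs_le.1 hZX).1
      · exact (abs_le.1 (le10 _)).1
  have q1 : s₁.reg 1 = d := by subst hs₁; simpa
  have q5 : s₁.reg 5 = M := by subst hs₁; simpa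
  have q6 : s₁.reg 6 = c := by subst hs₁; simpa
  have q7 : s₁.reg 7 = 1 := by subst hs₁; simpa
  have q8 : s₁.reg 8 = b := by subst hs₁; simpa
  have qa8 : ∀ i : ℕ, b < i → i ≤ d + 1 → s₁.arr 8 i = σ' i := by
    intro i h1 h2
    subst hs₁
    rcases eq_or_ne i (d + 1) with rfl | hi
    · simp [hσ']
    · have : (i : ℤ) ≠ (d : ℤ) + 1 := by omega
      rw [hσσ' i (by omega), ← arr8 i h1 (by omega)]
      simp [this]
  have qa9 : ∀ i : ℕ, b ≤ i → i ≤ d → s₁.arr 9 i = pre b σ' i := by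
    intro i h1 h2
    subst hs₁
    rw [hpre i h2, ← arr9 i h1 h2]
    simp
  have qa10 : ∀ i : ℕ, b < i → i ≤ d + 1 → s₁.arr 10 i = e i := by
    intro i h1 h2
    subst hs₁
    rcases eq_or_ne i (d + 1) with rfl | hi
    · simp [he]
    · have : (i : ℤ) ≠ (d : ℤ) + 1 := by omega
      simp [this, he, hi]
  have ql8 : ∀ i, |s₁.arr 8 i| ≤ X := by
    subst hs₁
    simpa using abs_update_le le8 (abs_le.2 ⟨by omega, by omega⟩ : |Z + 1| ≤ X)
  have ql9 : ∀ i, |s₁.arr 9 i| ≤ X := by subst hs₁; simpa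
  have ql10 : ∀ i, |s₁.arr 10 i| ≤ X := by
    subst hs₁
    simpa using abs_update_le le10 hZX
  have ql11 : ∀ i, |s₁.arr 11 i| ≤ X := by subst hs₁; simpa
  have ql12 : ∀ i, |s₁.arr 12 i| ≤ Y := by subst hs₁; simpa
  have ql13 : ∀ i, |s₁.arr 13 i| ≤ Y := by subst hs₁; simpa
  have qinp : s₁.inp = [] := by subst hs₁; simpa
  clear hs₁
  have hf₂ : sweepBounds₂.Fits V W s₁ := by
    refine Bounds.fits_mk' ?_ (by simp) (by simp) ?_ (by simp [qinp])
    · simp only [List.forall_mem_cons, q7, q8]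
      refine ⟨?_, ?_, by simp⟩ <;> apply hsm <;> omega
    · simp only [List.forall_mem_cons]
      exact ⟨fun i => len_le_of_abs_le hXW (ql10 i), by simp⟩
  have hrun₂ := runs_of_fits hV hVW hf₂ (p := sweepInit₂) (by decide)
  have ha10 := qa10 (b + 1) (by omega) (by omega)
  push_cast at ha10
  have hI : SweepInv b d σ' e M c Z X Y ((d - b) + (d - b) + (65 * d + 1 - (1 + 0)) + (d - 1) + 1)
      (run sweepInit₂ s₁) := by
    generalize hs₂ : run sweepInit₂ s₁ = s₂
    simp only [sweepInit₂, block, run, Instr.eval, State.set, Function.update_apply, q7, q8, ha10,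
      reduceIte, Nat.reduceEqDiff, add_zero] at hs₂
    subst hs₂
    have hbY : |(b : ℤ)| ≤ Y := by rw [Nat.abs_cast]; omega
    have hS := SweepState.start D (T := fun _ => e (b + 1)) rfl (Lo := fun _ => b)
      (Up := fun _ => b) rfl rfl
    constructor <;> try simpa
    · simpa using abs_update_le ql11 (hS.abs_le D)
    · simpa using abs_update_le ql12 hbY
    · simpa using abs_update_le ql13 hbY
    -- `T 0` may be anything, as the first ring begins at radius zero; here it is whatever the array
    -- contains.
    have S' := SweepState.start D (T := fun i => if i = 1 then e (b + 1) else s₁.arr 11 i) rfl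
      (Lo := fun _ => b) (Up := fun _ => b) rfl rfl
    refine ⟨_, b, b, 1, 1, _, _, _, 1, 0, S', by simp, by simp, by simp, by simp, fun i hi => ?_,
      fun i hi => ?_, fun i hi => ?_, Or.inl ⟨by simp, by simp, by omega⟩⟩
    · interval_cases i <;> simp
    · interval_cases i; simp
    · interval_cases i; simp
  have hfit : ∀ n s, SweepInv b d σ' e M c Z X Y n s → sweepBounds.Fits V W s := fun n s h => by
    obtain ⟨r1, r5, r6, r7, arr8, arr9, arr10, le8, le9, le10, le11, le12, le13, inp,
      ⟨t, l, k, del, N, T, Lo, Up, zs, ps, S, r60, r61, r62, r63, hT, hLo, hUp, hcase⟩⟩ := h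
    have h1 := S.N_le D
    have h2 := S.bl
    have h3 := S.lk
    have h4 := S.kd
    have h5 : del ≤ d := by rcases S.search with h1 | h1 <;> omega
    have h6 := abs_le.1 (S.abs_le D)
    refine Bounds.fits_mk' ?_ ?_ (by simp) ?_ (by simp [inp])
    · simp only [List.forall_mem_cons, r1, r7, r61, r62, r63]
      refine ⟨?_, ?_, ?_, ?_, ?_, ?_, ?_, by simp⟩ <;> apply hsm <;> omega
    · simp only [List.forall_mem_cons, r5, r6, r60]
      refine ⟨?_, ?_, ?_, by simp⟩ <;> apply hbig <;> omega
    · simp only [List.forall_mem_cons]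
      exact ⟨fun i => len_le_of_abs_le hXW (le8 i), fun i => len_le_of_abs_le hXW (le9 i),
        fun i => len_le_of_abs_le hXW (le10 i), by simp⟩
  obtain ⟨s', h1, h2, n', h3⟩ := runs_while hV hVW (x := 65) (p := sweepBody) (A := sweepBounds)
    (by decide) (by decide) hfit (sweep_step hd D (by omega)) _ _ hI
  obtain ⟨-, -, -, -, -, -, -, -, -, -, le11, le12, le13, -,
    ⟨t, l, k, del, N, T, Lo, Up, zs, ps, S, r60, r61, r62, r63, hT, hLo, hUp, hcase⟩⟩ := h3
  rcases hcase with ⟨r65, -⟩ | ⟨r65, r64, rfl, h12, h13⟩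
  · omega
  refine ⟨s', N, T, Function.update Lo N l, Function.update Up N l, ?_, ?_⟩
  · refine (hrun₁.seq (hrun₂.seq h1)).mono ?_
    rw [← add_assoc, ← add_mul]
    exact cost_le (by omega) hd
  · have hone := S.sweep.one_le
    refine ⟨⟨hone, ?_, ?_, fun j h1 h2 => ?_, fun n h1 h2 => ?_⟩, by simp, by simp,
      fun j h1 h2 => ?_, ?_, r64, hT, fun i hi => ?_, fun i hi => ?_, le11, le12, le13⟩
    · rw [Function.update_of_ne (by omega)]; exact S.sweep.lo0
    · rw [Function.update_of_ne (by omega)]; exact S.sweep.up0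
    · rw [← hhS j _ h2]; exact S.sweep.above0 j h1 h2
    · rw [Function.update_of_ne (by omega), Function.update_of_ne (by omega)]
      have R := S.sweep.step n h1 h2
      exact { R with
        below := fun j a1 a2 => by rw [← hgS]; exact R.below j a1 a2
        above := fun j a1 a2 => by rw [← hhS j _ a2]; exact R.above j a1 a2 }
    · rw [← hgS, S.TN]; exact S.below j h1 h2
    · rw [sum_update, S.sum]
      have := S.finish D hd
      omega
    · rcases eq_or_ne i N with rfl | hi'
      · simpa using h12
      · simpa [hi'] using hLo i (by omega)
    · rcases eq_or_ne i N with rfl | hi'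
      · simpa using h13
      · simpa [hi'] using hUp i (by omega)

/-! ### The upper hull of the points `(j, a j)` -/

/-- The point with index `x` is not above the line through the points with indices `p` and `q`. -/
def Dom (a : ℕ → ℤ) (p q x : ℕ) : Prop :=
  (a x - a p) * ((q : ℤ) - p) ≤ (a q - a p) * ((x : ℤ) - p)

section
variable {a : ℕ → ℤ} {p q u v w x j : ℕ}

theorem dom_left : Dom a p q p := by simp [Dom]

theorem dom_right : Dom a p q q := by simp [Dom]

theorem dom_of_pop (h : (a w - a j) * ((w : ℤ) - p) ≤ (a p - a w) * ((j : ℤ) - w)) :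
    Dom a p j w := by unfold Dom; linarith

theorem dom_of_not_pop (h : (a p - a w) * ((j : ℤ) - w) ≤ (a w - a j) * ((w : ℤ) - p)) :
    Dom a p w j := by unfold Dom; linarith

/-- If `w` lies under the chord from `p` to `j`, that chord replaces the one from `p` to `w` as an
upper bound. This lemma and the next three are linear inequalities between slopes, cleared of a
positive denominator. -/
theorem Dom.trans_left (hpw : p < w) (hpx : p ≤ x) (hpj : p < j) (h : Dom a p w x)
    (h' : Dom a p j w) : Dom a p j x := by
  unfold Dom at *
  have h1 : (0 : ℤ) < (w : ℤ) - p := by omega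
  have h2 : (0 : ℤ) ≤ (x : ℤ) - p := by omega
  have h3 : (0 : ℤ) < (j : ℤ) - p := by omega
  refine le_of_mul_le_mul_right ?_ h1
  have e1 := mul_le_mul_of_nonneg_right h h3.le
  have e2 := mul_le_mul_of_nonneg_right h' h2
  linarith

theorem Dom.trans_right (hwj : w < j) (hxj : x ≤ j) (hpj : p < j) (h : Dom a w j x)
    (h' : Dom a p j w) : Dom a p j x := by
  unfold Dom at *
  have h1 : (0 : ℤ) < (j : ℤ) - w := by omega
  have h2 : (0 : ℤ) ≤ (j : ℤ) - x := by omega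
  have h3 : (0 : ℤ) < (j : ℤ) - p := by omega
  refine le_of_mul_le_mul_right ?_ h1
  have e1 := mul_le_mul_of_nonneg_right h h3.le
  have e2 := mul_le_mul_of_nonneg_right h' h2
  linarith

theorem Dom.next (hpw : p < w) (hwj : w < j) (hxw : x ≤ w) (h : Dom a p w x) (h' : Dom a p w j) :
    Dom a w j x := by
  unfold Dom at *
  have h1 : (0 : ℤ) < (w : ℤ) - p := by omega
  have h2 : (0 : ℤ) ≤ (w : ℤ) - x := by omega
  have h3 : (0 : ℤ) < (j : ℤ) - w := by omega
  refine le_of_mul_le_mul_right ?_ h1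
  have e1 := mul_le_mul_of_nonneg_right h h3.le
  have e2 := mul_le_mul_of_nonneg_right h' h2
  linarith

/-- Concavity: the edge through `p` and `w` is no steeper upwards than the earlier edge through `u`
and `v`, so a new point under the later line is also under the earlier one. -/
theorem Dom.extend (huv : u < v) (hvw : v < w) (hwj : w < j) (hpw : p < w) (h1 : Dom a u v w)
    (h2 : Dom a p w v) (h3 : Dom a p w j) : Dom a u v j := by
  unfold Dom at *
  have e1 : (0 : ℤ) < (v : ℤ) - u := by omega
  have e2 : (0 : ℤ) < (w : ℤ) - v := by omega
  have e3 : (0 : ℤ) < (j : ℤ) - w := by omega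
  have e4 : (0 : ℤ) < (w : ℤ) - p := by omega
  have k1 : (a w - a p) * ((v : ℤ) - u) ≤ (a v - a u) * ((w : ℤ) - p) := by
    refine le_of_mul_le_mul_right ?_ e2
    have f1 := mul_le_mul_of_nonneg_right h1 e4.le
    have f2 := mul_le_mul_of_nonneg_right h2 e1.le
    linarith
  refine le_of_mul_le_mul_right ?_ e4
  have f1 := mul_le_mul_of_nonneg_right h3 e1.le
  have f2 := mul_le_mul_of_nonneg_right h1 e4.le
  have f3 := mul_le_mul_of_nonneg_right k1 e3.le
  linarith

end

/-- The stack `v` of height `n` after the points with indices below `j` have been processed and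
some vertices have been removed on behalf of `j`. -/
structure HullState (a : ℕ → ℤ) (nz : ℕ → Prop) (j n : ℕ) (v : ℕ → ℕ) : Prop where
  vnz : ∀ i, i < n → nz (v i)
  lt : ∀ i, i < n → v i < j
  inc : ∀ i, i + 1 < n → v i < v (i + 1)
  dom : ∀ i, i + 1 < n → ∀ x, x < j → nz x → Dom a (v i) (v (i + 1)) x
  first : ∀ x, x < j → nz x → 0 < n ∧ v 0 ≤ x
  last : ∀ i, i + 1 = n → ∀ x, v i < x → x < j → nz x → nz j ∧ Dom a (v i) j x

section
variable {a : ℕ → ℤ} {nz : ℕ → Prop} {j n : ℕ} {v : ℕ → ℕ}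

theorem HullState.inc' (h : HullState a nz j n v) {i k : ℕ} (hik : i < k) (hk : k < n) :
    v i < v k := by
  induction k, hik using Nat.le_induction with
  | base => exact h.inc i hk
  | succ k hik ih => exact (ih (by omega)).trans (h.inc k hk)

/-- The conjunct `nz j` in `last` is what matters here: if `nz j` fails, there is no relevant point
beyond the top of the stack, so nothing has to be passed on to `j + 1`. -/
theorem HullState.skip (h : HullState a nz j n v) (hj : ¬ nz j) : HullState a nz (j + 1) n v := by
  have key : ∀ x, x < j + 1 → nz x → x < j := fun x h1 h2 => by
    rcases Nat.lt_or_ge x j with h3 | h3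
    · exact h3
    · obtain rfl : x = j := by omega
      exact absurd h2 hj
  exact ⟨h.vnz, fun i hi => (h.lt i hi).trans (Nat.lt_succ_self j), h.inc,
    fun i hi x h1 h2 => h.dom i hi x (key x h1 h2) h2, fun x h1 h2 => h.first x (key x h1 h2) h2,
    fun i hi x h1 h2 h3 => absurd (h.last i hi x h1 (key x h2 h3) h3).1 hj⟩

/-- The removed vertex lies under the chord from its predecessor to `j`. So do the points beyond it,
by `last`, and those between the two vertices, by `dom`. -/
theorem HullState.pop (h : HullState a nz j (n + 2) v) (hj : nz j)
    (hp : (a (v (n + 1)) - a j) * ((v (n + 1) : ℤ) - v n) ≤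
      (a (v n) - a (v (n + 1))) * ((j : ℤ) - v (n + 1))) : HullState a nz j (n + 1) v := by
  have h1 := dom_of_pop hp
  have h2 := h.inc n (by omega)
  have h3 := h.lt n (by omega)
  have h4 := h.lt (n + 1) (by omega)
  refine ⟨fun i hi => h.vnz i (by omega), fun i hi => h.lt i (by omega),
    fun i hi => h.inc i (by omega), fun i hi => h.dom i (by omega),
    fun x hx hnz => ⟨by omega, (h.first x hx hnz).2⟩, fun i hi x h5 h6 h7 => ⟨hj, ?_⟩⟩
  obtain rfl : i = n := by omega
  rcases Nat.lt_or_ge (v (i + 1)) x with h8 | h8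
  · exact (h.last (i + 1) rfl x h8 h6 h7).2.trans_right h4 h6.le h3 h1
  · exact (h.dom i (by omega) x h6 h7).trans_left h2 h5.le h3 h1

/-- When no removal is due, `j` is under the last edge and, by concavity, under all edges. The
points already processed are under the new edge by `last` beyond the old top and by `Dom.next` up to
it. -/
theorem HullState.push (h : HullState a nz j n v) (hj : nz j)
    (hp : ∀ i, i + 2 = n → (a (v i) - a (v (i + 1))) * ((j : ℤ) - v (i + 1)) ≤
      (a (v (i + 1)) - a j) * ((v (i + 1) : ℤ) - v i)) :
    HullState a nz (j + 1) (n + 1) (Function.update v n j) := by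
  have key : ∀ i, i < n → Function.update v n j i = v i := fun i hi =>
    Function.update_of_ne hi.ne _ _
  have keyn : Function.update v n j n = j := Function.update_self _ _ _
  refine ⟨fun i hi => ?_, fun i hi => ?_, fun i hi => ?_, fun i hi x hx hnz => ?_,
    fun x hx hnz => ⟨by omega, ?_⟩, fun i hi x h1 h2 => ?_⟩
  · rcases Nat.lt_or_ge i n with h1 | h1
    · rw [key i h1]; exact h.vnz i h1
    · obtain rfl : i = n := by omega
      rw [keyn]; exact hj
  · rcases Nat.lt_or_ge i n with h1 | h1
    · rw [key i h1]; exact (h.lt i h1).trans (Nat.lt_succ_self j)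
    · obtain rfl : i = n := by omega
      rw [keyn]; exact Nat.lt_succ_self j
  · rw [key i (by omega)]
    rcases Nat.lt_or_ge (i + 1) n with h1 | h1
    · rw [key _ h1]; exact h.inc i h1
    · obtain rfl : i + 1 = n := by omega
      rw [keyn]; exact h.lt i (by omega)
  · rw [key i (by omega)]
    rcases Nat.lt_or_ge (i + 1) n with h1 | h1
    · rw [key _ h1]
      rcases Nat.lt_or_ge x j with h2 | h2
      · exact h.dom i h1 x h2 hnz
      obtain rfl : x = j := by omega
      obtain ⟨k, rfl⟩ : ∃ k, n = k + 2 := ⟨n - 2, by omega⟩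
      have h3 := dom_of_not_pop (hp k rfl)
      rcases Nat.lt_or_ge i k with h4 | h4
      · exact Dom.extend (h.inc i h1) (h.inc' (by omega) (by omega)) (h.lt (k + 1) (by omega))
          (h.inc k (by omega)) (h.dom i h1 _ (h.lt _ (by omega)) (h.vnz _ (by omega)))
          (h.dom k (by omega) _ (h.lt _ h1) (h.vnz _ h1)) h3
      · obtain rfl : i = k := by omega
        exact h3
    · obtain rfl : i + 1 = n := by omega
      rw [keyn]
      rcases Nat.lt_or_ge x j with h2 | h2
      swap
      · obtain rfl : x = j := by omega
        exact dom_right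
      rcases Nat.lt_or_ge (v i) x with h3 | h3
      · exact (h.last i rfl x h3 h2 hnz).2
      rcases i with _ | i
      · obtain rfl : x = v 0 := le_antisymm h3 (h.first x h2 hnz).2
        exact dom_left
      · exact (h.dom i (by omega) x h2 hnz).next (h.inc i (by omega)) (h.lt _ (by omega)) h3
          (dom_of_not_pop (hp i rfl))
  · rcases n.eq_zero_or_pos with rfl | h1
    · rw [keyn]
      by_contra hcon
      exact absurd (h.first x (by omega) hnz).1 (by omega)
    · rw [key 0 h1]
      rcases Nat.lt_or_ge x j with h2 | h2
      · exact (h.first x h2 hnz).2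
      · exact (h.lt 0 h1).le.trans h2
  · obtain rfl : i = n := by omega
    rw [keyn] at h1
    omega

theorem HullState.zero : HullState a nz 0 0 v :=
  ⟨fun _ h => by omega, fun _ h => by omega, fun _ h => by omega, fun _ h => by omega,
    fun _ h => by omega, fun _ h => by omega⟩

end

/-! ### The program for the hull -/

/-- One step of the computation of the hull: register 30 holds `j`, register 31 the height of the
stack. -/
def hullBody : Prog :=
  block (.instr (.load 33 5 30)) [
    .ifPos 33
      (block (.instr (.sub 34 31 7)) [
        .ifPos 34
          (block (.instr (.sub 35 34 7)) [.instr (.load 36 7 34), .instr (.load 37 7 35),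
            .instr (.load 38 4 36), .instr (.load 39 4 37), .instr (.load 40 4 30),
            .instr (.sub 39 39 38), .instr (.sub 38 38 40), .instr (.sub 40 30 36),
            .instr (.sub 41 36 37), .instr (.mul 39 39 40), .instr (.mul 38 38 41),
            .instr (.sub 39 39 38), .instr (.add 39 39 7)])
          (.instr (.const 39 0)),
        .ifPos 39 (.instr (.sub 31 31 7))
          (block (.instr (.store 7 31 30)) [.instr (.add 31 31 7), .instr (.add 30 30 7)])])
      (.instr (.add 30 30 7)),
    .instr (.add 32 1 7), .instr (.sub 32 32 30)]

def hullBounds : Bounds := Bounds.mk' [1, 7, 30, 31, 32] [] [7] [4, 5]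

def hullInit : Prog := block (.instr (.const 30 0)) [.instr (.const 31 0), .instr (.add 32 1 7)]

def hullPhase : Prog := .seq hullInit (.whilePos 32 hullBody)

def hullCost : ℕ :=
  hullInit.weight (Bounds.mk' [1, 7] [] [] []) + 5 * loopWeight 32 hullBody hullBounds

/-- The measure counts two for each index to come, for its push and its removal, and one for each
vertex on the stack. -/
structure HullInv (d : ℕ) (a : ℕ → ℤ) (nz : ℕ → Prop) (X Y : ℤ) (n : ℕ) (s : State) : Prop where
  r1 : s.reg 1 = d
  r7 : s.reg 7 = 1
  arr4 : ∀ i : ℕ, i ≤ d → s.arr 4 i = a i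
  arr5 : ∀ i : ℕ, i ≤ d → (0 < s.arr 5 i ↔ nz i)
  le4 : ∀ i, |s.arr 4 i| ≤ X
  le5 : ∀ i, |s.arr 5 i| ≤ X
  le7 : ∀ i, |s.arr 7 i| ≤ Y
  inp : s.inp = []
  idx : ∃ (j m : ℕ) (v : ℕ → ℕ), HullState a nz j m v ∧ s.reg 30 = j ∧ s.reg 31 = m ∧
    s.reg 32 = d + 1 - j ∧ j ≤ d + 1 ∧ m ≤ j ∧ n = 2 * (d + 1 - j) + m ∧
    ∀ i : ℕ, i < m → s.arr 7 i = v i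

theorem hull_step {d : ℕ} {a : ℕ → ℤ} {nz : ℕ → Prop} {X Y : ℤ} (hY : (d : ℤ) ≤ Y) (n : ℕ)
    (s : State) (h : HullInv d a nz X Y n s) (hpos : 0 < s.reg 32) :
    ∃ n' < n, HullInv d a nz X Y n' (run hullBody s) := by
  obtain ⟨r1, r7, arr4, arr5, le4, le5, le7, inp, ⟨j, m, v, H, r30, r31, r32, hjd, hmj, hn, hv⟩⟩ :=
    h
  have hj : j ≤ d := by omega
  have a1 := arr4 j hj
  have a2 := arr5 j hj
  have hjY : |(j : ℤ)| ≤ Y := by rw [Nat.abs_cast]; omega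
  generalize hs' : run hullBody s = s'
  by_cases c1 : 0 < s.arr 5 j
  swap
  · simp only [hullBody, block, run, Instr.eval, State.set, Function.update_apply, r30, r31, r7, r1,
      c1, reduceIte, Nat.reduceEqDiff] at hs'
    subst hs'
    refine ⟨n - 2, by omega, ?_⟩
    constructor <;> try simpa
    exact ⟨j + 1, m, v, H.skip (by rwa [← a2]), by simp, by simp [r31], by simp, by omega,
      by omega, by omega, hv⟩
  have hnz := a2.1 c1
  by_cases c2 : 0 < (m : ℤ) - 1
  · obtain ⟨m, rfl⟩ : ∃ k, m = k + 2 := ⟨m - 2, by omega⟩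
    have e1 : ((m + 2 : ℕ) : ℤ) - 1 = ((m + 1 : ℕ) : ℤ) := by push_cast; ring
    have e2 : ((m + 1 : ℕ) : ℤ) - 1 = (m : ℤ) := by push_cast; ring
    rw [e1] at c2
    have v1 := hv m (by omega)
    have v2 := hv (m + 1) (by omega)
    have b1 := arr4 (v m) (by have := H.lt m (by omega); omega)
    have b2 := arr4 (v (m + 1)) (by have := H.lt (m + 1) (by omega); omega)
    by_cases c3 : 0 < (a (v m) - a (v (m + 1))) * ((j : ℤ) - v (m + 1)) -
        (a (v (m + 1)) - a j) * ((v (m + 1) : ℤ) - v m) + 1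
    · simp only [hullBody, block, run, Instr.eval, State.set, Function.update_apply, r30, r31, r7,
        r1, c1, e1, e2, c2, v1, v2, b1, b2, a1, c3, reduceIte, Nat.reduceEqDiff] at hs'
      subst hs'
      refine ⟨n - 1, by omega, ?_⟩
      constructor <;> try simpa
      exact ⟨j, m + 1, v, H.pop hnz (by linarith), by simp [r30], by simp, by simp, by omega,
        by omega, by omega, fun i hi => hv i (by omega)⟩
    · simp only [hullBody, block, run, Instr.eval, State.set, Function.update_apply, r30, r31, r7,
        r1, c1, e1, e2, c2, v1, v2, b1, b2, a1, c3, reduceIte, Nat.reduceEqDiff] at hs'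
      subst hs'
      refine ⟨n - 1, by omega, ?_⟩
      constructor <;> try simpa
      · simpa using abs_update_le le7 hjY
      refine ⟨j + 1, m + 2 + 1, _, H.push hnz fun i hi => ?_, by simp, by simp, by simp,
        by omega, by omega, by omega, fun i hi => ?_⟩
      · obtain rfl : i = m := by omega
        linarith
      · rcases eq_or_ne i (m + 2) with rfl | hi'
        · simp
        · have : (i : ℤ) ≠ (m : ℤ) + 2 := by omega
          simpa [this, hi'] using hv i (by omega)
  · have c3 : ¬ (0 : ℤ) < 0 := lt_irrefl 0
    simp only [hullBody, block, run, Instr.eval, State.set, Function.update_apply, r30, r31, r7,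
      r1, c1, c2, c3, reduceIte, Nat.reduceEqDiff] at hs'
    subst hs'
    refine ⟨n - 1, by omega, ?_⟩
    constructor <;> try simpa
    · simpa using abs_update_le le7 hjY
    refine ⟨j + 1, m + 1, _, H.push hnz fun i hi => by omega, by simp, by simp, by simp,
      by omega, by omega, by omega, fun i hi => ?_⟩
    rcases eq_or_ne i m with rfl | hi'
    · simp
    · have : (i : ℤ) ≠ (m : ℤ) := by omega
      simpa [this, hi'] using hv i (by omega)

/-- The vertices of the upper hull. -/
structure Hull (d : ℕ) (a : ℕ → ℤ) (nz : ℕ → Prop) (m : ℕ) (v : ℕ → ℕ) : Prop where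
  vnz : ∀ i, i ≤ m → nz (v i)
  inc : ∀ i, i < m → v i < v (i + 1)
  dom : ∀ i, i < m → ∀ x, x ≤ d → nz x → Dom a (v i) (v (i + 1)) x
  first : ∀ x, x ≤ d → nz x → v 0 ≤ x
  last : v m = d

theorem hullPhase_runs {V W d : ℕ} {a : ℕ → ℤ} {nz : ℕ → Prop} {X Y : ℤ} {s : State} (hV : 1 ≤ V)
    (hVW : V ≤ W) (hXW : len X ≤ W) (hYV : len Y ≤ V) (hY : 66 * (d : ℤ) + 3 ≤ Y) (hd : 1 ≤ d)
    (hnz : nz d) (hnz' : ¬ nz (d + 1))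
    (r1 : s.reg 1 = d) (r7 : s.reg 7 = 1)
    (arr4 : ∀ i : ℕ, i ≤ d → s.arr 4 i = a i)
    (arr5 : ∀ i : ℕ, i ≤ d → (0 < s.arr 5 i ↔ nz i))
    (le4 : ∀ i, |s.arr 4 i| ≤ X) (le5 : ∀ i, |s.arr 5 i| ≤ X) (le7 : ∀ i, |s.arr 7 i| ≤ Y)
    (inp : s.inp = []) :
    ∃ s' m v, Runs hullPhase s (hullCost * (d * (V * W))) s' ∧ Hull d a nz m v ∧ m ≤ d ∧
      (∀ i : ℕ, i ≤ m → s'.arr 7 i = v i) ∧ ∀ i, |s'.arr 7 i| ≤ Y := by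
  have hsm : ∀ a : ℤ, -Y ≤ a → a ≤ Y → len a ≤ V := fun a h1 h2 =>
    (len_le_len h1 h2).trans hYV
  have hf : (Bounds.mk' [1, 7] [] [] []).Fits V W s := by
    refine Bounds.fits_mk' ?_ (by simp) (by simp) (by simp) (by simp [inp])
    simp only [List.forall_mem_cons, r1, r7]
    refine ⟨?_, ?_, by simp⟩ <;> apply hsm <;> omega
  have hrun := runs_of_fits hV hVW hf (p := hullInit) (by decide)
  have hI : HullInv d a nz X Y (2 * (d + 1 - 0) + 0) (run hullInit s) := by
    generalize hs' : run hullInit s = s'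
    simp only [hullInit, block, run, Instr.eval, State.set, Function.update_apply, r1, r7,
      reduceIte, Nat.reduceEqDiff] at hs'
    subst hs'
    constructor <;> try simpa
    exact ⟨0, 0, fun _ => 0, HullState.zero, by simp, by simp, by simp, by omega, le_rfl, rfl,
      fun i hi => by omega⟩
  have hfit : ∀ n s, HullInv d a nz X Y n s → hullBounds.Fits V W s := fun n s h => by
    obtain ⟨r1, r7, arr4, arr5, le4, le5, le7, inp,
      ⟨j, m, v, H, r30, r31, r32, hjd, hmj, hn, hv⟩⟩ := h
    refine Bounds.fits_mk' ?_ (by simp) ?_ ?_ (by simp [inp])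
    · simp only [List.forall_mem_cons, r1, r7, r30, r31, r32]
      refine ⟨?_, ?_, ?_, ?_, ?_, by simp⟩ <;> apply hsm <;> omega
    · simp only [List.forall_mem_cons]
      exact ⟨fun i => len_le_of_abs_le hYV (le7 i), by simp⟩
    · simp only [List.forall_mem_cons]
      exact ⟨fun i => len_le_of_abs_le hXW (le4 i), fun i => len_le_of_abs_le hXW (le5 i), by simp⟩
  obtain ⟨s', h1, h2, n', h3⟩ := runs_while hV hVW (x := 32) (p := hullBody) (A := hullBounds)
    (by decide) (by decide) hfit (hull_step (by omega)) _ _ hI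
  obtain ⟨-, -, -, -, -, -, le7, -, ⟨j, m, v, H, r30, r31, r32, hjd, hmj, hn, hv⟩⟩ := h3
  obtain rfl : j = d + 1 := by omega
  obtain ⟨k, rfl⟩ : ∃ k, m = k + 1 := ⟨m - 1, by have := (H.first d (by omega) hnz).1; omega⟩
  refine ⟨s', k, v, (hrun.seq h1).mono (cost_le (by omega) hd),
    ⟨fun i hi => H.vnz i (by omega), fun i hi => H.inc i (by omega),
      fun i hi x hx => H.dom i (by omega) x (by omega), fun x hx h => (H.first x (by omega) h).2,
      ?_⟩, by omega, fun i hi => hv i (by omega), le7⟩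
  have := H.lt k (by omega)
  by_contra hcon
  -- A top vertex below `d` would force the relevance of the nonexistent index `d + 1`.
  exact hnz' (H.last k rfl d (by omega) (by omega) hnz).1

/-! ### The rounded slopes of the upper hull -/

/-- The slope, scaled by `I`, of edge number `k`. -/
def edgeSlope (a : ℕ → ℤ) (v : ℕ → ℕ) (I : ℤ) (k : ℕ) : ℤ :=
  (a (v k) - a (v (k + 1))) * I / ((v (k + 1) : ℤ) - v k)

/-- The slope of the edge from the left of the index `i`. -/
def slope (a : ℕ → ℤ) (v : ℕ → ℕ) (I : ℤ) (m i : ℕ) : ℤ :=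
  edgeSlope a v I (Nat.findGreatest (fun k => v k < i) m)

section
variable {d m : ℕ} {a : ℕ → ℤ} {nz : ℕ → Prop} {v : ℕ → ℕ} {I : ℤ}

theorem Hull.inc' (h : Hull d a nz m v) {i k : ℕ} (hik : i ≤ k) (hk : k ≤ m) : v i ≤ v k := by
  induction k, hik using Nat.le_induction with
  | base => exact le_rfl
  | succ k hik ih => exact (ih (by omega)).trans (h.inc k hk).le

theorem Hull.le_d (h : Hull d a nz m v) {i : ℕ} (hi : i ≤ m) : v i ≤ d :=
  h.last ▸ h.inc' hi le_rfl

theorem Hull.findGreatest_eq (h : Hull d a nz m v) {i k : ℕ} (hk : k < m) (h1 : v k < i)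
    (h2 : i ≤ v (k + 1)) : Nat.findGreatest (fun k => v k < i) m = k := by
  rw [Nat.findGreatest_eq_iff]
  refine ⟨hk.le, fun _ => h1, fun n h3 h4 => ?_⟩
  have := h.inc' (by omega : k + 1 ≤ n) h4
  omega

theorem Hull.slope_eq (h : Hull d a nz m v) {i k : ℕ} (hk : k < m) (h1 : v k < i)
    (h2 : i ≤ v (k + 1)) : slope a v I m i = edgeSlope a v I k := by
  rw [slope, h.findGreatest_eq hk h1 h2]

theorem Hull.exists_edge (h : Hull d a nz m v) {i : ℕ} (h1 : v 0 < i) (h2 : i ≤ d) :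
    ∃ k < m, v k < i ∧ i ≤ v (k + 1) := by
  have h3 : v (Nat.findGreatest (fun k => v k < i) m) < i :=
    Nat.findGreatest_spec (P := fun k => v k < i) (Nat.zero_le m) h1
  have h4 : Nat.findGreatest (fun k => v k < i) m ≤ m := Nat.findGreatest_le m
  set k := Nat.findGreatest (fun k => v k < i) m with hk
  have h5 : k < m := by
    rcases h4.lt_or_eq with h5 | h5
    · exact h5
    · rw [h5, h.last] at h3; omega
  refine ⟨k, h5, h3, ?_⟩
  have := Nat.findGreatest_is_greatest (P := fun k => v k < i) (Nat.lt_succ_self k) h5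
  exact not_lt.1 this

/-- Rounding down is monotone, so it is enough to compare the exact slopes of adjacent edges: the
end of the second edge lies under the line of the first. -/
theorem Hull.edgeSlope_mono (h : Hull d a nz m v) (hI : 0 < I) {i k : ℕ} (hik : i ≤ k)
    (hk : k < m) : edgeSlope a v I i ≤ edgeSlope a v I k := by
  induction k, hik using Nat.le_induction with
  | base => exact le_rfl
  | succ k hik ih =>
    refine (ih (by omega)).trans ?_
    have h1 := h.inc k (by omega)
    have h2 := h.inc (k + 1) hk
    have hD := h.dom k (by omega) (v (k + 2)) (h.le_d (by omega)) (h.vnz _ (by omega))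
    unfold Dom at hD
    have p1 : (0 : ℤ) < (v (k + 1) : ℤ) - v k := by omega
    have p2 : (0 : ℤ) < (v (k + 1 + 1) : ℤ) - v (k + 1) := by omega
    have hx := Int.ediv_mul_le ((a (v k) - a (v (k + 1))) * I) p1.ne'
    change edgeSlope a v I k * _ ≤ _ at hx
    refine (Int.le_ediv_iff_mul_le p2).2 (le_of_mul_le_mul_right ?_ p1)
    have e1 := mul_le_mul_of_nonneg_right hx p2.le
    have e2 : (a (v k) - a (v (k + 1))) * ((v (k + 1 + 1) : ℤ) - v (k + 1)) ≤
      (a (v (k + 1)) - a (v (k + 1 + 1))) * ((v (k + 1) : ℤ) - v k) := by linarith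
    have e3 := mul_le_mul_of_nonneg_left e2 hI.le
    linarith

theorem Hull.sorted (h : Hull d a nz m v) (hI : 0 < I) : SortedOn (v 0) d (slope a v I m) := by
  intro i j h1 h2 h3
  obtain ⟨k, hk, k1, k2⟩ := h.exists_edge h1 (h2.trans h3)
  obtain ⟨l, hl, l1, l2⟩ := h.exists_edge (h1.trans_le h2) h3
  rw [h.slope_eq hk k1 k2, h.slope_eq hl l1 l2]
  refine h.edgeSlope_mono hI ?_ hl
  by_contra hcon
  have := h.inc' (by omega : l + 1 ≤ k) hk.le
  omega

theorem Hull.pre_add (h : Hull d a nz m v) {k : ℕ} (hk : k < m) (r : ℕ)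
    (hr : v k + r ≤ v (k + 1)) : pre (v 0) (slope a v I m) (v k + r) =
      pre (v 0) (slope a v I m) (v k) + r * edgeSlope a v I k := by
  induction r with
  | zero => simp
  | succ r ih =>
    rw [← add_assoc, pre_succ _ ((h.inc' (Nat.zero_le k) hk.le).trans (Nat.le_add_right _ _)),
      ih (by omega), h.slope_eq hk (by omega) (by omega)]
    push_cast
    ring

/-- Rounding a slope down loses less than one for each index of the edge, so the rounded hull is
never below a vertex and above it by at most the number of indices passed. -/
theorem Hull.vertex_bounds (h : Hull d a nz m v) {k : ℕ} (hk : k ≤ m) :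
    a (v k) * I + pre (v 0) (slope a v I m) (v k) ≤ a (v 0) * I ∧
    a (v 0) * I - (v k - v 0) ≤ a (v k) * I + pre (v 0) (slope a v I m) (v k) := by
  induction k with
  | zero => simp [pre_self]
  | succ k ih =>
    obtain ⟨h1, h2⟩ := ih (by omega)
    have h3 := h.inc k hk
    have h4 := h.pre_add (I := I) (k := k) hk (v (k + 1) - v k) (by omega)
    rw [Nat.add_sub_cancel' h3.le, Nat.cast_sub h3.le] at h4
    have p1 : (0 : ℤ) < (v (k + 1) : ℤ) - v k := by omega
    have e1 := Int.mul_ediv_self_le (x := (a (v k) - a (v (k + 1))) * I) p1.ne'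
    have e2 := Int.lt_mul_ediv_self_add (x := (a (v k) - a (v (k + 1))) * I) p1
    change _ * edgeSlope a v I k ≤ _ at e1
    change _ < _ * edgeSlope a v I k + _ at e2
    constructor <;> linarith

/-- The slopes describe the hull up to an error of at most `d`. -/
structure SlopeSpec (b d : ℕ) (a : ℕ → ℤ) (nz : ℕ → Prop) (I : ℤ) (σ : ℕ → ℤ) : Prop where
  bd : b ≤ d
  sorted : SortedOn b d σ
  le : ∀ j, j ≤ d → nz j → b ≤ j ∧ a j * I + pre b σ j ≤ a b * I
  ge : ∀ k, b ≤ k → k ≤ d → (k = b ∨ k = d ∨ σ k < σ (k + 1)) →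
    nz k ∧ a b * I - d ≤ a k * I + pre b σ k

/-- The upper bound holds at all relevant points since they are under the edges. The lower bound
needs a vertex, and a place where the rounded slope changes is one. -/
theorem Hull.slopeSpec (h : Hull d a nz m v) (hI : 0 < I) :
    SlopeSpec (v 0) d a nz I (slope a v I m) := by
  refine ⟨h.le_d (Nat.zero_le m), h.sorted hI, fun j hj hnz => ⟨h.first j hj hnz, ?_⟩,
    fun k h1 h2 h3 => ?_⟩
  · rcases (h.first j hj hnz).lt_or_eq with h1 | rfl
    · obtain ⟨k, hk, k1, k2⟩ := h.exists_edge h1 hj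
      have h4 := h.pre_add (I := I) (k := k) hk (j - v k) (by omega)
      rw [Nat.add_sub_cancel' k1.le, Nat.cast_sub k1.le] at h4
      rw [h4]
      have h5 := (h.vertex_bounds (I := I) hk.le).1
      have hD := h.dom k hk j hj hnz
      unfold Dom at hD
      have p1 : (0 : ℤ) < (v (k + 1) : ℤ) - v k := by omega
      have p2 : (0 : ℤ) < (j : ℤ) - v k := by omega
      have e1 := Int.mul_ediv_self_le (x := (a (v k) - a (v (k + 1))) * I) p1.ne'
      change _ * edgeSlope a v I k ≤ _ at e1
      have e2 : (a j - a (v k)) * I ≤ - (((j : ℤ) - v k) * edgeSlope a v I k) := by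
        refine le_of_mul_le_mul_right ?_ p1
        have f1 := mul_le_mul_of_nonneg_left e1 p2.le
        have f2 := mul_le_mul_of_nonneg_right hD hI.le
        linarith
      linarith
    · simp [pre_self]
  · obtain ⟨i, hi, rfl⟩ : ∃ i ≤ m, k = v i := by
      rcases h3 with rfl | rfl | h3
      · exact ⟨0, Nat.zero_le m, rfl⟩
      · exact ⟨m, le_rfl, h.last.symm⟩
      · rcases h1.lt_or_eq with h1 | rfl
        swap
        · exact ⟨0, Nat.zero_le m, rfl⟩
        rcases h2.lt_or_eq with h2 | rfl
        swap
        · exact ⟨m, le_rfl, h.last.symm⟩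
        obtain ⟨i, hi, k1, k2⟩ := h.exists_edge h1 h2.le
        refine ⟨i + 1, hi, ?_⟩
        by_contra hcon
        rw [h.slope_eq hi k1 k2, h.slope_eq hi (k1.trans (Nat.lt_succ_self k)) (by omega)] at h3
        exact lt_irrefl _ h3
    refine ⟨h.vnz i hi, ?_⟩
    have := (h.vertex_bounds (I := I) hi).2
    have : (0 : ℤ) ≤ v 0 := Int.natCast_nonneg _
    have : (v i : ℤ) ≤ d := by exact_mod_cast h2
    linarith

theorem abs_slope_le {α : ℤ} (ha : ∀ i, |a i| ≤ α) (hI : 0 < I) (i : ℕ) :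
    |slope a v I m i| ≤ 2 * α * I := by
  unfold slope edgeSlope
  set k := Nat.findGreatest (fun k => v k < i) m
  have h1 := Int.natAbs_ediv_le_natAbs ((a (v k) - a (v (k + 1))) * I) ((v (k + 1) : ℤ) - v k)
  zify at h1
  refine h1.trans ?_
  rw [abs_mul, abs_of_pos hI]
  have h2 := abs_sub (a (v k)) (a (v (k + 1)))
  have h3 := ha (v k)
  have h4 := ha (v (k + 1))
  exact mul_le_mul_of_nonneg_right (by linarith) hI.le

end

/-! ### The program for the slopes and their partial sums -/

theorem abs_pre_le {b : ℕ} {σ : ℕ → ℤ} {B : ℤ} (hσ : ∀ i, |σ i| ≤ B) (j : ℕ) :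
    |pre b σ j| ≤ j * B := by
  have hB : 0 ≤ B := (abs_nonneg _).trans (hσ 0)
  unfold pre
  calc |∑ i ∈ Finset.Ioc b j, σ i| ≤ ∑ i ∈ Finset.Ioc b j, |σ i| := Finset.abs_sum_le_sum_abs _ _
    _ ≤ ∑ i ∈ Finset.Ioc b j, B := Finset.sum_le_sum fun i _ => hσ i
    _ = ((j - b : ℕ) : ℤ) * B := by simp
    _ ≤ j * B := mul_le_mul_of_nonneg_right (by omega) hB

/-- One step of the computation of the slopes and of their partial sums: register 40 holds the
index, register 41 the number of the edge. -/
def slopeBody : Prog :=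
  block (.instr (.load 46 7 41)) [.instr (.add 47 41 7), .instr (.load 47 7 47),
    .instr (.sub 48 40 47),
    .ifPos 48 (.instr (.add 41 41 7))
      (block (.instr (.load 48 4 46)) [.instr (.load 49 4 47), .instr (.sub 48 48 49),
        .instr (.mul 48 48 2), .instr (.sub 49 47 46), .instr (.div 43 48 49),
        .instr (.store 8 40 43), .instr (.add 42 42 43), .instr (.store 9 40 42),
        .instr (.add 40 40 7)]),
    .instr (.add 45 1 7), .instr (.sub 45 45 40)]

def slopeBounds : Bounds := Bounds.mk' [1, 2, 7, 40, 41, 45] [42, 43] [7] [4]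

def slopeInit : Prog :=
  block (.instr (.const 41 0)) [.instr (.load 8 7 41), .instr (.add 40 8 7), .instr (.const 42 0),
    .instr (.store 9 8 42), .instr (.const 43 0), .instr (.add 45 1 7), .instr (.sub 45 45 40)]

def slopePhase : Prog := .seq slopeInit (.whilePos 45 slopeBody)

def slopeCost : ℕ :=
  slopeInit.weight (Bounds.mk' [1, 7] [] [7] []) + 4 * loopWeight 45 slopeBody slopeBounds

/-- Register 43 keeps the latest slope, from which the sweep builds its sentinel. Each round
advances either the index or the edge. -/
structure SlopeInv (d : ℕ) (a : ℕ → ℤ) (m : ℕ) (v : ℕ → ℕ) (I : ℕ) (X Y : ℤ) (n : ℕ)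
    (s : State) : Prop where
  r1 : s.reg 1 = d
  r2 : s.reg 2 = I
  r7 : s.reg 7 = 1
  r8 : s.reg 8 = v 0
  arr4 : ∀ i : ℕ, i ≤ d → s.arr 4 i = a i
  arr7 : ∀ i : ℕ, i ≤ m → s.arr 7 i = v i
  le4 : ∀ i, |s.arr 4 i| ≤ X
  le7 : ∀ i, |s.arr 7 i| ≤ Y
  le8 : ∀ i, |s.arr 8 i| ≤ X
  le9 : ∀ i, |s.arr 9 i| ≤ X
  inp : s.inp = []
  idx : ∃ i k : ℕ, s.reg 40 = i + 1 ∧ s.reg 41 = k ∧ s.reg 45 = d + 1 - (i + 1) ∧ v 0 ≤ i ∧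
    i ≤ d ∧ k ≤ m ∧ (i < d → k < m ∧ v k < i + 1) ∧ n = (d - i) + (m - k) ∧
    s.reg 42 = pre (v 0) (slope a v I m) i ∧ |s.reg 43| ≤ X ∧
    (v 0 < i → s.reg 43 = slope a v I m i) ∧
    (∀ j : ℕ, v 0 < j → j ≤ i → s.arr 8 j = slope a v I m j) ∧
    (∀ j : ℕ, v 0 ≤ j → j ≤ i → s.arr 9 j = pre (v 0) (slope a v I m) j)

theorem slope_step {d : ℕ} {a : ℕ → ℤ} {nz : ℕ → Prop} {m : ℕ} {v : ℕ → ℕ} {I : ℕ} {X Y : ℤ}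
    (H : Hull d a nz m v) (hX : ∀ i, |slope a v I m i| ≤ X)
    (hX' : ∀ i ≤ d, |pre (v 0) (slope a v I m) i| ≤ X) (n : ℕ) (s : State)
    (h : SlopeInv d a m v I X Y n s) (hpos : 0 < s.reg 45) :
    ∃ n' < n, SlopeInv d a m v I X Y n' (run slopeBody s) := by
  obtain ⟨r1, r2, r7, r8, arr4, arr7, le4, le7, le8, le9, inp,
    ⟨i, k, r40, r41, r45, hvi, hid, hkm, hk, hn, r42, r43, r43', h8, h9⟩⟩ := h
  obtain ⟨hk1, hk2⟩ := hk (by omega)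
  have a1 := arr7 k hkm
  have a2 := arr7 (k + 1) hk1
  push_cast at a2
  have hd1 := H.le_d hkm
  have hd2 := H.le_d (i := k + 1) hk1
  have a3 := arr4 _ hd1
  have a4 := arr4 _ hd2
  generalize hs' : run slopeBody s = s'
  by_cases c1 : 0 < (i : ℤ) + 1 - v (k + 1)
  · simp only [slopeBody, block, run, Instr.eval, State.set, Function.update_apply, r40, r41, r7,
      r1, a1, a2, c1, reduceIte, Nat.reduceEqDiff] at hs'
    subst hs'
    have : k + 1 < m := by
      by_contra hcon
      obtain rfl : m = k + 1 := by omega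
      rw [H.last] at c1
      omega
    refine ⟨n - 1, by omega, ?_⟩
    constructor <;> try simpa
    exact ⟨i, k + 1, by simp [r40], by simp, by simp, hvi, hid, hk1,
      fun _ => ⟨this, by omega⟩, by omega, by simp [r42], by simpa using r43,
      fun h => by simpa using r43' h, h8, h9⟩
  · simp only [slopeBody, block, run, Instr.eval, State.set, Function.update_apply, r40, r41, r7,
      r1, r2, r42, a1, a2, a3, a4, c1, reduceIte, Nat.reduceEqDiff] at hs'
    have hsl : slope a v I m (i + 1) = edgeSlope a v I k := H.slope_eq hk1 hk2 (by omega)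
    have hpre := pre_succ (slope a v I m) hvi
    have hsl' : (a (v k) - a (v (k + 1))) * (I : ℤ) / ((v (k + 1) : ℤ) - v k) =
      slope a v I m (i + 1) := hsl.symm
    rw [hsl', ← hpre] at hs'
    subst hs'
    refine ⟨n - 1, by omega, ?_⟩
    constructor <;> try simpa
    · simpa using abs_update_le le8 (hX (i + 1))
    · simpa using abs_update_le le9 (hX' (i + 1) (by omega))
    refine ⟨i + 1, k, by simp, by simp [r41], by simp, by omega, by omega, hkm,
      fun _ => ⟨hk1, by omega⟩, by omega, by simp, by simpa using hX (i + 1), fun h => by simp,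
      fun j h1 h2 => ?_, fun j h1 h2 => ?_⟩
    · rcases eq_or_ne j (i + 1) with rfl | hj
      · simp
      · have : (j : ℤ) ≠ (i : ℤ) + 1 := by omega
        simpa [this] using h8 j h1 (by omega)
    · rcases eq_or_ne j (i + 1) with rfl | hj
      · simp
      · have : (j : ℤ) ≠ (i : ℤ) + 1 := by omega
        simpa [this] using h9 j h1 (by omega)

theorem slopePhase_runs {V W d : ℕ} {a : ℕ → ℤ} {nz : ℕ → Prop} {m : ℕ} {v : ℕ → ℕ} {I : ℕ}
    {X Y : ℤ} {s : State} (hV : 1 ≤ V) (hVW : V ≤ W) (hXW : len X ≤ W) (hYV : len Y ≤ V)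
    (hY : 66 * (d : ℤ) + 3 ≤ Y) (hIY : (I : ℤ) ≤ Y) (hd : 1 ≤ d) (hmd : m ≤ d)
    (H : Hull d a nz m v) (hX : ∀ i, |slope a v I m i| ≤ X)
    (hX' : ∀ i ≤ d, |pre (v 0) (slope a v I m) i| ≤ X)
    (r1 : s.reg 1 = d) (r2 : s.reg 2 = I) (r7 : s.reg 7 = 1)
    (arr4 : ∀ i : ℕ, i ≤ d → s.arr 4 i = a i) (arr7 : ∀ i : ℕ, i ≤ m → s.arr 7 i = v i)
    (le4 : ∀ i, |s.arr 4 i| ≤ X) (le7 : ∀ i, |s.arr 7 i| ≤ Y) (le8 : ∀ i, |s.arr 8 i| ≤ X)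
    (le9 : ∀ i, |s.arr 9 i| ≤ X) (inp : s.inp = []) :
    ∃ s', Runs slopePhase s (slopeCost * (d * (V * W))) s' ∧ s'.reg 8 = v 0 ∧
      |s'.reg 43| ≤ X ∧ (v 0 < d → s'.reg 43 = slope a v I m d) ∧
      (∀ j : ℕ, v 0 < j → j ≤ d → s'.arr 8 j = slope a v I m j) ∧
      (∀ j : ℕ, v 0 ≤ j → j ≤ d → s'.arr 9 j = pre (v 0) (slope a v I m) j) ∧
      (∀ i, |s'.arr 8 i| ≤ X) ∧ (∀ i, |s'.arr 9 i| ≤ X) := by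
  have hsm : ∀ a : ℤ, -Y ≤ a → a ≤ Y → len a ≤ V := fun a h1 h2 =>
    (len_le_len h1 h2).trans hYV
  have hX0 : (0 : ℤ) ≤ X := (abs_nonneg _).trans (hX 0)
  have hf : (Bounds.mk' [1, 7] [] [7] []).Fits V W s := by
    refine Bounds.fits_mk' ?_ (by simp) ?_ (by simp) (by simp [inp])
    · simp only [List.forall_mem_cons, r1, r7]
      refine ⟨?_, ?_, by simp⟩ <;> apply hsm <;> omega
    · simp only [List.forall_mem_cons]
      exact ⟨fun i => len_le_of_abs_le hYV (le7 i), by simp⟩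
  have hrun := runs_of_fits hV hVW hf (p := slopeInit) (by decide)
  have hv0 := H.le_d (Nat.zero_le m)
  have hI : SlopeInv d a m v I X Y ((d - v 0) + (m - 0)) (run slopeInit s) := by
    have a0 := arr7 0 (Nat.zero_le m)
    rw [Nat.cast_zero] at a0
    generalize hs' : run slopeInit s = s'
    simp only [slopeInit, block, run, Instr.eval, State.set, Function.update_apply, r1, r7, a0,
      reduceIte, Nat.reduceEqDiff] at hs'
    subst hs'
    constructor <;> try simpa
    · simpa using abs_update_le le9 (by simpa using hX0)
    refine ⟨v 0, 0, by simp, by simp, by simp, le_rfl, hv0, Nat.zero_le m, fun h => ⟨?_, by simp⟩,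
      rfl, by simp [pre_self], by simpa using hX0, fun h => by omega, fun j h1 h2 => by omega,
      fun j h1 h2 => ?_⟩
    · by_contra hcon
      obtain rfl : m = 0 := by omega
      rw [H.last] at h
      omega
    · obtain rfl : j = v 0 := by omega
      simp [pre_self]
  have hfit : ∀ n s, SlopeInv d a m v I X Y n s → slopeBounds.Fits V W s := fun n s h => by
    obtain ⟨r1, r2, r7, r8, arr4, arr7, le4, le7, le8, le9, inp,
      ⟨i, k, r40, r41, r45, hvi, hid, hkm, hk, hn, r42, r43, r43', h8, h9⟩⟩ := h
    refine Bounds.fits_mk' ?_ ?_ ?_ ?_ (by simp [inp])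
    · simp only [List.forall_mem_cons, r1, r2, r7, r40, r41, r45]
      refine ⟨?_, ?_, ?_, ?_, ?_, ?_, by simp⟩ <;> apply hsm <;> omega
    · simp only [List.forall_mem_cons, r42]
      exact ⟨len_le_of_abs_le hXW (hX' i hid), len_le_of_abs_le hXW r43, by simp⟩
    · simp only [List.forall_mem_cons]
      exact ⟨fun i => len_le_of_abs_le hYV (le7 i), by simp⟩
    · simp only [List.forall_mem_cons]
      exact ⟨fun i => len_le_of_abs_le hXW (le4 i), by simp⟩
  obtain ⟨s', h1, h2, n', h3⟩ := runs_while hV hVW (x := 45) (p := slopeBody) (A := slopeBounds)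
    (by decide) (by decide) hfit (slope_step H hX hX') _ _ hI
  obtain ⟨-, -, -, r8, -, -, -, -, le8, le9, -,
    ⟨i, k, r40, r41, r45, hvi, hid, hkm, hk, hn, r42, r43, r43', h8, h9⟩⟩ := h3
  obtain rfl : i = d := by omega
  exact ⟨s', (hrun.seq h1).mono (cost_le (by omega) hd), r8, r43, r43', h8, h9, le8, le9⟩

/-! ### Reading the input -/

def Float2.size (x : Float2) : ℤ := (Nat.size x.man.natAbs : ℤ)

/-- The largest of the numbers `e` such that the real or the imaginary part of `x` is nonzero and has
magnitude in `[2 ^ (e - 1), 2 ^ e)`. -/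
def CFloat.log (x : CFloat) : ℤ :=
  if 0 < x.re.size then
    if 0 < x.im.size then
      if 0 < x.im.size + x.im.exp - (x.re.size + x.re.exp) then
        x.re.size + x.re.exp + (x.im.size + x.im.exp - (x.re.size + x.re.exp))
      else x.re.size + x.re.exp
    else x.re.size + x.re.exp
  else x.im.size + x.im.exp

def zeroFloat : CFloat := ⟨⟨0, 0⟩, ⟨0, 0⟩⟩

def readFloat : Prog :=
  block (.instr (.read 10)) [.instr (.read 11), .instr (.read 12), .instr (.read 13)]

def storeFloat : Prog :=
  block (.instr (.store 0 20 10)) [.instr (.store 1 20 11), .instr (.store 2 20 12),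
    .instr (.store 3 20 13)]

/-- Register 19 is always zero: assigning it serves as an empty branch, and adding it copies a
register. Register 18 ends up positive exactly for a nonzero coefficient. -/
def computeLog : Prog :=
  block (.instr (.size 14 10)) [.instr (.size 15 12), .instr (.add 16 14 11),
    .instr (.add 17 15 13), .instr (.const 19 0),
    .ifPos 14
      (.ifPos 15 (.seq (.instr (.sub 18 17 16))
        (.ifPos 18 (.instr (.add 16 16 18)) (.instr (.const 19 0)))) (.instr (.const 19 0)))
      (.instr (.add 16 17 19)),
    .instr (.add 18 14 15)]

def storeLog : Prog :=
  block (.instr (.store 4 20 16)) [.instr (.store 5 20 18), .instr (.add 20 20 7),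
    .instr (.add 21 1 7), .instr (.sub 21 21 20)]

def readBody : Prog := block readFloat [storeFloat, computeLog, storeLog]

def readBounds : Bounds := Bounds.mk' [1, 7, 20, 21] [] [] []

def readInit : Prog :=
  block (.instr (.read 0)) [.instr (.read 1), .instr (.const 7 1), .instr (.const 20 0),
    .instr (.add 21 1 7)]

def readPhase : Prog := .seq readInit (.whilePos 21 readBody)

def readCost : ℕ :=
  readInit.weight (Bounds.mk' [] [] [] []) + 3 * loopWeight 21 readBody readBounds

/-- The coefficients are stored in the arrays `0` to `3`. -/
structure Stored (d : ℕ) (c : List CFloat) (W : ℕ) (j : ℕ) (s : State) : Prop where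
  arr0 : ∀ i : ℕ, i < j → s.arr 0 i = (c.getD i zeroFloat).re.man
  arr1 : ∀ i : ℕ, i < j → s.arr 1 i = (c.getD i zeroFloat).re.exp
  arr2 : ∀ i : ℕ, i < j → s.arr 2 i = (c.getD i zeroFloat).im.man
  arr3 : ∀ i : ℕ, i < j → s.arr 3 i = (c.getD i zeroFloat).im.exp
  len0 : ∀ i, len (s.arr 0 i) ≤ W
  len1 : ∀ i, len (s.arr 1 i) ≤ W
  len2 : ∀ i, len (s.arr 2 i) ≤ W
  len3 : ∀ i, len (s.arr 3 i) ≤ W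

structure ReadInv (d : ℕ) (m : ℤ) (c : List CFloat) (W : ℕ) (α : ℤ) (n : ℕ) (s : State) :
    Prop where
  r0 : s.reg 0 = m
  r1 : s.reg 1 = d
  r7 : s.reg 7 = 1
  le4 : ∀ i, |s.arr 4 i| ≤ α
  le5 : ∀ i, |s.arr 5 i| ≤ α
  out : s.out = []
  zero : ∀ x, 6 ≤ x → s.arr x = fun _ => 0
  idx : ∃ j : ℕ, s.reg 20 = j ∧ s.reg 21 = d + 1 - j ∧ j ≤ d + 1 ∧ n = d + 1 - j ∧
    s.inp = (c.drop j).flatMap CFloat.encode ∧ Stored d c W j s ∧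
    (∀ i : ℕ, i < j → s.arr 4 i = (c.getD i zeroFloat).log) ∧
    (∀ i : ℕ, i < j → s.arr 5 i = (c.getD i zeroFloat).re.size + (c.getD i zeroFloat).im.size)

theorem len_update_le {f : ℤ → ℤ} {W : ℕ} {x v : ℤ} (hf : ∀ i, len (f i) ≤ W) (hv : len v ≤ W)
    (i : ℤ) : len (Function.update f x v i) ≤ W := by
  rw [Function.update_apply]
  split_ifs
  exacts [hv, hf i]

theorem update_eq_of_lt {f : ℤ → ℤ} {g : ℕ → ℤ} {j : ℕ} (h : ∀ i : ℕ, i < j → f i = g i) {v : ℤ}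
    (hv : v = g j) (i : ℕ) (hi : i < j + 1) : Function.update f (j : ℤ) v i = g i := by
  rw [Function.update_apply]
  split_ifs with h1
  · rw [hv, Nat.cast_inj.1 h1]
  · exact h i (by omega)

theorem run_readFloat {s : State} {a b c d : ℤ} {l : List ℤ} (h : s.inp = a :: b :: c :: d :: l) :
    (run readFloat s).reg 0 = s.reg 0 ∧ (run readFloat s).reg 1 = s.reg 1 ∧
    (run readFloat s).reg 7 = s.reg 7 ∧ (run readFloat s).reg 20 = s.reg 20 ∧
    (run readFloat s).reg 10 = a ∧ (run readFloat s).reg 11 = b ∧ (run readFloat s).reg 12 = c ∧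
    (run readFloat s).reg 13 = d ∧ (run readFloat s).arr = s.arr ∧ (run readFloat s).inp = l ∧
    (run readFloat s).out = s.out := by
  simp [readFloat, block, run, Instr.eval, State.set, h]

theorem run_storeFloat (s : State) :
    (run storeFloat s).reg 0 = s.reg 0 ∧ (run storeFloat s).reg 1 = s.reg 1 ∧
    (run storeFloat s).reg 7 = s.reg 7 ∧ (run storeFloat s).reg 20 = s.reg 20 ∧
    (run storeFloat s).reg 10 = s.reg 10 ∧ (run storeFloat s).reg 11 = s.reg 11 ∧
    (run storeFloat s).reg 12 = s.reg 12 ∧ (run storeFloat s).reg 13 = s.reg 13 ∧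
    (run storeFloat s).arr = Function.update (Function.update (Function.update
      (Function.update s.arr 0 (Function.update (s.arr 0) (s.reg 20) (s.reg 10)))
      1 (Function.update (s.arr 1) (s.reg 20) (s.reg 11)))
      2 (Function.update (s.arr 2) (s.reg 20) (s.reg 12)))
      3 (Function.update (s.arr 3) (s.reg 20) (s.reg 13)) ∧
    (run storeFloat s).inp = s.inp ∧ (run storeFloat s).out = s.out := by
  simp [storeFloat, block, run, Instr.eval]

theorem run_computeLog {s : State} {x : CFloat} (h10 : s.reg 10 = x.re.man)
    (h11 : s.reg 11 = x.re.exp) (h12 : s.reg 12 = x.im.man) (h13 : s.reg 13 = x.im.exp) :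
    (run computeLog s).reg 0 = s.reg 0 ∧ (run computeLog s).reg 1 = s.reg 1 ∧
    (run computeLog s).reg 7 = s.reg 7 ∧ (run computeLog s).reg 20 = s.reg 20 ∧
    (run computeLog s).reg 16 = x.log ∧ (run computeLog s).reg 18 = x.re.size + x.im.size ∧
    (run computeLog s).arr = s.arr ∧
    (run computeLog s).inp = s.inp ∧ (run computeLog s).out = s.out := by
  generalize hs' : run computeLog s = s'
  by_cases c1 : 0 < x.re.size
  · by_cases c2 : 0 < x.im.size
    · by_cases c3 : 0 < x.im.size + x.im.exp - (x.re.size + x.re.exp) <;>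
      · rw [CFloat.log, if_pos c1, if_pos c2]
        simp only [c3, reduceIte]
        unfold Float2.size at *
        simp only [computeLog, block, run, Instr.eval, State.set, Function.update_apply, h10, h11,
          h12, h13, c1, c2, c3, reduceIte, Nat.reduceEqDiff] at hs'
        subst hs'
        simp
    · rw [CFloat.log, if_pos c1, if_neg c2]
      unfold Float2.size at *
      simp only [computeLog, block, run, Instr.eval, State.set, Function.update_apply, h10, h11,
        h12, h13, c1, c2, reduceIte, Nat.reduceEqDiff] at hs'
      subst hs'
      simp
  · rw [CFloat.log, if_neg c1]
    unfold Float2.size at *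
    simp only [computeLog, block, run, Instr.eval, State.set, Function.update_apply, h10, h11,
      h12, h13, c1, reduceIte, Nat.reduceEqDiff, add_zero] at hs'
    subst hs'
    simp

theorem read_step {d : ℕ} {m : ℤ} {c : List CFloat} {W : ℕ} {α : ℤ} (hc : c.length = d + 1)
    (hlen : ∀ x ∈ c, ∀ v ∈ x.encode, len v ≤ W) (hlog : ∀ x ∈ c, |x.log| ≤ α)
    (hsize : ∀ x ∈ c, |x.re.size + x.im.size| ≤ α) (n : ℕ) (s : State)
    (h : ReadInv d m c W α n s) (hpos : 0 < s.reg 21) :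
    ∃ n' < n, ReadInv d m c W α n' (run readBody s) := by
  obtain ⟨r0, r1, r7, le4, le5, out, zero, ⟨j, r20, r21, hj, hn, inp, S, h4, h5⟩⟩ := h
  obtain ⟨s0, s1, s2, s3, l0, l1, l2, l3⟩ := S
  have hjc : j < c.length := by omega
  have hmem : (c)[j] ∈ c := List.getElem_mem hjc
  have hget : c.getD j zeroFloat = (c)[j] := by simp [hjc]
  set x := (c)[j] with hx
  rw [List.drop_eq_getElem_cons hjc, ← hx, List.flatMap_cons] at inp
  have inp' : s.inp = x.re.man :: x.re.exp :: x.im.man :: x.im.exp ::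
      (c.drop (j + 1)).flatMap CFloat.encode := by
    rw [inp]; simp [CFloat.encode, Float2.encode]
  have k0 : len x.re.man ≤ W := hlen x hmem _ (by simp [CFloat.encode, Float2.encode])
  have k1 : len x.re.exp ≤ W := hlen x hmem _ (by simp [CFloat.encode, Float2.encode])
  have k2 : len x.im.man ≤ W := hlen x hmem _ (by simp [CFloat.encode, Float2.encode])
  have k3 : len x.im.exp ≤ W := hlen x hmem _ (by simp [CFloat.encode, Float2.encode])
  obtain ⟨s', hs', q0, q1, q7, q20, q21, harr, hinp, hout⟩ : ∃ s', run readBody s = s' ∧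
      s'.reg 0 = m ∧ s'.reg 1 = d ∧ s'.reg 7 = 1 ∧ s'.reg 20 = (j : ℤ) + 1 ∧
      s'.reg 21 = (d : ℤ) + 1 - (j + 1) ∧
      s'.arr = Function.update (Function.update (Function.update (Function.update
        (Function.update (Function.update s.arr 0 (Function.update (s.arr 0) j x.re.man))
        1 (Function.update (s.arr 1) j x.re.exp)) 2 (Function.update (s.arr 2) j x.im.man))
        3 (Function.update (s.arr 3) j x.im.exp)) 4 (Function.update (s.arr 4) j x.log))
        5 (Function.update (s.arr 5) j (x.re.size + x.im.size)) ∧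
      s'.inp = (c.drop (j + 1)).flatMap CFloat.encode ∧ s'.out = s.out := by
    refine ⟨_, rfl, ?_⟩
    simp only [readBody, block, run]
    obtain ⟨f0, f1, f7, f20, f10, f11, f12, f13, farr, finp, fout⟩ := run_readFloat inp'
    generalize run readFloat s = s₁ at *
    obtain ⟨g0, g1, g7, g20, g10, g11, g12, g13, garr, ginp, gout⟩ := run_storeFloat s₁
    generalize run storeFloat s₁ = s₂ at *
    obtain ⟨h0, h1, h7, h20, h16, h18, harr, hinp, hout⟩ := run_computeLog (x := x) (s := s₂)
      (by rw [g10, f10]) (by rw [g11, f11]) (by rw [g12, f12]) (by rw [g13, f13])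
    generalize run computeLog s₂ = s₃ at *
    simp only [storeLog, block, run, Instr.eval, State.set, Function.update_apply, reduceIte,
      Nat.reduceEqDiff, h0, g0, f0, h1, g1, f1, h7, g7, f7, h20, g20, f20, h16, h18, hinp, ginp,
      finp, hout, gout, fout, harr, garr, farr, f10, f11, f12, f13, r0, r1, r7, r20]
    simp
  rw [hs']
  refine ⟨n - 1, by omega, ?_, ?_, ?_, ?_, ?_, by rw [hout, out], ?_, j + 1, ?_, ?_, by omega,
    by omega, hinp, ⟨?_, ?_, ?_, ?_, ?_, ?_, ?_, ?_⟩, ?_, ?_⟩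
  · exact q0
  · exact q1
  · exact q7
  · rw [harr]; simpa using abs_update_le le4 (hlog x hmem)
  · rw [harr]; simpa using abs_update_le le5 (hsize x hmem)
  · intro y hy
    rw [harr, ← zero y hy]
    rw [Function.update_of_ne (by omega), Function.update_of_ne (by omega),
      Function.update_of_ne (by omega), Function.update_of_ne (by omega),
      Function.update_of_ne (by omega), Function.update_of_ne (by omega)]
  · rw [q20]; simp
  · rw [q21]; simp
  · rw [harr]; simpa using update_eq_of_lt s0 (by rw [hget])
  · rw [harr]; simpa using update_eq_of_lt s1 (by rw [hget])
  · rw [harr]; simpa using update_eq_of_lt s2 (by rw [hget])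
  · rw [harr]; simpa using update_eq_of_lt s3 (by rw [hget])
  · rw [harr]; simpa using len_update_le l0 k0
  · rw [harr]; simpa using len_update_le l1 k1
  · rw [harr]; simpa using len_update_le l2 k2
  · rw [harr]; simpa using len_update_le l3 k3
  · rw [harr]; simpa using update_eq_of_lt h4 (by rw [hget])
  · rw [harr]
    simpa using update_eq_of_lt (g := fun i => (c.getD i zeroFloat).re.size +
      (c.getD i zeroFloat).im.size) h5 (by rw [hget])

theorem readPhase_runs {V W d m : ℕ} {c : List CFloat} {α Y : ℤ} (hV : 1 ≤ V) (hVW : V ≤ W)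
    (hYV : len Y ≤ V) (hY : 66 * (d : ℤ) + 3 ≤ Y) (hd : 1 ≤ d) (hα : 0 ≤ α)
    (hmW : len m ≤ W) (hc : c.length = d + 1)
    (hlen : ∀ x ∈ c, ∀ v ∈ x.encode, len v ≤ W) (hlog : ∀ x ∈ c, |x.log| ≤ α)
    (hsize : ∀ x ∈ c, |x.re.size + x.im.size| ≤ α) :
    ∃ s', Runs readPhase (State.init (encodeInput m d c)) (readCost * (d * (V * W))) s' ∧
      s'.reg 0 = m ∧ s'.reg 1 = d ∧ s'.reg 7 = 1 ∧ (∀ i, |s'.arr 4 i| ≤ α) ∧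
      (∀ i, |s'.arr 5 i| ≤ α) ∧ s'.inp = [] ∧ s'.out = [] ∧ (∀ x, 6 ≤ x → s'.arr x = fun _ => 0) ∧
      Stored d c W (d + 1) s' ∧ (∀ i : ℕ, i ≤ d → s'.arr 4 i = (c.getD i zeroFloat).log) ∧
      ∀ i : ℕ, i ≤ d →
        s'.arr 5 i = (c.getD i zeroFloat).re.size + (c.getD i zeroFloat).im.size := by
  have hsm : ∀ a : ℤ, -Y ≤ a → a ≤ Y → len a ≤ V := fun a h1 h2 =>
    (len_le_len h1 h2).trans hYV
  have hflat : ∀ j, ∀ v ∈ (c.drop j).flatMap CFloat.encode, len v ≤ W := fun j v hv => by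
    obtain ⟨x, hx, hv⟩ := List.mem_flatMap.1 hv
    exact hlen x (List.mem_of_mem_drop hx) v hv
  have hf : (Bounds.mk' [] [] [] []).Fits V W (State.init (encodeInput m d c)) := by
    refine Bounds.fits_mk' (by simp) (by simp) (by simp) (by simp) fun v hv => ?_
    simp only [State.init, encodeInput, List.cons_append, List.nil_append, List.mem_cons] at hv
    rcases hv with rfl | rfl | hv
    · exact hmW
    · exact (hsm _ (by omega) (by omega)).trans hVW
    · exact hflat 0 v (by simpa using hv)
  have hrun := runs_of_fits hV hVW hf (p := readInit) (by decide)
  have h0 : len 0 ≤ W := by simpa [len] using hV.trans hVW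
  have hI : ReadInv d m c W α (d + 1) (run readInit (State.init (encodeInput m d c))) := by
    generalize hs' : run readInit (State.init (encodeInput m d c)) = s'
    simp only [readInit, block, run, Instr.eval, State.set, Function.update_apply, State.init,
      encodeInput, List.cons_append, List.nil_append, List.headD_cons, List.tail_cons,
      reduceIte, Nat.reduceEqDiff] at hs'
    subst hs'
    refine ⟨by simp, by simp, by simp, by simpa, by simpa, by simp, by simp, 0, by simp, by simp,
      by simp, by simp, by simp, ⟨?_, ?_, ?_, ?_, ?_, ?_, ?_, ?_⟩, ?_, ?_⟩ <;> simp [h0]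
  have hfit : ∀ n s, ReadInv d m c W α n s → readBounds.Fits V W s := fun n s h => by
    obtain ⟨r0, r1, r7, le4, le5, out, zero, ⟨j, r20, r21, hj, hn, inp, S, h4, h5⟩⟩ := h
    refine Bounds.fits_mk' ?_ (by simp) (by simp) (by simp) (by rw [inp]; exact hflat j)
    simp only [List.forall_mem_cons, r1, r7, r20, r21]
    refine ⟨?_, ?_, ?_, ?_, by simp⟩ <;> apply hsm <;> omega
  obtain ⟨s', h1, h2, n', h3⟩ := runs_while hV hVW (x := 21) (p := readBody) (A := readBounds)
    (by decide) (by decide) hfit (read_step hc hlen hlog hsize) _ _ hI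
  obtain ⟨r0, r1, r7, le4, le5, out, zero, ⟨j, r20, r21, hj, hn, inp, S, h4, h5⟩⟩ := h3
  obtain rfl : j = d + 1 := by omega
  refine ⟨s', (hrun.seq h1).mono (cost_le (by omega) hd), r0, r1, r7, le4, le5, ?_, out, zero, S,
    fun i hi => h4 i (by omega), fun i hi => h5 i (by omega)⟩
  rw [inp, ← hc, List.drop_length, List.flatMap_nil]

/-! ### The table of radii -/

/-- Rounded powers of `1 + 1 / K`, scaled by `K ^ 2`. -/
def tab (K : ℕ) : ℕ → ℕ
  | 0 => K ^ 2
  | i + 1 => tab K i + tab K i / K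

/-- `I` is the number of entries of the table below `2 * K ^ 2`. -/
structure IsPeriod (K I : ℕ) : Prop where
  le : 2 * K ^ 2 ≤ tab K I
  lt : ∀ i < I, tab K i < 2 * K ^ 2

theorem le_tab (K i : ℕ) : K ^ 2 + i * K ≤ tab K i := by
  induction i with
  | zero => simp [tab]
  | succ i ih =>
    rcases K.eq_zero_or_pos with rfl | hK
    · simp
    · have : K ≤ tab K i / K := by
        rw [Nat.le_div_iff_mul_le hK]
        nlinarith
      rw [tab]
      nlinarith

theorem lt_of_tab_lt {K i : ℕ} (h : tab K i < 2 * K ^ 2) : i < K := by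
  have := le_tab K i
  by_contra! h'
  nlinarith [Nat.mul_le_mul_right K h']

theorem tab_succ_le {K i : ℕ} (h : tab K i < 2 * K ^ 2) : tab K (i + 1) ≤ 4 * K ^ 2 := by
  have := Nat.div_le_self (tab K i) K
  rw [tab]
  omega

theorem IsPeriod.le_self {K I : ℕ} (h : IsPeriod K I) : I ≤ K := by
  by_contra! h'
  exact lt_irrefl _ (lt_of_tab_lt (h.lt K h'))

/-! ### The program for the table and the thresholds -/

def tableInit : Prog :=
  block (.instr (.const 22 1)) [.instr (.size 23 1), .instr (.const 24 8),
    .instr (.add 23 23 24)]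

def tableStart : Prog :=
  block (.instr (.mul 24 4 4)) [.instr (.add 3 23 23), .instr (.add 25 24 24),
    .instr (.const 2 0), .instr (.sub 26 25 24)]

def tableBody : Prog :=
  block (.instr (.store 6 2 24)) [.instr (.div 27 24 4), .instr (.add 24 24 27),
    .instr (.add 2 2 7), .instr (.sub 26 25 24)]

/-- Register 5 becomes the threshold `(m + 3) * I` for negligible terms, register 6 the target `m *
I - 8 * d` for index width times ring width. The `3` and the `8` absorb the rounding errors in
`term_le` and in `FineGrid.rad_ratio`. -/
def tableEnd : Prog :=
  block (.instr (.const 27 3)) [.instr (.add 27 27 0), .instr (.mul 5 27 2),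
    .instr (.mul 6 0 2), .instr (.const 27 8), .instr (.mul 27 27 1), .instr (.sub 6 6 27)]

def tablePhase : Prog :=
  block tableInit [.instr (.shl 4 22 23), tableStart, .whilePos 26 tableBody, tableEnd]

def tableStartBounds : Bounds := Bounds.mk' [4, 23] [] [] []

def tableBounds : Bounds := Bounds.mk' [2, 4, 7, 24, 25, 26] [] [] []

def tableEndBounds : Bounds := Bounds.mk' [1, 2] [0] [] []

def tableCost : ℕ :=
  tableInit.weight (Bounds.mk' [1] [] [] []) + 4 + tableStart.weight tableStartBounds +
    tableEnd.weight tableEndBounds + 513 * loopWeight 26 tableBody tableBounds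

structure TableInv (K : ℕ) (s₀ : State) (n : ℕ) (s : State) : Prop where
  same : SameExcept [2, 24, 26, 27] [6] false s₀ s
  idx : ∃ i : ℕ, s.reg 2 = i ∧ s.reg 24 = tab K i ∧ s.reg 26 = 2 * K ^ 2 - tab K i ∧ n = K - i ∧
    i ≤ K ∧ tab K i ≤ 4 * K ^ 2 ∧
    (∀ j < i, tab K j < 2 * K ^ 2) ∧ (∀ j : ℕ, j < i → s.arr 6 j = tab K j) ∧
    ∀ j, |s.arr 6 j| ≤ 4 * K ^ 2

theorem table_step {K : ℕ} {s₀ : State} (h4 : s₀.reg 4 = K) (h7 : s₀.reg 7 = 1)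
    (h25 : s₀.reg 25 = 2 * K ^ 2) (n : ℕ) (s : State) (h : TableInv K s₀ n s)
    (hpos : 0 < s.reg 26) : ∃ n' < n, TableInv K s₀ n' (run tableBody s) := by
  obtain ⟨same, i, r2, r24, r26, hn, hi, hle, hlt, h6, hb⟩ := h
  have r4 : s.reg 4 = K := by rw [same.reg _ (by decide), h4]
  have r7 : s.reg 7 = 1 := by rw [same.reg _ (by decide), h7]
  have r25 : s.reg 25 = 2 * K ^ 2 := by rw [same.reg _ (by decide), h25]
  have ht : tab K i < 2 * K ^ 2 := by zify; linarith
  have hiK := lt_of_tab_lt ht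
  have hs := same.trans ((run_sameExcept tableBody s).mono (by decide) (by decide) (by decide))
  refine ⟨n - 1, by omega, hs, i + 1, ?_⟩
  generalize hs' : run tableBody s = s'
  simp only [tableBody, block, run, Instr.eval, State.set, Function.update_apply,
    r2, r24, r4, r7, r25, reduceIte, Nat.reduceEqDiff] at hs'
  subst hs'
  have e1 : (tab K (i + 1) : ℤ) = tab K i + tab K i / K := by rw [tab]; push_cast; rfl
  refine ⟨by simp, by simp [e1], by simp [e1], by omega, by omega, tab_succ_le ht,
    fun j hj => ?_, ?_, ?_⟩
  · rcases Nat.lt_succ_iff_lt_or_eq.1 hj with hj | rfl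
    exacts [hlt j hj, ht]
  · simpa using update_eq_of_lt (g := fun i => (tab K i : ℤ)) h6 rfl
  · have : |(tab K i : ℤ)| ≤ 4 * K ^ 2 := by
      rw [abs_of_nonneg (by positivity)]; exact_mod_cast hle
    simpa using abs_update_le hb this

/-- The first bound makes the grid fine enough for exponents up to `d`, the second keeps the table
linear in `d`. -/
theorem size_two_pow_bounds {d : ℕ} (hd : 1 ≤ d) :
    256 * d < 2 ^ (d.size + 8) ∧ 2 ^ (d.size + 8) ≤ 512 * d := by
  have h1 := Nat.lt_size_self d
  have h0 : 0 < d.size := Nat.size_pos.2 hd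
  obtain ⟨k, hk⟩ : ∃ k, d.size = k + 1 := ⟨d.size - 1, by omega⟩
  have h2 : 2 ^ k ≤ d := Nat.lt_size.1 (by omega)
  rw [hk] at h1 ⊢
  rw [pow_succ] at h1
  rw [show k + 1 + 8 = k + 9 by omega, pow_add]
  omega

theorem tablePhase_runs {V W d m K : ℕ} {Y : ℤ} {s : State} (hV : 1 ≤ V) (hVW : V ≤ W)
    (hYV : len Y ≤ V) (hY : 4 * (K : ℤ) ^ 2 ≤ Y) (hK : K = 2 ^ (d.size + 8)) (hd : 1 ≤ d)
    (hmW : len m ≤ W) (r0 : s.reg 0 = m) (r1 : s.reg 1 = d) (r7 : s.reg 7 = 1)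
    (h6 : s.arr 6 = fun _ => 0) (inp : s.inp = []) :
    ∃ s' I, Runs tablePhase s (tableCost * (d * (V * W))) s' ∧ IsPeriod K I ∧ s'.reg 2 = I ∧
      s'.reg 3 = 2 * (d.size + 8) ∧ s'.reg 5 = (m + 3) * I ∧
      s'.reg 6 = m * I - 8 * d ∧ (∀ i : ℕ, i < I → s'.arr 6 i = tab K i) ∧
      ∀ i, |s'.arr 6 i| ≤ 4 * K ^ 2 := by
  obtain ⟨hK1, hK2⟩ := size_two_pow_bounds hd
  rw [← hK] at hK1 hK2
  have hsm : ∀ a : ℤ, -Y ≤ a → a ≤ Y → len a ≤ V := fun a h1 h2 =>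
    (len_le_len h1 h2).trans hYV
  have hKK : (K : ℤ) * 256 ≤ K ^ 2 := by
    have : (256 : ℤ) ≤ K := by omega
    nlinarith
  have hdV : len (d : ℤ) ≤ V := hsm _ (by omega) (by omega)
  have hKV : len (K : ℤ) ≤ V := hsm _ (by omega) (by omega)
  have hlenK : len (K : ℤ) = d.size + 8 + 2 := by
    rw [len, Int.natAbs_natCast, hK, Nat.size_pow]
  have f0 : (Bounds.mk' [1] [] [] []).Fits V W s :=
    Bounds.fits_mk' (by simpa [r1]) (by simp) (by simp) (by simp) (by simp [inp])
  have g0 := runs_of_fits hV hVW f0 (p := tableInit) (by decide)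
  obtain ⟨s₁, hs₁, a0, a1, a7, a22, a23, aarr, ainp⟩ : ∃ s₁, run tableInit s = s₁ ∧
      s₁.reg 0 = m ∧ s₁.reg 1 = d ∧ s₁.reg 7 = 1 ∧ s₁.reg 22 = 1 ∧ s₁.reg 23 = (d.size + 8 : ℕ) ∧
      s₁.arr = s.arr ∧ s₁.inp = [] := by
    refine ⟨_, rfl, ?_⟩
    simp [tableInit, block, run, Instr.eval, State.set, r0, r1, r7, inp]
  rw [hs₁] at g0
  -- The length of a left shift depends on a value and not on lengths, so its cost is bounded by
  -- hand.
  have g1 : Runs (.instr (.shl 4 22 23)) s₁ (4 * (V * W)) (s₁.set 4 K) := by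
    refine ⟨_, ?_, (by
      have := Exec.instr (.shl 4 22 23) s₁
      simp only [Instr.eval, a22, a23, Int.toNat_natCast, one_mul] at this
      rw [hK]
      push_cast
      exact this)⟩
    simp only [Instr.cost, a22, a23, Int.toNat_natCast]
    have e1 : len (1 : ℤ) = 2 := by decide
    have e2 : len ((d.size + 8 : ℕ) : ℤ) ≤ len (K : ℤ) :=
      len_natCast_mono (by rw [hK]; exact Nat.lt_two_pow_self.le)
    have e3 : V ≤ V * W := Nat.le_mul_of_pos_right _ (hV.trans hVW)
    omega
  set s₂ := s₁.set 4 K with hs₂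
  have b0 : s₂.reg 0 = m := by simp [hs₂, State.set, a0]
  have b1 : s₂.reg 1 = d := by simp [hs₂, State.set, a1]
  have b7 : s₂.reg 7 = 1 := by simp [hs₂, State.set, a7]
  have b4 : s₂.reg 4 = K := by simp [hs₂, State.set]
  have b23 : s₂.reg 23 = (d.size + 8 : ℕ) := by simp [hs₂, State.set, a23]
  have barr : s₂.arr 6 = fun _ => 0 := by simp [hs₂, State.set, aarr, h6]
  have binp : s₂.inp = [] := by simp [hs₂, State.set, ainp]
  clear_value s₂
  have f2 : tableStartBounds.Fits V W s₂ := by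
    refine Bounds.fits_mk' ?_ (by simp) (by simp) (by simp) (by simp [binp])
    simp only [List.forall_mem_cons, b4, b23]
    have : d.size + 8 < K := by rw [hK]; exact Nat.lt_two_pow_self
    refine ⟨hKV, ?_, by simp⟩
    apply hsm <;> omega
  have g2 := runs_of_fits hV hVW f2 (p := tableStart) (by decide)
  obtain ⟨s₃, hs₃, c0, c1, c2, c3, c4, c7, c24, c25, c26, carr, cinp⟩ : ∃ s₃,
      run tableStart s₂ = s₃ ∧ s₃.reg 0 = m ∧ s₃.reg 1 = d ∧ s₃.reg 2 = 0 ∧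
      s₃.reg 3 = 2 * (d.size + 8) ∧ s₃.reg 4 = K ∧ s₃.reg 7 = 1 ∧
      s₃.reg 24 = (K : ℤ) ^ 2 ∧ s₃.reg 25 = 2 * (K : ℤ) ^ 2 ∧
      s₃.reg 26 = 2 * (K : ℤ) ^ 2 - K ^ 2 ∧ s₃.arr 6 = (fun _ => 0) ∧ s₃.inp = [] := by
    refine ⟨_, rfl, ?_⟩
    simp [tableStart, block, run, Instr.eval, State.set, b0, b1, b4, b7,
      b23, barr, binp, ← two_mul, ← sq]
  rw [hs₃] at g2
  have hI : TableInv K s₃ K s₃ := by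
    refine ⟨⟨fun _ _ => rfl, fun _ _ => rfl, fun _ => rfl, fun _ => rfl⟩, 0, c2, ?_, ?_, by omega,
      by omega, by simp [tab]; omega, by omega, by omega, fun j => ?_⟩
    · simp [c24, tab]
    · simp [c26, tab]
    · simp [carr]
  have hfit : ∀ n s, TableInv K s₃ n s → tableBounds.Fits V W s := fun n s h => by
    obtain ⟨same, i, r2, r24, r26, hn, hi, hle, hlt, h6, hb⟩ := h
    have r4 : s.reg 4 = K := by rw [same.reg _ (by decide), c4]
    have r7 : s.reg 7 = 1 := by rw [same.reg _ (by decide), c7]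
    have r25 : s.reg 25 = 2 * K ^ 2 := by rw [same.reg _ (by decide), c25]
    have hle' : (tab K i : ℤ) ≤ 4 * K ^ 2 := by exact_mod_cast hle
    refine Bounds.fits_mk' ?_ (by simp) (by simp) (by simp)
      (by rw [same.inp rfl, cinp]; simp)
    simp only [List.forall_mem_cons, r2, r4, r7, r24, r25, r26]
    refine ⟨?_, ?_, ?_, ?_, ?_, ?_, by simp⟩ <;> apply hsm <;> omega
  obtain ⟨s₄, g3, hx, n', same, I, q2, q24, q26, hn, hi, hle, hlt, q6, hb⟩ :=
    runs_while hV hVW (x := 26) (p := tableBody) (A := tableBounds)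
    (by decide) (by decide) hfit (table_step c4 c7 c25) _ _ hI
  have hper : IsPeriod K I := ⟨by zify; linarith, hlt⟩
  have k0 : s₄.reg 0 = m := by rw [same.reg _ (by decide), c0]
  have k1 : s₄.reg 1 = d := by rw [same.reg _ (by decide), c1]
  have k3 : s₄.reg 3 = 2 * (d.size + 8) := by rw [same.reg _ (by decide), c3]
  have f4 : tableEndBounds.Fits V W s₄ := by
    refine Bounds.fits_mk' ?_ ?_ (by simp) (by simp) (by rw [same.inp rfl, cinp]; simp)
    · simp only [List.forall_mem_cons, k1, q2]
      refine ⟨hdV, ?_, by simp⟩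
      apply hsm <;> omega
    · simp only [List.forall_mem_cons, k0]
      exact ⟨hmW, by simp⟩
  have g4 := runs_of_fits hV hVW f4 (p := tableEnd) (by decide)
  refine ⟨run tableEnd s₄, I, ?_, hper, ?_⟩
  · refine (g0.seq (g1.seq (g2.seq (g3.seq g4)))).mono ?_
    have hA : ∀ x, x * (V * W) ≤ x * (d * (V * W)) := fun x =>
      Nat.mul_le_mul_left x (Nat.le_mul_of_pos_left _ hd)
    have hB : (K + 1) * (loopWeight 26 tableBody tableBounds * (V * W)) ≤
        513 * loopWeight 26 tableBody tableBounds * (d * (V * W)) := by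
      calc _ ≤ (513 * d) * (loopWeight 26 tableBody tableBounds * (V * W)) :=
            Nat.mul_le_mul_right _ (by omega)
        _ = _ := by ring
    rw [tableCost]
    simp only [add_mul] at hB ⊢
    have := hA (tableInit.weight (Bounds.mk' [1] [] [] []))
    have := hA 4
    have := hA (tableStart.weight tableStartBounds)
    have := hA (tableEnd.weight tableEndBounds)
    omega
  · simp only [tableEnd, block, run, Instr.eval, State.set, Function.update_apply, k0, k1, q2,
      reduceIte, Nat.reduceEqDiff]
    exact ⟨trivial, k3, by ring, trivial, q6, hb⟩

/-! ### The radii of the grid -/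

theorem tab_le_pow {K : ℕ} (hK : 1 ≤ K) (i : ℕ) :
    (tab K i : ℝ) ≤ K ^ 2 * (1 + 1 / K) ^ i := by
  induction i with
  | zero => simp [tab]
  | succ i ih =>
    have h : ((tab K i / K : ℕ) : ℝ) ≤ tab K i / K := Nat.cast_div_le
    rw [tab]
    push_cast
    calc (tab K i : ℝ) + (tab K i / K : ℕ) ≤ tab K i * (1 + 1 / K) := by
          rw [mul_add, mul_one, mul_one_div]; linarith
      _ ≤ K ^ 2 * (1 + 1 / K) ^ i * (1 + 1 / K) := by gcongr
      _ = _ := by ring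

/-- Rounding down loses at most `1`, which is at most `tab K i / K ^ 2`. This is why the table is
scaled by `K ^ 2`. -/
theorem pow_le_tab {K : ℕ} (hK : 1 ≤ K) (i : ℕ) :
    K ^ 2 * (1 + 1 / K - 1 / K ^ 2 : ℝ) ^ i ≤ tab K i := by
  have hK' : (1 : ℝ) ≤ K := by exact_mod_cast hK
  have h0 : (1 : ℝ) ≤ 1 + 1 / K - 1 / K ^ 2 := by
    have : (1 : ℝ) / K ^ 2 ≤ 1 / K := by
      gcongr
      nlinarith
    linarith
  induction i with
  | zero => simp [tab]
  | succ i ih =>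
    have h : (tab K i : ℝ) / K - 1 ≤ (tab K i / K : ℕ) := by
      have : tab K i < (tab K i / K + 1) * K := by
        rw [add_mul, one_mul, mul_comm]
        exact Nat.lt_mul_div_succ _ hK
      have h2 : (tab K i : ℝ) < ((tab K i / K : ℕ) + 1) * K := by exact_mod_cast this
      rw [sub_le_iff_le_add, div_le_iff₀ (by positivity)]
      exact h2.le
    have h1 : (1 : ℝ) ≤ tab K i / K ^ 2 := by
      rw [le_div_iff₀ (by positivity), one_mul]
      have := le_tab K i
      exact_mod_cast (Nat.le_add_right _ _).trans this
    rw [tab]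
    push_cast
    calc (K : ℝ) ^ 2 * (1 + 1 / K - 1 / K ^ 2) ^ (i + 1)
        = ((K : ℝ) ^ 2 * (1 + 1 / K - 1 / K ^ 2) ^ i) * (1 + 1 / K - 1 / K ^ 2) := by
          rw [pow_succ _ i, mul_assoc]
      _ ≤ (tab K i : ℝ) * (1 + 1 / K - 1 / K ^ 2) := by gcongr
      _ = (tab K i : ℝ) + tab K i / K - tab K i / K ^ 2 := by ring
      _ ≤ _ := by linarith

theorem tab_lt_tab_succ {K : ℕ} (hK : 1 ≤ K) (i : ℕ) : tab K i < tab K (i + 1) := by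
  have h := le_tab K i
  have : 0 < tab K i / K := Nat.div_pos (by nlinarith) hK
  rw [tab]
  omega

theorem IsPeriod.pos {K I : ℕ} (hK : 1 ≤ K) (h : IsPeriod K I) : 0 < I := by
  rcases Nat.eq_zero_or_pos I with rfl | h'
  · have := h.le
    rw [tab] at this
    nlinarith
  · exact h'

/-- The grid point number `t`; its binary logarithm is about `t / I`. -/
noncomputable def rad (K I : ℕ) (t : ℤ) : ℝ :=
  (tab K (t % I).toNat : ℝ) / K ^ 2 * 2 ^ (t / (I : ℤ))

theorem rad_pos {K I : ℕ} (hK : 1 ≤ K) (t : ℤ) : 0 < rad K I t := by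
  have h := le_tab K (t % I).toNat
  have : 0 < tab K (t % I).toNat := by nlinarith
  unfold rad
  positivity

/-- Within an octave the table increases; at the end of an octave all entries used are below `2 * K
^ 2`, the start of the next. -/
theorem rad_strictMono {K I : ℕ} (hK : 1 ≤ K) (h : IsPeriod K I) : StrictMono (rad K I) := by
  have hI := h.pos hK
  have hI' : (0 : ℤ) < I := by exact_mod_cast hI
  refine strictMono_int_of_lt_succ fun t => ?_
  have h1 := Int.emod_add_mul_ediv t I
  have h2 := Int.emod_nonneg t hI'.ne'
  have h3 := Int.emod_lt_of_pos t hI'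
  obtain ⟨i, hi⟩ := Int.eq_ofNat_of_zero_le h2
  set e := t / (I : ℤ) with he
  have hiI : i < I := by omega
  unfold rad
  rw [← he, hi]
  rcases Nat.lt_or_ge (i + 1) I with h4 | h4
  · have e1 : (t + 1) / (I : ℤ) = e ∧ (t + 1) % (I : ℤ) = i + 1 :=
      (Int.ediv_emod_unique hI').2 ⟨by omega, by omega, by omega⟩
    rw [e1.1, e1.2, show ((i : ℤ) + 1).toNat = i + 1 by omega, Int.toNat_natCast]
    have := tab_lt_tab_succ hK i
    gcongr
  · have e1 : (t + 1) / (I : ℤ) = e + 1 ∧ (t + 1) % (I : ℤ) = 0 := by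
      refine (Int.ediv_emod_unique hI').2 ⟨?_, by omega, by omega⟩
      rw [mul_add]; omega
    have := h.lt i hiI
    have h5 : (tab K i : ℝ) < 2 * K ^ 2 := by exact_mod_cast this
    rw [e1.1, e1.2, Int.toNat_natCast, Int.toNat_zero, zpow_add_one₀ (by norm_num), tab,
      mul_comm ((2 : ℝ) ^ e), ← mul_assoc]
    refine mul_lt_mul_of_pos_right ?_ (by positivity)
    push_cast
    rw [div_lt_iff₀ (by positivity)]
    calc _ < _ := h5
      _ = _ := by field_simp

/-- The constant `1.45` is an upper bound of `1 / log 2`. -/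
theorem logb_one_add_le {x : ℝ} (hx : 0 ≤ x) : Real.logb 2 (1 + x) ≤ 1.45 * x := by
  have h2 := Real.log_two_gt_d9
  have h := Real.log_le_sub_one_of_pos (show 0 < 1 + x by linarith)
  rw [Real.logb, div_le_iff₀ (by linarith)]
  nlinarith

/-- The grid is logarithmic up to a relative error `3 / K`. -/
theorem IsPeriod.abs_logb_tab {K I : ℕ} (hK : 1 ≤ K) (h : IsPeriod K I) :
    K ≤ 2 * I ∧ ∀ i < I, |Real.logb 2 (tab K i / K ^ 2) - i / I| ≤ 3 / K := by
  have hI := h.pos hK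
  have hIK := h.le_self
  have hK' : (1 : ℝ) ≤ K := by exact_mod_cast hK
  have hI' : (1 : ℝ) ≤ I := by exact_mod_cast hI
  have hIK' : (I : ℝ) ≤ K := by exact_mod_cast hIK
  have hq : (1 : ℝ) / K ^ 2 ≤ 1 / K := by
    gcongr
    nlinarith
  have hqK : (1 : ℝ) / K ^ 2 * K = 1 / K := by field_simp
  have hK1 : (1 : ℝ) / K * K = 1 := by field_simp
  set q : ℝ := 1 / K ^ 2 with hq'
  set w : ℝ := 1 / K with hw'
  have hq0 : 0 < q := by positivity
  have hw0 : 0 < w := by positivity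
  set β := Real.logb 2 (1 + w) with hβ
  set γ := Real.logb 2 (1 + w - q) with hγ
  have tabpos : ∀ i, (0 : ℝ) < tab K i := fun i => by
    have h := le_tab K i
    have : 0 < tab K i := by nlinarith
    exact_mod_cast this
  have up : ∀ i, Real.logb 2 (tab K i / K ^ 2) ≤ i * β := fun i => by
    rw [hβ, ← Real.logb_pow]
    refine Real.logb_le_logb_of_le (by norm_num) (by have := tabpos i; positivity) ?_
    rw [div_le_iff₀ (by positivity), mul_comm]
    exact tab_le_pow hK i
  have low : ∀ i, i * γ ≤ Real.logb 2 (tab K i / K ^ 2) := fun i => by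
    rw [hγ, ← Real.logb_pow]
    refine Real.logb_le_logb_of_le (by norm_num) (pow_pos (by linarith) _) ?_
    rw [le_div_iff₀ (by positivity), mul_comm]
    exact pow_le_tab hK i
  have b1 : β ≤ 1.45 * w := logb_one_add_le hw0.le
  have g0 : 0 ≤ γ := Real.logb_nonneg (by norm_num) (by linarith)
  have gb : γ ≤ β := Real.logb_le_logb_of_le (by norm_num) (by linarith) (by linarith)
  have bg : β ≤ γ + 1.45 * q := by
    have hp : 0 < 1 + w - q := by linarith
    have : β = γ + Real.logb 2 (1 + q / (1 + w - q)) := by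
      rw [hβ, hγ, ← Real.logb_mul hp.ne' (by positivity)]
      congr 1
      field_simp
      ring
    rw [this]
    have h1 := logb_one_add_le (x := q / (1 + w - q)) (by positivity)
    have h2 : q / (1 + w - q) ≤ q := div_le_self hq0.le (by linarith)
    linarith
  -- Entry `I` has reached `2 * K ^ 2` and entry `I - 1` has not. This pins `1 / I` to the growth
  -- rates `γ` and `β` of the lower and upper bounds for the table.
  have c1 : 1 ≤ I * β := by
    refine le_trans ?_ (up I)
    rw [Real.le_logb_iff_rpow_le (by norm_num) (by have := tabpos I; positivity), Real.rpow_one,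
      le_div_iff₀ (by positivity)]
    exact_mod_cast h.le
  have c2 : (I - 1) * γ ≤ 1 := by
    have h1 := low (I - 1)
    rw [Nat.cast_pred hI] at h1
    refine h1.trans ?_
    rw [Real.logb_le_iff_le_rpow (by norm_num) (by have := tabpos (I - 1); positivity),
      Real.rpow_one, div_le_iff₀ (by positivity)]
    exact_mod_cast (h.lt (I - 1) (by omega)).le
  refine ⟨?_, fun i hi => ?_⟩
  · have : (K : ℝ) ≤ 2 * I := by
      have h1 : I * β ≤ I * (1.45 * w) := by gcongr
      have h2 : 1 ≤ I * (1.45 * w) := c1.trans h1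
      have h3 : (K : ℝ) * 1 ≤ K * (I * (1.45 * w)) := by gcongr
      nlinarith
    exact_mod_cast this
  · have hi' : (i : ℝ) + 1 ≤ I := by exact_mod_cast hi
    have hi0 : (0 : ℝ) ≤ i := by positivity
    set v : ℝ := 1 / I with hv
    have hv0 : 0 < v := by positivity
    have hvI : v * I = 1 := by rw [hv]; field_simp
    have e1 : (i : ℝ) / I = i * v := by rw [hv]; ring
    have e2 : (3 : ℝ) / K = 3 * w := by rw [hw']; ring
    rw [e1, e2]
    have hiv : (i : ℝ) * v ≤ 1 := by nlinarith
    have hiq : (i : ℝ) * q ≤ w := by nlinarith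
    have b2 : v ≤ β := by nlinarith
    have g2 : γ - v ≤ γ * v := by nlinarith
    have h1 := up i
    have h2 := low i
    have h3 : (i : ℝ) * v ≤ i * β := by gcongr
    have h4 : (i : ℝ) * β ≤ i * (γ + 1.45 * q) := by gcongr
    have h5 : (i : ℝ) * (γ - v) ≤ i * (γ * v) := by gcongr
    have h6 : γ * (i * v) ≤ γ * 1 := by gcongr
    -- Two errors of at most `1.45 / K` each: one from `β - γ`, the other from `γ - 1 / I`.
    rw [abs_le]
    constructor <;> nlinarith

theorem abs_logb_rad {K I : ℕ} (hK : 1 ≤ K) (h : IsPeriod K I) (t : ℤ) :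
    |Real.logb 2 (rad K I t) - t / I| ≤ 3 / K := by
  have hI := h.pos hK
  have hI' : (0 : ℤ) < I := by exact_mod_cast hI
  have h1 := Int.emod_add_mul_ediv t I
  have h2 := Int.emod_nonneg t hI'.ne'
  have h3 := Int.emod_lt_of_pos t hI'
  obtain ⟨i, hi⟩ := Int.eq_ofNat_of_zero_le h2
  set e := t / (I : ℤ) with he
  have hiI : i < I := by omega
  have ht : 0 < tab K i := by
    have := le_tab K i
    nlinarith
  have ht' : (0 : ℝ) < tab K i := by exact_mod_cast ht
  unfold rad
  rw [← he, hi, Int.toNat_natCast, Real.logb_mul (by positivity) (by positivity),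
    ← Real.rpow_intCast, Real.logb_rpow (by norm_num) (by norm_num)]
  have e1 : (t : ℝ) / I = i / I + e := by
    have : (t : ℝ) = i + I * e := by rw [hi] at h1; exact_mod_cast h1.symm
    rw [this]
    field_simp
  rw [e1]
  convert (h.abs_logb_tab hK).2 i hiI using 2
  ring

/-! ### Negligible terms -/

section gap
variable {b d : ℕ} {a : ℕ → ℤ} {nz : ℕ → Prop} {I : ℤ} {σ : ℕ → ℤ} {M t : ℤ} {j : ℕ}

/-- The dominating index is the last one whose slope is at most `t`. The slope jumps there or the
hull ends, so it is a vertex, and the rounded hull exceeds its point by at most `d`. -/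
theorem SlopeSpec.gap_below (h : SlopeSpec b d a nz I σ) (hM : 0 < M) (hbj : b ≤ j) (hjd : j ≤ d)
    (hj : nz j) (hg : M ≤ gSum d σ j t) :
    ∃ k, j < k ∧ k ≤ d ∧ nz k ∧ M - d ≤ (a k - a j) * I + ((k : ℤ) - j) * t := by
  classical
  have hne : ∃ i, j < i ∧ i ≤ d ∧ σ i ≤ t := by
    by_contra! hn
    rw [gSum_eq (k := j) hbj le_rfl hjd (fun i h1 h2 => by omega)
      (fun i h1 h2 => (hn i h1 h2).le)] at hg
    simp at hg
    omega
  obtain ⟨i₀, h1, h2, h3⟩ := hne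
  have hP : j < i₀ ∧ σ i₀ ≤ t := ⟨h1, h3⟩
  set k := Nat.findGreatest (fun i => j < i ∧ σ i ≤ t) d with hk
  obtain ⟨hjk, hσk⟩ : j < k ∧ σ k ≤ t :=
    Nat.findGreatest_spec (P := fun i => j < i ∧ σ i ≤ t) h2 hP
  have hkd : k ≤ d := Nat.findGreatest_le d
  have hgt : ∀ i, k < i → i ≤ d → t < σ i := fun i h4 h5 => by
    have := Nat.findGreatest_is_greatest (P := fun i => j < i ∧ σ i ≤ t) h4 h5
    push Not at this
    exact this (by omega)
  have hbr : k = b ∨ k = d ∨ σ k < σ (k + 1) := by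
    rcases hkd.eq_or_lt with h4 | h4
    · exact Or.inr (Or.inl h4)
    · exact Or.inr (Or.inr (hσk.trans_lt (hgt _ (by omega) h4)))
  obtain ⟨g1, g2⟩ := h.ge k (by omega) hkd hbr
  have g3 := (h.le j hjd hj).2
  rw [gSum_eq hbj hjk.le hkd (fun i h4 h5 => (h.sorted i k (by omega) h5 hkd).trans hσk)
    fun i h4 h5 => (hgt i h4 h5).le] at hg
  exact ⟨k, hjk, hkd, g1, by linarith⟩

/-- The mirror image: the dominating index precedes the first slope above `t`. -/
theorem SlopeSpec.gap_above (h : SlopeSpec b d a nz I σ) (hM : 0 < M) (hbj : b ≤ j) (hjd : j ≤ d)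
    (hj : nz j) (hg : M ≤ hSum b σ j t) :
    ∃ k, b ≤ k ∧ k < j ∧ nz k ∧ M - d ≤ (a k - a j) * I + ((k : ℤ) - j) * t := by
  classical
  have hne : ∃ i, b < i ∧ i ≤ j ∧ t < σ i := by
    by_contra! hn
    rw [hSum_eq (p := j) hbj le_rfl hn (fun i h1 h2 => by omega)] at hg
    simp at hg
    omega
  have hex : ∃ i, b < i ∧ t < σ i := by
    obtain ⟨i, h1, h2, h3⟩ := hne
    exact ⟨i, h1, h3⟩
  obtain ⟨i₀, h1, h2, h3⟩ := hne
  obtain ⟨hbk, hσk⟩ := Nat.find_spec hex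
  have hkj : Nat.find hex ≤ j := (Nat.find_le ⟨h1, h3⟩).trans h2
  have hlt : ∀ i, b < i → i < Nat.find hex → σ i ≤ t := fun i h4 h5 => by
    have := Nat.find_min hex h5
    push Not at this
    exact this h4
  obtain ⟨k, hk⟩ : ∃ k, Nat.find hex = k + 1 := ⟨Nat.find hex - 1, by omega⟩
  rw [hk] at hbk hσk hkj hlt
  have hbr : k = b ∨ k = d ∨ σ k < σ (k + 1) := by
    rcases (Nat.lt_succ_iff.1 hbk).eq_or_lt with h4 | h4
    · exact Or.inl h4.symm
    · exact Or.inr (Or.inr ((hlt k h4 (by omega)).trans_lt hσk))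
  obtain ⟨g1, g2⟩ := h.ge k (by omega) (by omega) hbr
  have g3 := (h.le j hjd hj).2
  rw [hSum_eq (p := k) (by omega) (by omega) (fun i h4 h5 => hlt i h4 (by omega))
    fun i h4 h5 => hσk.le.trans (h.sorted _ i (by omega) h4 (by omega))] at hg
  exact ⟨k, by omega, by omega, g1, by linarith⟩

end gap

/-- The integers `a j` are logarithms of the numbers `F j` up to an error of one. -/
structure LogSpec (d : ℕ) (a : ℕ → ℤ) (nz : ℕ → Prop) (F : ℕ → ℝ) : Prop where
  low : ∀ j ≤ d, nz j → (2 : ℝ) ^ (a j - 1) ≤ F j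
  up : ∀ j ≤ d, nz j → F j ≤ (2 : ℝ) ^ (a j + 1)
  zero : ∀ j ≤ d, ¬ nz j → F j = 0

structure FineGrid (d K I : ℕ) : Prop where
  fine : 256 * d < K
  period : IsPeriod K I

theorem FineGrid.one_le_K {d K I : ℕ} (g : FineGrid d K I) : 1 ≤ K := by
  have := g.fine
  omega

theorem FineGrid.lt_I {d K I : ℕ} (g : FineGrid d K I) : 128 * d < I := by
  have := g.fine
  have := (g.period.abs_logb_tab g.one_le_K).1
  omega

/-- Of the surplus `3` in the exponent, `2` goes to the errors of the two logarithms, `d / I ≤ 1 /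
128` to the rounded slopes, and `3 * d / K ≤ 3 / 256` to the grid. -/
theorem term_le {d m K I : ℕ} {a : ℕ → ℤ} {nz : ℕ → Prop} {F : ℕ → ℝ} {t : ℤ} {x : ℝ} {j k : ℕ}
    (g : FineGrid d K I) (hF : LogSpec d a nz F) (hx : 0 < x) (hjd : j ≤ d) (hkd : k ≤ d)
    (hj : nz j) (hk : nz k)
    (hgap : ((m : ℤ) + 3) * I - d ≤ (a k - a j) * I + ((k : ℤ) - j) * t)
    (hL : -(3 * d / K : ℝ) ≤ ((k : ℝ) - j) * (Real.logb 2 x - t / I)) :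
    F j * x ^ j ≤ 2 ^ (-(m : ℤ)) * (F k * x ^ k) := by
  have hK0 : (0 : ℝ) < K := by exact_mod_cast g.one_le_K
  have hI0 : (0 : ℝ) < I := by exact_mod_cast g.period.pos g.one_le_K
  have h1 : (3 * d / K : ℝ) ≤ 3 / 256 := by
    rw [div_le_div_iff₀ hK0 (by norm_num)]
    have : (256 * d : ℝ) ≤ K := by exact_mod_cast g.fine.le
    linarith
  have h2 : (d : ℝ) / I ≤ 1 / 128 := by
    rw [div_le_div_iff₀ hI0 (by norm_num)]
    have : (128 * d : ℝ) ≤ I := by exact_mod_cast g.lt_I.le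
    linarith
  have h3 : (m : ℝ) + 3 - d / I ≤ (a k - a j) + ((k : ℝ) - j) * (t / I) := by
    have : ((m : ℝ) + 3) * I - d ≤ (a k - a j) * I + ((k : ℝ) - j) * t := by exact_mod_cast hgap
    have := div_le_div_of_nonneg_right this hI0.le
    have e1 : (((m : ℝ) + 3) * I - d) / I = m + 3 - d / I := by field_simp
    have e2 : (((a k : ℝ) - a j) * I + ((k : ℝ) - j) * t) / I =
        (a k - a j) + ((k : ℝ) - j) * (t / I) := by field_simp
    rwa [e1, e2] at this
  have hx' : x = (2 : ℝ) ^ Real.logb 2 x := (Real.rpow_logb (by norm_num) (by norm_num) hx).symm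
  set y := Real.logb 2 x
  have hpow : ∀ n : ℕ, x ^ n = (2 : ℝ) ^ (n * y) := fun n => by
    rw [hx', ← Real.rpow_natCast, ← Real.rpow_mul (by norm_num), mul_comm]
  have hz : ∀ e : ℤ, (2 : ℝ) ^ e = (2 : ℝ) ^ (e : ℝ) := fun e => (Real.rpow_intCast _ _).symm
  calc F j * x ^ j ≤ 2 ^ (a j + 1) * x ^ j := by
        gcongr
        exact hF.up j hjd hj
    _ = (2 : ℝ) ^ ((a j : ℝ) + 1 + j * y) := by
        rw [hz, hpow, Real.rpow_add (by norm_num)]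
        push_cast
        rfl
    _ ≤ (2 : ℝ) ^ (-(m : ℝ) + ((a k : ℝ) - 1 + k * y)) := by
        refine Real.rpow_le_rpow_of_exponent_le (by norm_num) ?_
        linarith
    _ = 2 ^ (-(m : ℤ)) * (2 ^ (a k - 1) * x ^ k) := by
        rw [hz, hz, hpow, Real.rpow_add (by norm_num), Real.rpow_add (by norm_num)]
        push_cast
        rfl
    _ ≤ _ := by
        gcongr
        exact hF.low k hkd hk

section negligible
variable {b d m K I : ℕ} {a : ℕ → ℤ} {nz : ℕ → Prop} {σ : ℕ → ℤ} {F : ℕ → ℝ} {t : ℤ} {x S : ℝ}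
  {j : ℕ}

/-- The dominating index is the larger one, so moving outwards from the grid point only helps. -/
theorem term_le_of_gSum (g : FineGrid d K I) (h : SlopeSpec b d a nz I σ)
    (hF : LogSpec d a nz F) (hS : ∀ k ≤ d, F k * x ^ k ≤ S) (hS0 : 0 ≤ S) (hjd : j ≤ d)
    (hx : rad K I t ≤ x) (hg : b ≤ j → ((m : ℤ) + 3) * I ≤ gSum d σ j t) :
    F j * x ^ j ≤ 2 ^ (-(m : ℤ)) * S := by
  by_cases hj : nz j
  · have hI := g.period.pos g.one_le_K
    have hr := rad_pos (I := I) g.one_le_K t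
    obtain ⟨k, h1, h2, h3, h4⟩ := h.gap_below (by positivity) (h.le j hjd hj).1 hjd hj
      (hg (h.le j hjd hj).1)
    refine (term_le g hF (hr.trans_le hx) hjd h2 hj h3 h4 ?_).trans
      (mul_le_mul_of_nonneg_left (hS k h2) (by positivity))
    have h5 := (abs_le.1 (abs_logb_rad g.one_le_K g.period t)).1
    have h6 := Real.logb_le_logb_of_le (b := 2) (by norm_num) hr hx
    have h7 : (0 : ℝ) ≤ (k : ℝ) - j := by rw [sub_nonneg]; exact_mod_cast h1.le
    have h8 : (k : ℝ) - j ≤ d := by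
      have : (k : ℝ) ≤ d := by exact_mod_cast h2
      have : (0 : ℝ) ≤ j := by positivity
      linarith
    have h9 : ((k : ℝ) - j) * (3 / K) ≤ d * (3 / K) := by gcongr
    have h10 : ((k : ℝ) - j) * (-(3 / K)) ≤ ((k : ℝ) - j) * (Real.logb 2 x - t / I) := by
      gcongr
      linarith
    have e : (3 * d / K : ℝ) = d * (3 / K) := by ring
    rw [e]
    linarith
  · rw [hF.zero j hjd hj, zero_mul]
    positivity

theorem term_le_of_hSum (g : FineGrid d K I) (h : SlopeSpec b d a nz I σ)
    (hF : LogSpec d a nz F) (hS : ∀ k ≤ d, F k * x ^ k ≤ S) (hS0 : 0 ≤ S) (hjd : j ≤ d)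
    (hbj : b < j) (hx0 : 0 ≤ x) (hx : x ≤ rad K I t)
    (hg : ((m : ℤ) + 3) * I ≤ hSum b σ j t) :
    F j * x ^ j ≤ 2 ^ (-(m : ℤ)) * S := by
  rcases hx0.eq_or_lt with rfl | hx0
  · rw [zero_pow (by omega), mul_zero]
    positivity
  by_cases hj : nz j
  · have hI := g.period.pos g.one_le_K
    obtain ⟨k, h1, h2, h3, h4⟩ := h.gap_above (by positivity) hbj.le hjd hj hg
    refine (term_le g hF hx0 hjd (h2.le.trans hjd) hj h3 h4 ?_).trans
      (mul_le_mul_of_nonneg_left (hS k (h2.le.trans hjd)) (by positivity))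
    have h5 := (abs_le.1 (abs_logb_rad g.one_le_K g.period t)).2
    have h6 := Real.logb_le_logb_of_le (b := 2) (by norm_num) hx0 hx
    have h7 : (0 : ℝ) ≤ (j : ℝ) - k := by rw [sub_nonneg]; exact_mod_cast h2.le
    have h8 : (j : ℝ) - k ≤ d := by
      have : (j : ℝ) ≤ d := by exact_mod_cast hjd
      have : (0 : ℝ) ≤ k := by positivity
      linarith
    have h9 : ((j : ℝ) - k) * (3 / K) ≤ d * (3 / K) := by gcongr
    have h10 : ((j : ℝ) - k) * (Real.logb 2 x - t / I) ≤ ((j : ℝ) - k) * (3 / K) := by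
      gcongr
      linarith
    have e : (3 * d / K : ℝ) = d * (3 / K) := by ring
    rw [e]
    linarith
  · rw [hF.zero j hjd hj, zero_mul]
    positivity

end negligible

/-- The two radii contribute an error of at most `6 * d / K` to the logarithm, covered above by the
`8 * d` subtracted from `m * I`. Below, the total loss is at most `15 * d / I`, less than `m / 2`.
-/
theorem FineGrid.rad_ratio {b d m K I : ℕ} {σ : ℕ → ℤ} {M t t' : ℤ} {l u : ℕ}
    (g : FineGrid d K I) (hm : 1 ≤ m)
    (R : RingStep b d σ M (m * I - 8 * d) t t' l u) (hlu : l < u) :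
    2 ^ ((m : ℝ) / 2) * rad K I t ^ (u - l) ≤ rad K I t' ^ (u - l) ∧
      rad K I t' ^ (u - l) ≤ 2 ^ m * rad K I t ^ (u - l) := by
  have hK0 : (0 : ℝ) < K := by exact_mod_cast g.one_le_K
  have hI0 : (0 : ℝ) < I := by exact_mod_cast g.period.pos g.one_le_K
  have hIK : (I : ℝ) ≤ K := by exact_mod_cast g.period.le_self
  have hm' : (1 : ℝ) ≤ m := by exact_mod_cast hm
  have h1 := abs_le.1 (abs_logb_rad g.one_le_K g.period t)
  have h2 := abs_le.1 (abs_logb_rad g.one_le_K g.period t')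
  have p1 := rad_pos (I := I) g.one_le_K t
  have p2 := rad_pos (I := I) g.one_le_K t'
  have hlow := R.lower hlu
  have hup := R.upper hlu
  have hud := R.ud
  obtain ⟨δ, rfl⟩ := Nat.exists_eq_add_of_lt hlu
  rw [show l + δ + 1 - l = δ + 1 by omega]
  have e : ((l + δ + 1 : ℕ) : ℤ) - l = ((δ + 1 : ℕ) : ℤ) := by push_cast; ring
  rw [e] at hlow hup
  set n := δ + 1
  have hn : (n : ℝ) ≤ d := by exact_mod_cast (show n ≤ d by omega)
  have hn0 : (0 : ℝ) ≤ n := by positivity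
  have hup' : (n : ℝ) * (t' / I - t / I) ≤ m - 8 * (d / I) := by
    have : (n : ℝ) * (t' - t) ≤ m * I - 8 * d := by exact_mod_cast hup
    have := div_le_div_of_nonneg_right this hI0.le
    have e1 : (n : ℝ) * (t' - t) / I = n * (t' / I - t / I) := by ring
    have e2 : ((m : ℝ) * I - 8 * d) / I = m - 8 * (d / I) := by field_simp
    rwa [e1, e2] at this
  have hlow' : m - 8 * (d / I) - d / I ≤ (n : ℝ) * (t' / I - t / I) := by
    have : (m : ℝ) * I - 8 * d - n ≤ n * (t' - t) := by exact_mod_cast hlow.le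
    have := div_le_div_of_nonneg_right this hI0.le
    have e1 : (n : ℝ) * (t' - t) / I = n * (t' / I - t / I) := by ring
    have e2 : ((m : ℝ) * I - 8 * d - n) / I = m - 8 * (d / I) - n / I := by field_simp
    rw [e1, e2] at this
    have : (n : ℝ) / I ≤ d / I := by gcongr
    linarith
  have h3 : (d : ℝ) / K ≤ d / I := by gcongr
  have h4 : (d : ℝ) / I ≤ 1 / 128 := by
    rw [div_le_div_iff₀ hI0 (by norm_num)]
    have : (128 * d : ℝ) ≤ I := by exact_mod_cast g.lt_I.le
    linarith
  have h5 : (n : ℝ) * (3 / K) ≤ 3 * (d / K) := by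
    calc (n : ℝ) * (3 / K) ≤ d * (3 / K) := by gcongr
      _ = _ := by ring
  have h6 : (0 : ℝ) ≤ d / I := by positivity
  set y := Real.logb 2 (rad K I t) with hy
  set y' := Real.logb 2 (rad K I t') with hy'
  have q1 : rad K I t = (2 : ℝ) ^ y := (Real.rpow_logb (by norm_num) (by norm_num) p1).symm
  have q2 : rad K I t' = (2 : ℝ) ^ y' := (Real.rpow_logb (by norm_num) (by norm_num) p2).symm
  have k1 : (n : ℝ) * (y' - t' / I) ≤ n * (3 / K) := by gcongr; exact h2.2
  have k2 : (n : ℝ) * (t / I - y) ≤ n * (3 / K) := by gcongr; linarith [h1.1]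
  have k3 : (n : ℝ) * (t' / I - y') ≤ n * (3 / K) := by gcongr; linarith [h2.1]
  have k4 : (n : ℝ) * (y - t / I) ≤ n * (3 / K) := by gcongr; linarith [h1.2]
  rw [q1, q2, ← Real.rpow_natCast, ← Real.rpow_natCast, ← Real.rpow_mul (by norm_num),
    ← Real.rpow_mul (by norm_num), ← Real.rpow_natCast, ← Real.rpow_add (by norm_num),
    ← Real.rpow_add (by norm_num)]
  constructor <;> refine Real.rpow_le_rpow_of_exponent_le (by norm_num) ?_ <;> linarith

/-! ### Writing the output -/

def writeCoeff : Prog :=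
  block (.instr (.load 73 0 71)) [.instr (.write 73), .instr (.load 73 1 71), .instr (.write 73),
    .instr (.load 73 2 71), .instr (.write 73), .instr (.load 73 3 71), .instr (.write 73),
    .instr (.add 71 71 7)]

def writeRadius : Prog :=
  block (.instr (.load 74 11 70)) [.instr (.div 75 74 2), .instr (.mul 76 75 2),
    .instr (.sub 76 74 76), .instr (.load 77 6 76), .instr (.write 77), .instr (.sub 78 75 3),
    .instr (.write 78)]

def writeZero : Prog := block (.instr (.const 77 0)) [.instr (.write 77), .instr (.write 77)]

def writeIndices : Prog :=
  block (.instr (.load 71 12 70)) [.instr (.load 72 13 70), .instr (.write 71), .instr (.write 72),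
    .instr (.add 70 70 7)]

def outputTest : Prog :=
  block (.instr (.sub 79 64 70)) [.instr (.add 79 79 72), .instr (.add 79 79 7),
    .instr (.sub 79 79 71)]

def outputBody : Prog :=
  block (.instr (.sub 76 72 71)) [.instr (.add 76 76 7),
    .ifPos 76 writeCoeff (.seq (.ifPos 70 writeRadius writeZero) writeIndices), outputTest]

/-- The range from `1` to `0` of pending coefficients is empty, so the first round writes the head
of the first piece. -/
def outputInit : Prog :=
  block (.instr (.const 70 0)) [.instr (.const 71 1), .instr (.const 72 0), .instr (.const 79 0),
    .instr (.add 79 79 64)]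

def outputPhase : Prog := .seq outputInit (.whilePos 79 outputBody)

def outputInitBounds : Bounds := Bounds.mk' [64] [] [] []

def outputBounds : Bounds :=
  Bounds.mk' [2, 3, 7, 64, 70, 71, 72, 79] [] [6, 12, 13] [0, 1, 2, 3, 11]

def outputCost : ℕ :=
  outputInit.weight outputInitBounds + 133 * loopWeight 79 outputBody outputBounds

/-- What the state has to hold for the piece number `n`. -/
structure PieceData (d : ℕ) (c : List CFloat) (s : State) (n : ℕ) (p : Piece) : Prop where
  coeffs : p.coeffs = (c.drop p.lower).take (p.upper + 1 - p.lower)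
  le : p.lower ≤ p.upper
  upper_le : p.upper ≤ d
  arr12 : s.arr 12 n = p.lower
  arr13 : s.arr 13 n = p.upper
  zero : n = 0 → p.inner = ⟨0, 0⟩
  inner : 0 < n → p.inner = ⟨s.arr 6 (s.arr 11 n % s.reg 2), s.arr 11 n / s.reg 2 - s.reg 3⟩

/-- A single loop writes heads and coefficients, so the output may end within a piece; adding the
pending coefficients `j` to `u` completes it. -/
def OutputRest (c : List CFloat) (P : List Piece) (n j u : ℕ) (out : List ℤ) : Prop :=
  out ++ ((c.drop j).take (u + 1 - j)).flatMap CFloat.encode = encodeOutput (P.take n)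

/-- A piece not begun counts twice its number of coefficients: writing its head turns this into the
simple count of pending ones, and the measure drops. -/
structure OutputInv (d : ℕ) (c : List CFloat) (P : List Piece) (s₀ : State) (k : ℕ) (s : State) :
    Prop where
  same : SameExcept [70, 71, 72, 73, 74, 75, 76, 77, 78, 79] [] true s₀ s
  inp : s.inp = []
  idx : ∃ n j u : ℕ, s.reg 70 = n ∧ s.reg 71 = j ∧ s.reg 72 = u ∧
    s.reg 79 = P.length - n + u + 1 - j ∧ n ≤ P.length ∧ j ≤ u + 1 ∧ u ≤ d ∧
    k = 2 * ((P.drop n).map fun p => p.delta + 1).sum + (u + 1 - j) ∧ OutputRest c P n j u s.out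

theorem run_writeCoeff {c : List CFloat} {P : List Piece} {n j u d W : ℕ} {s₀ s : State}
    (hS : Stored d c W (d + 1) s₀) (harr : s.arr = s₀.arr) (hc : c.length = d + 1)
    (h7 : s.reg 7 = 1) (h71 : s.reg 71 = j) (hju : j ≤ u) (hud : u ≤ d)
    (h : OutputRest c P n j u s.out) :
    (run writeCoeff s).reg 71 = (j + 1 : ℕ) ∧ OutputRest c P n (j + 1) u (run writeCoeff s).out := by
  have hj : j < c.length := by omega
  have hget : c.getD j zeroFloat = (c)[j] := by simp [hj]
  have a0 := hS.arr0 j (by omega)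
  have a1 := hS.arr1 j (by omega)
  have a2 := hS.arr2 j (by omega)
  have a3 := hS.arr3 j (by omega)
  rw [hget] at a0 a1 a2 a3
  generalize hs' : run writeCoeff s = s'
  simp only [writeCoeff, block, run, Instr.eval, State.set, Function.update_apply, harr, h7, h71,
    a0, a1, a2, a3, reduceIte, Nat.reduceEqDiff] at hs'
  subst hs'
  refine ⟨by simp, ?_⟩
  unfold OutputRest at h ⊢
  rw [← h, List.drop_eq_getElem_cons hj, show u + 1 - j = (u + 1 - (j + 1)) + 1 by omega,
    List.take_succ_cons, List.flatMap_cons]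
  simp [CFloat.encode, Float2.encode]

theorem run_writePiece {d : ℕ} {c : List CFloat} {P : List Piece} {n j u : ℕ} {s₀ s : State}
    (harr : s.arr = s₀.arr) (h2 : s.reg 2 = s₀.reg 2) (h3 : s.reg 3 = s₀.reg 3) (h7 : s.reg 7 = 1)
    (h70 : s.reg 70 = n) (hn : n < P.length) (hp : PieceData d c s₀ n P[n]) (hju : j = u + 1)
    (h : OutputRest c P n j u s.out) :
    let s' := run (.seq (.ifPos 70 writeRadius writeZero) writeIndices) s
    s'.reg 70 = (n + 1 : ℕ) ∧ s'.reg 71 = (P[n].lower : ℤ) ∧ s'.reg 72 = (P[n].upper : ℤ) ∧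
      OutputRest c P (n + 1) P[n].lower P[n].upper s'.out := by
  obtain ⟨p1, p2, p3, p4, p5, p6, p7⟩ := hp
  have hout : s.out = encodeOutput (P.take n) := by
    unfold OutputRest at h
    rw [← h, hju]; simp
  have key : ∀ out, out = s.out ++ P[n].inner.encode ++ [(P[n].lower : ℤ), (P[n].upper : ℤ)] →
      OutputRest c P (n + 1) P[n].lower P[n].upper out := fun out h => by
    unfold OutputRest
    have e : P.take (n + 1) = P.take n ++ [P[n]] := (List.take_append_getElem hn).symm
    rw [h, ← p1, hout, e, encodeOutput, encodeOutput, List.flatMap_append]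
    simp [Piece.encode]
  intro s'
  generalize hs' : s' = s''
  rcases Nat.eq_zero_or_pos n with rfl | hn0
  · simp only [s', writeZero, writeIndices, block, run, Instr.eval, State.set,
      Function.update_apply, harr, h7, h70, reduceIte, Nat.reduceEqDiff, Nat.cast_zero,
      lt_self_iff_false] at hs' p4 p5
    subst hs'
    refine ⟨by simp, by simpa, by simpa, key _ ?_⟩
    simp [p6 rfl, Float2.encode, p4, p5]
  · have c1 : (0 : ℤ) < n := by exact_mod_cast hn0
    have e : s₀.arr 11 n - s₀.arr 11 n / s₀.reg 2 * s₀.reg 2 = s₀.arr 11 n % s₀.reg 2 := by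
      have := Int.emod_add_mul_ediv (s₀.arr 11 n) (s₀.reg 2)
      linarith
    simp only [s', writeRadius, writeIndices, block, run, Instr.eval, State.set,
      Function.update_apply, harr, h2, h3, h7, h70, p4, p5, c1, reduceIte, Nat.reduceEqDiff,
      e] at hs'
    subst hs'
    refine ⟨by simp, by simp, by simp, key _ ?_⟩
    simp [p7 hn0, Float2.encode]

theorem output_step {d W : ℕ} {c : List CFloat} {P : List Piece} {s₀ : State}
    (hS : Stored d c W (d + 1) s₀) (hc : c.length = d + 1) (h7 : s₀.reg 7 = 1)
    (h64 : s₀.reg 64 = P.length)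
    (hP : ∀ (n : ℕ) (hn : n < P.length), PieceData d c s₀ n P[n]) (k : ℕ) (s : State)
    (h : OutputInv d c P s₀ k s) (hpos : 0 < s.reg 79) :
    ∃ k' < k, OutputInv d c P s₀ k' (run outputBody s) := by
  obtain ⟨same, inp, n, j, u, r70, r71, r72, r79, hn, hj, hu, hk, hR⟩ := h
  have r2 := same.reg 2 (by decide)
  have r3 := same.reg 3 (by decide)
  have r7 : s.reg 7 = 1 := by rw [same.reg 7 (by decide), h7]
  have r64 : s.reg 64 = P.length := by rw [same.reg 64 (by decide), h64]
  have harr : s.arr = s₀.arr := funext fun a => same.arr a (by simp)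
  have hsame := same.trans ((run_sameExcept outputBody s).mono (by decide) (by decide) (by decide))
  have hinp : (run outputBody s).inp = [] := by
    rw [run_inp outputBody (by decide), inp]
  generalize hs' : run outputBody s = s' at hsame hinp
  obtain ⟨s₁, e, b2, b3, b7, b64, b70, b71, b72, b76, barr, bout⟩ :
      ∃ s₁, run (.ifPos 76 writeCoeff (.seq (.ifPos 70 writeRadius writeZero) writeIndices)) s₁ =
        run (block (.instr (.sub 76 72 71)) [.instr (.add 76 76 7),
          .ifPos 76 writeCoeff (.seq (.ifPos 70 writeRadius writeZero) writeIndices)]) s ∧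
        s₁.reg 2 = s₀.reg 2 ∧ s₁.reg 3 = s₀.reg 3 ∧ s₁.reg 7 = 1 ∧ s₁.reg 64 = P.length ∧
        s₁.reg 70 = n ∧ s₁.reg 71 = j ∧ s₁.reg 72 = u ∧ s₁.reg 76 = (u : ℤ) - j + 1 ∧
        s₁.arr = s₀.arr ∧ s₁.out = s.out := by
    refine ⟨run (block (.instr (.sub 76 72 71)) [.instr (.add 76 76 7)]) s, rfl, ?_⟩
    simp [block, run, Instr.eval, State.set, r2, r3, r7, r64, r70, r71, r72, harr]
  have hs₂ : s' = run outputTest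
      (run (.ifPos 76 writeCoeff (.seq (.ifPos 70 writeRadius writeZero) writeIndices)) s₁) := by
    rw [e, ← hs']; rfl
  have test : ∀ s₂ : State, (run outputTest s₂).reg 70 = s₂.reg 70 ∧
      (run outputTest s₂).reg 71 = s₂.reg 71 ∧ (run outputTest s₂).reg 72 = s₂.reg 72 ∧
      (run outputTest s₂).reg 79 = s₂.reg 64 - s₂.reg 70 + s₂.reg 72 + s₂.reg 7 - s₂.reg 71 ∧
      (run outputTest s₂).out = s₂.out := fun s₂ => by
    simp [outputTest, block, run, Instr.eval, State.set]
  clear hs' e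
  by_cases c1 : 0 < (u : ℤ) - j + 1
  · rw [run, if_pos (by rwa [b76])] at hs₂
    obtain ⟨e1, e2⟩ := run_writeCoeff (n := n) (u := u) (P := P) hS barr hc b7 b71 (by omega) hu
      (by rwa [bout])
    have f := run_sameExcept writeCoeff s₁
    have f7 := f.reg 7 (by decide)
    have f64 := f.reg 64 (by decide)
    have f70 := f.reg 70 (by decide)
    have f72 := f.reg 72 (by decide)
    generalize run writeCoeff s₁ = s₂ at *
    obtain ⟨t70, t71, t72, t79, tout⟩ := test s₂
    rw [← hs₂] at t70 t71 t72 t79 tout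
    refine ⟨k - 1, by omega, hsame, hinp, n, j + 1, u, by rw [t70, f70, b70], by rw [t71, e1],
      by rw [t72, f72, b72], ?_, hn, by omega, hu, by omega, by rwa [tout]⟩
    rw [t79, f64, f70, f72, f7, e1, b64, b70, b72, b7]
  · rw [run, if_neg (by rwa [b76])] at hs₂
    have hn' : n < P.length := by omega
    obtain ⟨e1, e2, e3, e4⟩ := run_writePiece barr b2 b3 b7 b70 hn' (hP n hn') (by omega)
      (u := u) (j := j) (c := c) (by rwa [bout])
    have f := run_sameExcept (.seq (.ifPos 70 writeRadius writeZero) writeIndices) s₁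
    have f7 := f.reg 7 (by decide)
    have f64 := f.reg 64 (by decide)
    generalize run (.seq (.ifPos 70 writeRadius writeZero) writeIndices) s₁ = s₂ at *
    obtain ⟨t70, t71, t72, t79, tout⟩ := test s₂
    rw [← hs₂] at t70 t71 t72 t79 tout
    have hp1 := (hP n hn').le
    have hp2 := (hP n hn').upper_le
    rw [List.drop_eq_getElem_cons hn', List.map_cons, List.sum_cons, Piece.delta] at hk
    refine ⟨_, ?_, hsame, hinp, n + 1, P[n].lower, P[n].upper, by rw [t70, e1], by rw [t71, e2],
      by rw [t72, e3], ?_, by omega, by omega, hp2, rfl, by rwa [tout]⟩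
    · omega
    · rw [t79, f64, f7, e1, e2, e3, b64, b7]

theorem outputPhase_runs {V W d : ℕ} {c : List CFloat} {P : List Piece} {s₀ : State} {Y : ℤ}
    (hV : 1 ≤ V) (hVW : V ≤ W) (hYV : len Y ≤ V) (hY : 66 * (d : ℤ) + 3 ≤ Y) (hd : 1 ≤ d)
    (hS : Stored d c W (d + 1) s₀) (hc : c.length = d + 1) (h7 : s₀.reg 7 = 1)
    (h64 : s₀.reg 64 = P.length) (h2 : |s₀.reg 2| ≤ Y) (h3 : |s₀.reg 3| ≤ Y)
    (le6 : ∀ i, |s₀.arr 6 i| ≤ Y) (len11 : ∀ i, len (s₀.arr 11 i) ≤ W)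
    (le12 : ∀ i, |s₀.arr 12 i| ≤ Y) (le13 : ∀ i, |s₀.arr 13 i| ≤ Y) (inp : s₀.inp = [])
    (out : s₀.out = [])
    (hP : ∀ (n : ℕ) (hn : n < P.length), PieceData d c s₀ n P[n])
    (hsum : (P.map fun p => p.delta + 1).sum ≤ 65 * d + 1) :
    ∃ s', Runs outputPhase s₀ (outputCost * (d * (V * W))) s' ∧ s'.out = encodeOutput P := by
  have hsm : ∀ a : ℤ, -Y ≤ a → a ≤ Y → len a ≤ V := fun a h1 h2 =>
    (len_le_len h1 h2).trans hYV
  have hL : P.length ≤ 65 * d + 1 := by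
    have : (P.map fun _ => 1).sum ≤ (P.map fun p => p.delta + 1).sum :=
      List.sum_le_sum fun p _ => Nat.le_add_left _ _
    simp only [List.map_const', List.sum_replicate, smul_eq_mul, mul_one] at this
    omega
  have f0 : outputInitBounds.Fits V W s₀ := by
    refine Bounds.fits_mk' ?_ (by simp) (by simp) (by simp) (by simp [inp])
    simp only [List.forall_mem_cons, h64]
    refine ⟨?_, by simp⟩
    apply hsm <;> omega
  have g0 := runs_of_fits hV hVW f0 (p := outputInit) (by decide)
  have hI : OutputInv d c P s₀ (2 * (P.map fun p => p.delta + 1).sum) (run outputInit s₀) := by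
    refine ⟨(run_sameExcept outputInit s₀).mono (by decide) (by decide) (by decide),
      by rw [run_inp outputInit (by decide), inp], 0, 1, 0, ?_⟩
    simp [outputInit, block, run, Instr.eval, State.set, OutputRest, h64, out, encodeOutput]
  have hfit : ∀ n s, OutputInv d c P s₀ n s → outputBounds.Fits V W s := fun k s h => by
    obtain ⟨same, inp, n, j, u, r70, r71, r72, r79, hn, hj, hu, hk, hR⟩ := h
    have harr : s.arr = s₀.arr := funext fun a => same.arr a (by simp)
    have a2 := abs_le.1 h2
    have a3 := abs_le.1 h3
    refine Bounds.fits_mk' ?_ (by simp) ?_ ?_ (by simp [inp])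
    · simp only [List.forall_mem_cons, same.reg 2 (by decide), same.reg 3 (by decide),
        same.reg 7 (by decide), same.reg 64 (by decide), h7, h64, r70, r71, r72, r79]
      refine ⟨?_, ?_, ?_, ?_, ?_, ?_, ?_, ?_, by simp⟩ <;> apply hsm <;> omega
    · simp only [List.forall_mem_cons, harr]
      exact ⟨fun i => len_le_of_abs_le hYV (le6 i), fun i => len_le_of_abs_le hYV (le12 i),
        fun i => len_le_of_abs_le hYV (le13 i), by simp⟩
    · simp only [List.forall_mem_cons, harr]
      exact ⟨hS.len0, hS.len1, hS.len2, hS.len3, len11, by simp⟩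
  obtain ⟨s', h1, h2', n', h3'⟩ := runs_while hV hVW (x := 79) (p := outputBody) (A := outputBounds)
    (by decide) (by decide) hfit (output_step hS hc h7 h64 hP) _ _ hI
  refine ⟨s', (g0.seq h1).mono (cost_le (by omega) hd), ?_⟩
  obtain ⟨same, inp, n, j, u, r70, r71, r72, r79, hn, hj, hu, hk, hR⟩ := h3'
  obtain rfl : n = P.length := by omega
  obtain rfl : j = u + 1 := by omega
  simpa [OutputRest] using hR

/-! ### Magnitudes of floating-point numbers -/

theorem Float2.abs_val (x : Float2) : |x.val| = (x.man.natAbs : ℝ) * (2 : ℝ) ^ x.exp := by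
  rw [Float2.val, abs_mul, abs_of_pos (show (0 : ℝ) < 2 ^ x.exp by positivity), Nat.cast_natAbs,
    Int.cast_abs]

theorem Float2.size_nonneg (x : Float2) : 0 ≤ x.size := Int.natCast_nonneg _

theorem Float2.size_pos {x : Float2} : 0 < x.size ↔ x.man ≠ 0 := by
  rw [Float2.size, Int.natCast_pos, Nat.size_pos, Int.natAbs_pos]

theorem Float2.abs_val_lt (x : Float2) : |x.val| < 2 ^ (x.size + x.exp) := by
  rw [x.abs_val, zpow_add₀ (by norm_num), Float2.size, zpow_natCast]
  gcongr
  exact_mod_cast Nat.lt_size_self _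

theorem Float2.le_abs_val {x : Float2} (h : x.man ≠ 0) :
    (2 : ℝ) ^ (x.size + x.exp - 1) ≤ |x.val| := by
  have h0 : 0 < x.man.natAbs.size := by simpa [Float2.size] using Float2.size_pos.2 h
  obtain ⟨k, hk⟩ : ∃ k, x.man.natAbs.size = k + 1 := ⟨_, (Nat.sub_add_cancel h0).symm⟩
  rw [x.abs_val, Float2.size, hk,
    show ((k + 1 : ℕ) : ℤ) + x.exp - 1 = (k : ℤ) + x.exp by push_cast; ring,
    zpow_add₀ (by norm_num), zpow_natCast]
  gcongr
  exact_mod_cast Nat.lt_size.1 (by omega)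

section valid
variable {m τ : ℕ} {x : Float2}

theorem Float2.Valid.size_le (h : x.Valid m τ) : x.size ≤ m := by
  have : x.man.natAbs < 2 ^ m := by
    have := h.1
    zify
    exact this
  rw [Float2.size]
  exact_mod_cast Nat.size_le.2 this

theorem Float2.Valid.abs_le (h : x.Valid m τ) : |x.size + x.exp| ≤ τ := by
  by_cases h0 : x.man = 0
  · have : x.size = 0 := by simp [Float2.size, h0]
    rw [h.2.1 h0, this]
    simp
  · obtain ⟨h1, h2⟩ := h.2.2 h0
    have h3 := (zpow_lt_zpow_iff_right₀ (by norm_num)).1 (h1.trans_lt x.abs_val_lt)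
    have h4 := (Float2.le_abs_val h0).trans_lt h2
    rw [← zpow_natCast, zpow_lt_zpow_iff_right₀ (by norm_num)] at h4
    rw [_root_.abs_le]
    omega

theorem Float2.Valid.abs_exp_le (h : x.Valid m τ) : |x.exp| ≤ τ + m := by
  have h1 := _root_.abs_le.1 h.abs_le
  have h2 := h.size_le
  have h3 := x.size_nonneg
  rw [_root_.abs_le]
  omega

theorem Float2.Valid.len_man (h : x.Valid m τ) : len x.man ≤ m + 1 := by
  refine len_le_of_natAbs_lt ?_
  have := h.1
  zify
  exact this

end valid

theorem CFloat.log_cases (x : CFloat) :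
    x.log = x.re.size + x.re.exp ∨ x.log = x.im.size + x.im.exp := by
  unfold CFloat.log
  split_ifs
  · right; ring
  · left; rfl
  · left; rfl
  · right; rfl

theorem CFloat.Valid.abs_log_le {m τ : ℕ} {x : CFloat} (h : x.Valid m τ) : |x.log| ≤ τ := by
  rcases x.log_cases with h1 | h1 <;> rw [h1]
  exacts [h.1.abs_le, h.2.abs_le]

theorem CFloat.le_norm {x : CFloat} (h : 0 < x.re.size + x.im.size) :
    (2 : ℝ) ^ (x.log - 1) ≤ ‖x.val‖ := by
  have hre : |x.re.val| ≤ ‖x.val‖ := Complex.abs_re_le_norm x.val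
  have him : |x.im.val| ≤ ‖x.val‖ := Complex.abs_im_le_norm x.val
  have h1 := x.re.size_nonneg
  have h2 := x.im.size_nonneg
  unfold CFloat.log
  split_ifs with c1 c2 c3
  · rw [add_sub_cancel]
    exact (Float2.le_abs_val (Float2.size_pos.1 c2)).trans him
  · exact (Float2.le_abs_val (Float2.size_pos.1 c1)).trans hre
  · exact (Float2.le_abs_val (Float2.size_pos.1 c1)).trans hre
  · exact (Float2.le_abs_val (Float2.size_pos.1 (by omega))).trans him

theorem Float2.val_eq_zero {x : Float2} (h : ¬ 0 < x.size) : x.val = 0 := by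
  rw [Float2.size_pos, not_not] at h
  simp [Float2.val, h]

theorem CFloat.norm_le (x : CFloat) : ‖x.val‖ ≤ (2 : ℝ) ^ (x.log + 1) := by
  have h1 : |x.re.val| ≤ 2 ^ x.log := by
    unfold CFloat.log
    split_ifs with c1 c2 c3
    · exact x.re.abs_val_lt.le.trans (zpow_le_zpow_right₀ (by norm_num) (by omega))
    · exact x.re.abs_val_lt.le
    · exact x.re.abs_val_lt.le
    · rw [Float2.val_eq_zero c1, abs_zero]; positivity
  have h2 : |x.im.val| ≤ 2 ^ x.log := by
    unfold CFloat.log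
    split_ifs with c1 c2 c3
    · rw [add_sub_cancel]; exact x.im.abs_val_lt.le
    · exact x.im.abs_val_lt.le.trans (zpow_le_zpow_right₀ (by norm_num) (by omega))
    · rw [Float2.val_eq_zero c2, abs_zero]; positivity
    · exact x.im.abs_val_lt.le
  have h3 : ‖x.val‖ ≤ |x.re.val| + |x.im.val| := Complex.norm_le_abs_re_add_abs_im x.val
  rw [zpow_add_one₀ (by norm_num)]
  linarith

theorem CFloat.val_eq_zero {x : CFloat} (h : ¬ 0 < x.re.size + x.im.size) : x.val = 0 := by
  have h1 := x.re.size_nonneg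
  have h2 := x.im.size_nonneg
  rw [CFloat.val, Float2.val_eq_zero (x := x.re) (by omega),
    Float2.val_eq_zero (x := x.im) (by omega)]
  rfl

/-! ### The computation of the rings -/

def coeffLog (c : List CFloat) (i : ℕ) : ℤ := (c.getD i zeroFloat).log

def coeffNonzero (c : List CFloat) (i : ℕ) : Prop :=
  0 < (c.getD i zeroFloat).re.size + (c.getD i zeroFloat).im.size

theorem abs_coeffLog_le {c : List CFloat} {m τ : ℕ} (h : ∀ x ∈ c, x.Valid m τ) (i : ℕ) :
    |coeffLog c i| ≤ τ := by
  unfold coeffLog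
  rcases Nat.lt_or_ge i c.length with hi | hi
  · rw [List.getD_eq_getElem _ _ hi]
    exact (h _ (List.getElem_mem hi)).abs_log_le
  · rw [List.getD_eq_default _ _ hi]
    simp [zeroFloat, CFloat.log, Float2.size]

theorem not_coeffNonzero {c : List CFloat} {i : ℕ} (h : c.length ≤ i) : ¬ coeffNonzero c i := by
  rw [coeffNonzero, List.getD_eq_default _ _ h]
  simp [zeroFloat, Float2.size]

theorem Stored.congr {d : ℕ} {c : List CFloat} {W j : ℕ} {s s' : State} (h : Stored d c W j s)
    (h' : ∀ x < 4, s'.arr x = s.arr x) : Stored d c W j s' := by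
  obtain ⟨h0, h1, h2, h3, l0, l1, l2, l3⟩ := h
  constructor
  all_goals rw [h' _ (by norm_num)]; assumption

def ringsPhase : Prog :=
  block readPhase [tablePhase, hullPhase, slopePhase, entryPhase, sweepPhase]

def ringsCost : ℕ := readCost + tableCost + hullCost + slopeCost + entryCost + sweepCost

/-- Table entries and indices are at most `4 * K ^ 2`, hence of length at most `V`. The quantities
on the logarithmic grid are bounded by `X`, where `τ + 2 * m` bounds both the logarithms and the
mantissa sizes of the coefficients. -/
theorem ringsPhase_runs {d m τ K V W : ℕ} {c : List CFloat} {X : ℤ} (hd : 1 ≤ d) (hm : 1 ≤ m)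
    (hc : c.length = d + 1) (hvalid : ∀ x ∈ c, x.Valid m τ) (hlast : coeffNonzero c d)
    (hK : K = 2 ^ (d.size + 8)) (hV : V = len (4 * (K : ℤ) ^ 2))
    (hX : X = 12 * (τ + 2 * m) * K ^ 2) (hW : W = m + 1 + len X) :
    ∃ s I b σ N T Lo Up, Runs ringsPhase (State.init (encodeInput m d c))
        (ringsCost * (d * (V * W))) s ∧
      IsPeriod K I ∧ SlopeSpec b d (coeffLog c) (coeffNonzero c) I σ ∧
      RingData b d σ ((m + 3) * I) (m * I - 8 * d) X (4 * K ^ 2) N T Lo Up s ∧ s.reg 2 = I ∧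
      s.reg 3 = 2 * (d.size + 8) ∧ s.reg 7 = 1 ∧ (∀ i : ℕ, i < I → s.arr 6 i = tab K i) ∧
      (∀ i, |s.arr 6 i| ≤ 4 * K ^ 2) ∧ Stored d c W (d + 1) s ∧ s.inp = [] ∧ s.out = [] := by
  obtain ⟨hK1, hK2⟩ := size_two_pow_bounds hd
  rw [← hK] at hK1 hK2
  have hKK : (K : ℤ) * 256 ≤ K ^ 2 := by
    have : (256 : ℤ) ≤ K := by omega
    nlinarith
  have hα : (1 : ℤ) ≤ τ + 2 * m := by omega
  have hαK : (τ + 2 * m : ℤ) ≤ (τ + 2 * m) * K ^ 2 := le_mul_of_one_le_right (by omega) (by omega)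
  have hKα : (K : ℤ) ^ 2 ≤ (τ + 2 * m) * K ^ 2 := le_mul_of_one_le_left (by positivity) hα
  have hX' : X = 12 * ((τ + 2 * m) * K ^ 2) := by rw [hX]; ring
  have hVX : V ≤ len X := by
    rw [hV]; exact len_le_len (by nlinarith) (by omega)
  have hV1 : 1 ≤ V := hV ▸ one_le_len _
  have hVW : V ≤ W := by omega
  have hXW : len X ≤ W := by omega
  have hYV : len (4 * (K : ℤ) ^ 2) ≤ V := hV.ge
  have hY : 66 * (d : ℤ) + 3 ≤ 4 * (K : ℤ) ^ 2 := by omega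
  have hmW : len (m : ℤ) ≤ W := by
    have := len_le_of_natAbs_lt (a := m) (n := m) (by simpa using Nat.lt_two_pow_self)
    omega
  have hα0 : (0 : ℤ) ≤ τ + 2 * m := by omega
  obtain ⟨s₁, R₁, a0, a1, a7, le4, le5, inp₁, out₁, zero, St, arr4, arr5⟩ :=
    readPhase_runs hV1 hVW hYV hY hd hα0 hmW hc (fun x hx v hv => by
      have hmant : ∀ {y : Float2}, y.Valid m τ → len y.man ≤ W ∧ len y.exp ≤ W := fun h => by
        refine ⟨h.len_man.trans (by omega), len_le_of_abs_le hXW ?_⟩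
        have := h.abs_exp_le
        omega
      have h1 := hmant (hvalid x hx).1
      have h2 := hmant (hvalid x hx).2
      simp only [CFloat.encode, Float2.encode, List.cons_append, List.nil_append, List.mem_cons,
        List.not_mem_nil, or_false] at hv
      rcases hv with rfl | rfl | rfl | rfl
      exacts [h1.1, h1.2, h2.1, h2.2]) (fun x hx => by
        have := (hvalid x hx).abs_log_le
        omega) (fun x hx => by
        have h1 := (hvalid x hx).1.size_le
        have h2 := (hvalid x hx).2.size_le
        have h3 := x.re.size_nonneg
        have h4 := x.im.size_nonneg
        rw [abs_le]
        omega)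
  obtain ⟨s₂, I, R₂, hper, b2, b3, b5, b6, arr6, le6⟩ :=
    tablePhase_runs hV1 hVW hYV le_rfl hK hd hmW a0 a1 a7 (zero 6 (by norm_num)) inp₁
  have g : FineGrid d K I := ⟨hK1, hper⟩
  have hI := g.lt_I
  have hIK := hper.le_self
  have E₂ := R₂.sameExcept
  have b1 : s₂.reg 1 = d := by rw [E₂.reg 1 (by decide), a1]
  have b7 : s₂.reg 7 = 1 := by rw [E₂.reg 7 (by decide), a7]
  have inp₂ : s₂.inp = [] := by rw [E₂.inp rfl, inp₁]
  have out₂ : s₂.out = [] := by rw [E₂.out rfl, out₁]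
  have arr4₂ : s₂.arr 4 = s₁.arr 4 := E₂.arr 4 (by decide)
  have hX0 : 0 ≤ X := by rw [hX]; positivity
  have zero₂ : ∀ x, 7 ≤ x → s₂.arr x = fun _ => 0 := fun x hx => by
    rw [E₂.arr x (fun h => by
      have : ∀ y ∈ tablePhase.outArr, y = 6 := by decide
      have := this x h
      omega), zero x (by omega)]
  have hαX : ∀ {z : ℤ}, |z| ≤ τ + 2 * m → |z| ≤ X := fun h => by omega
  obtain ⟨s₃, n, v, R₃, H, hn, arr7, le7⟩ :=
    hullPhase_runs (a := coeffLog c) (nz := coeffNonzero c) (X := X) hV1 hVW hXW hYV hY hd hlast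
      (not_coeffNonzero hc.le) b1 b7 (by rw [arr4₂]; exact arr4)
      (by rw [E₂.arr 5 (by decide)]; exact fun i hi => by rw [arr5 i hi]; rfl)
      (fun i => by rw [arr4₂]; exact hαX (le4 i))
      (fun i => by rw [E₂.arr 5 (by decide)]; exact hαX (le5 i))
      (fun i => by rw [zero₂ 7 le_rfl]; simp) inp₂
  have E₃ := R₃.sameExcept
  set b := v 0 with hb
  set σ := slope (coeffLog c) v I n with hσ
  have spec : SlopeSpec b d (coeffLog c) (coeffNonzero c) I σ := H.slopeSpec (by omega)
  have hσle : ∀ i, |σ i| ≤ 2 * (τ + 2 * m) * I := fun i =>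
    abs_slope_le (fun i => (abs_coeffLog_le hvalid i).trans (by omega)) (by omega) i
  have hαI : (τ + 2 * m : ℤ) * I * d ≤ (τ + 2 * m) * K ^ 2 := by
    rw [mul_assoc, sq]
    gcongr
    omega
  have hαI' : (τ + 2 * m : ℤ) * I ≤ (τ + 2 * m) * I * d :=
    le_mul_of_one_le_right (by positivity) (by omega)
  -- Partial sums get a smaller bound than `X`, so that a difference of two of them minus the
  -- threshold still fits under `X`.
  obtain ⟨X₁, hX₁⟩ : ∃ X₁ : ℤ, X₁ = 2 * ((τ + 2 * m) * I * d) := ⟨_, rfl⟩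
  have hσX : ∀ i, |σ i| ≤ X₁ := fun i => (hσle i).trans (by rw [mul_assoc]; omega)
  have hpre : ∀ i ≤ d, |pre b σ i| ≤ X₁ := fun i hi => by
    refine (abs_pre_le hσle i).trans ?_
    calc (i : ℤ) * (2 * (τ + 2 * m) * I) ≤ d * (2 * (τ + 2 * m) * I) := by
          gcongr
      _ = X₁ := by rw [hX₁]; ring
  have hαX₁ : ∀ {z : ℤ}, |z| ≤ τ + 2 * m → |z| ≤ X₁ := fun h => by
    have : (τ + 2 * m : ℤ) ≤ (τ + 2 * m) * I := le_mul_of_one_le_right (by omega) (by omega)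
    omega
  have hX₁0 : 0 ≤ X₁ := (abs_nonneg _).trans (hσX 0)
  have hmI : (m : ℤ) * I ≤ (τ + 2 * m) * K ^ 2 := by
    have : (m : ℤ) * I ≤ (τ + 2 * m) * I := by gcongr; omega
    omega
  have hIm : (I : ℤ) ≤ m * I := le_mul_of_one_le_left (by omega) (by omega)
  have hM : (m + 3 : ℤ) * I = m * I + 3 * I := by ring
  have hX₁X : X₁ ≤ X := by omega
  have c1 : s₃.reg 1 = d := by rw [E₃.reg 1 (by decide), b1]
  have c2 : s₃.reg 2 = I := by rw [E₃.reg 2 (by decide), b2]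
  have c7 : s₃.reg 7 = 1 := by rw [E₃.reg 7 (by decide), b7]
  have inp₃ : s₃.inp = [] := by rw [E₃.inp rfl, inp₂]
  have out₃ : s₃.out = [] := by rw [E₃.out rfl, out₂]
  have arr4₃ : s₃.arr 4 = s₁.arr 4 := by rw [E₃.arr 4 (by decide), arr4₂]
  have zero₃ : ∀ x, 8 ≤ x → s₃.arr x = fun _ => 0 := fun x hx => by
    rw [E₃.arr x (fun h => by
      have : ∀ y ∈ hullPhase.outArr, y = 7 := by decide
      have := this x h
      omega), zero₂ x (by omega)]
  obtain ⟨s₄, R₄, d8, d43, d43', arr8, arr9, le8, le9⟩ :=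
    slopePhase_runs (X := X₁) hV1 hVW
      ((len_le_len (by omega) hX₁X).trans hXW) hYV hY (by omega) hd hn H hσX hpre
      c1 c2 c7 (by rw [arr4₃]; exact arr4) arr7
      (fun i => by rw [arr4₃]; exact hαX₁ (le4 i)) le7
      (fun i => by rw [zero₃ 8 le_rfl]; simpa) (fun i => by rw [zero₃ 9 (by norm_num)]; simpa)
      inp₃
  have E₄ := R₄.sameExcept
  have d1 : s₄.reg 1 = d := by rw [E₄.reg 1 (by decide), c1]
  have d7 : s₄.reg 7 = 1 := by rw [E₄.reg 7 (by decide), c7]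
  have d5 : s₄.reg 5 = (m + 3) * I := by rw [E₄.reg 5 (by decide), E₃.reg 5 (by decide), b5]
  have inp₄ : s₄.inp = [] := by rw [E₄.inp rfl, inp₃]
  have zero₄ : ∀ x, 10 ≤ x → s₄.arr x = fun _ => 0 := fun x hx => by
    rw [E₄.arr x (fun h => by
      have : ∀ y ∈ slopePhase.outArr, y = 8 ∨ y = 9 := by decide
      have := this x h
      omega), zero₃ x (by omega)]
  have hM0 : (0 : ℤ) < (m + 3) * I := by omega
  obtain ⟨s₅, R₅, le10, arr10⟩ :=
    entryPhase_runs (X := X) hV1 hVW hXW (hV ▸ len_le_len (by omega) (by omega)) spec.bd hd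
      spec.sorted hM0 (fun j p h1 h2 h3 => by
        have e1 := abs_le.1 (hpre j h3)
        have e2 := abs_le.1 (hpre p (by omega))
        rw [abs_le]
        omega) (by omega) d1 d5 d7 d8 arr8 arr9 (fun i => (le8 i).trans hX₁X)
      (fun i => (le9 i).trans hX₁X) (fun i => by rw [zero₄ 10 le_rfl]; simpa) inp₄
  have E₅ := R₅.sameExcept
  have h5 : ∀ x, x = 1 ∨ x = 5 ∨ x = 6 ∨ x = 7 ∨ x = 8 ∨ x = 43 → s₅.reg x = s₄.reg x := by
    rintro x (rfl | rfl | rfl | rfl | rfl | rfl) <;> exact E₅.reg _ (by decide)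
  have a5 : ∀ x, x ≠ 10 → s₅.arr x = s₄.arr x := fun x hx => E₅.arr x (fun h => by
    have : ∀ y ∈ entryPhase.outArr, y = 10 := by decide
    exact hx (this x h))
  have inp₅ : s₅.inp = [] := by rw [E₅.inp rfl, inp₄]
  have hdI : (128 * d : ℤ) < I := by exact_mod_cast hI
  obtain ⟨s₆, N, T, Lo, Up, R₆, D⟩ :=
    sweepPhase_runs (X := X) (M := (m + 3) * I) (c := m * I - 8 * d) (sl := s₄.reg 43) hV1 hVW
      hXW hYV hY spec.bd hd spec.sorted hM0
      (by omega) (by omega) d43' (by omega) (by rw [h5 1 (by simp), d1])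
      (by rw [h5 5 (by simp), d5])
      (by rw [h5 6 (by simp), E₄.reg 6 (by decide), E₃.reg 6 (by decide), b6])
      (by rw [h5 7 (by simp), d7]) (by rw [h5 8 (by simp), d8]) (h5 43 (by simp))
      (by rw [a5 8 (by norm_num)]; exact arr8) (by rw [a5 9 (by norm_num)]; exact arr9) arr10
      (by rw [a5 8 (by norm_num)]; exact fun i => (le8 i).trans hX₁X)
      (by rw [a5 9 (by norm_num)]; exact fun i => (le9 i).trans hX₁X) le10
      (fun i => by rw [a5 11 (by norm_num), zero₄ 11 (by norm_num)]; simpa)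
      (fun i => by rw [a5 12 (by norm_num), zero₄ 12 (by norm_num)]; simp)
      (fun i => by rw [a5 13 (by norm_num), zero₄ 13 (by norm_num)]; simp) inp₅
  have E₆ := R₆.sameExcept
  have e6 : s₆.arr 6 = s₂.arr 6 := by
    rw [E₆.arr 6 (by decide), a5 6 (by norm_num), E₄.arr 6 (by decide), E₃.arr 6 (by decide)]
  refine ⟨s₆, I, b, σ, N, T, Lo, Up, ?_, hper, spec, D, ?_, ?_, ?_, by rwa [e6], by rwa [e6],
    St.congr fun x hx => ?_, ?_, ?_⟩
  · refine (R₁.seq (R₂.seq (R₃.seq (R₄.seq (R₅.seq R₆))))).mono ?_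
    rw [ringsCost]
    simp only [add_mul]
    omega
  · rw [E₆.reg 2 (by decide), E₅.reg 2 (by decide), E₄.reg 2 (by decide), c2]
  · rw [E₆.reg 3 (by decide), E₅.reg 3 (by decide), E₄.reg 3 (by decide), E₃.reg 3 (by decide), b3]
  · rw [E₆.reg 7 (by decide), h5 7 (by simp), d7]
  · have hx' : ∀ x < 4, x ∉ sweepPhase.outArr ∧ x ∉ slopePhase.outArr ∧ x ∉ hullPhase.outArr ∧
        x ∉ tablePhase.outArr := by decide
    obtain ⟨h1, h2, h3, h4⟩ := hx' x hx
    rw [E₆.arr x h1, a5 x (by omega), E₄.arr x h2, E₃.arr x h3, E₂.arr x h4]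
  · rw [E₆.inp rfl, inp₅]
  · rw [E₆.out rfl, E₅.out rfl, E₄.out rfl, out₃]

/-! ### The pieces -/

/-- For `K = 2 ^ e` the division by `K ^ 2` is a shift of the exponent, so grid radii are exact
floating-point numbers. -/
def radFloat (K I e : ℕ) (t : ℤ) : Float2 := ⟨tab K (t % I).toNat, t / I - 2 * e⟩

theorem radFloat_val {e : ℕ} (I : ℕ) (t : ℤ) :
    (radFloat (2 ^ e) I e t).val = rad (2 ^ e) I t := by
  rw [Float2.val, radFloat, rad, zpow_sub₀ (by norm_num)]
  push_cast
  rw [← pow_mul, show (2 : ℝ) ^ (2 * (e : ℤ)) = 2 ^ (e * 2) by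
    rw [← zpow_natCast]; congr 1; push_cast; ring]
  ring

/-- The piece for the indices from `l` to `u` outside the grid point `t`, or outside `0` if `n = 0`. -/
def ringPiece (c : List CFloat) (K I e n : ℕ) (t : ℤ) (l u : ℕ) : Piece :=
  ⟨if n = 0 then ⟨0, 0⟩ else radFloat K I e t, l, u, (c.drop l).take (u + 1 - l)⟩

def ringPieces (c : List CFloat) (K I e : ℕ) (T : ℕ → ℤ) (Lo Up : ℕ → ℕ) (N : ℕ) : List Piece :=
  (List.range (N + 1)).map fun n => ringPiece c K I e n (T n) (Lo n) (Up n)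

/-- The rings cover the plane. -/
structure RingCover (b d : ℕ) (σ : ℕ → ℤ) (M c : ℤ) (T : ℕ → ℤ) (Lo Up : ℕ → ℕ) (N : ℕ) :
    Prop where
  sweep : Sweep b d σ M c T Lo Up N
  bd : b ≤ d
  lo_last : Lo N = d
  up_last : Up N = d
  below : ∀ j, b ≤ j → j < d → M ≤ gSum d σ j (T N)

section pieces
variable {b d K I e N n m : ℕ} {σ : ℕ → ℤ} {M ρ : ℤ} {T : ℕ → ℤ} {Lo Up : ℕ → ℕ} {c : List CFloat}

theorem length_ringPieces : (ringPieces c K I e T Lo Up N).length = N + 1 := by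
  simp [ringPieces]

theorem getElem_ringPieces (h : n < (ringPieces c K I e T Lo Up N).length) :
    (ringPieces c K I e T Lo Up N)[n] = ringPiece c K I e n (T n) (Lo n) (Up n) := by
  simp [ringPieces]

theorem RingCover.cases (h : RingCover b d σ M ρ T Lo Up N) (hn : n ≤ N) :
    (n = 0 ∧ Lo n = b ∧ Up n = b) ∨
      (1 ≤ n ∧ n < N ∧ RingStep b d σ M ρ (T n) (T (n + 1)) (Lo n) (Up n)) ∨
      (1 ≤ n ∧ n = N ∧ Lo n = d ∧ Up n = d) := by
  rcases Nat.eq_zero_or_pos n with rfl | h0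
  · exact Or.inl ⟨rfl, h.sweep.lo0, h.sweep.up0⟩
  · rcases hn.eq_or_lt with rfl | h1
    · exact Or.inr (Or.inr ⟨h0, rfl, h.lo_last, h.up_last⟩)
    · exact Or.inr (Or.inl ⟨h0, h1, h.sweep.step n h0 h1⟩)

theorem RingCover.le (h : RingCover b d σ M ρ T Lo Up N) (hn : n ≤ N) : Lo n ≤ Up n ∧ Up n ≤ d := by
  rcases h.cases hn with ⟨h1, h2, h3⟩ | ⟨h1, h2, h3⟩ | ⟨h1, h2, h3, h4⟩
  · exact ⟨by omega, h3 ▸ h.bd⟩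
  · exact ⟨h3.lu, h3.ud⟩
  · omega

theorem radius_ringPieces_zero : radius (ringPieces c K I e T Lo Up N) 0 = 0 := by
  rw [radius, dif_pos (by rw [length_ringPieces]; omega), getElem_ringPieces]
  simp [ringPiece, Float2.val]

theorem radius_ringPieces (hK : K = 2 ^ e) (h0 : 0 < n) (hn : n ≤ N) :
    radius (ringPieces c K I e T Lo Up N) n = ENNReal.ofReal (rad K I (T n)) := by
  subst hK
  rw [radius, dif_pos (by rw [length_ringPieces]; omega), getElem_ringPieces, ringPiece,
    if_neg h0.ne', radFloat_val]

theorem radius_ringPieces_last : radius (ringPieces c K I e T Lo Up N) (N + 1) = ⊤ := by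
  rw [radius, dif_neg (by rw [length_ringPieces]; omega)]

theorem RingCover.isRingPartition (h : RingCover b d σ M ρ T Lo Up N) (g : FineGrid d K I)
    (hK : K = 2 ^ e) : IsRingPartition d c (ringPieces c K I e T Lo Up N) := by
  have hmem : ∀ p ∈ ringPieces c K I e T Lo Up N, ∃ n ≤ N,
      p = ringPiece c K I e n (T n) (Lo n) (Up n) := fun p hp => by
    simp only [ringPieces, List.mem_map, List.mem_range] at hp
    obtain ⟨n, hn, rfl⟩ := hp
    exact ⟨n, by omega, rfl⟩
  refine ⟨fun p hp => ?_, radius_ringPieces_zero, fun n hn => ?_, fun p hp => ?_, fun p hp => ?_,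
    fun p hp => ?_⟩
  · obtain ⟨n, hn, rfl⟩ := hmem p hp
    unfold ringPiece
    split_ifs
    · simp [Float2.val]
    · subst hK
      rw [radFloat_val]
      exact (rad_pos g.one_le_K _).le
  · rw [length_ringPieces] at hn
    have hN := h.sweep.one_le
    rcases h.cases (Nat.lt_succ_iff.1 hn) with ⟨rfl, h2, h3⟩ | ⟨h1, h2, h3⟩ | ⟨h1, rfl, h3, h4⟩
    · rw [radius_ringPieces_zero, radius_ringPieces hK (by omega) (by omega), ENNReal.ofReal_pos]
      exact rad_pos g.one_le_K _
    · rw [radius_ringPieces hK h1 (by omega), radius_ringPieces hK (by omega) (by omega),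
        ENNReal.ofReal_lt_ofReal_iff (rad_pos g.one_le_K _)]
      exact rad_strictMono g.one_le_K g.period h3.lt
    · rw [radius_ringPieces_last, radius_ringPieces hK h1 le_rfl]
      exact ENNReal.ofReal_lt_top
  · obtain ⟨n, hn, rfl⟩ := hmem p hp
    exact (h.le hn).1
  · obtain ⟨n, hn, rfl⟩ := hmem p hp
    exact (h.le hn).2
  · obtain ⟨n, hn, rfl⟩ := hmem p hp
    have := (h.le hn).1
    simp only [ringPiece, Piece.delta]
    congr 1
    omega

theorem RingCover.radius_ratio (h : RingCover b d σ M (m * I - 8 * d) T Lo Up N)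
    (g : FineGrid d K I) (hK : K = 2 ^ e) (hm : 1 ≤ m) (hn : n ≤ N) (hlu : 1 ≤ Up n - Lo n) :
    (2 : ENNReal) ^ ((m : ℝ) / 2) * radius (ringPieces c K I e T Lo Up N) n ^ (Up n - Lo n)
        ≤ radius (ringPieces c K I e T Lo Up N) (n + 1) ^ (Up n - Lo n) ∧
      radius (ringPieces c K I e T Lo Up N) (n + 1) ^ (Up n - Lo n)
        ≤ (2 : ENNReal) ^ m * radius (ringPieces c K I e T Lo Up N) n ^ (Up n - Lo n) := by
  rcases h.cases hn with ⟨h1, h2, h3⟩ | ⟨h1, h2, h3⟩ | ⟨h1, h2, h3, h4⟩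
  · omega
  · rw [radius_ringPieces hK h1 (by omega), radius_ringPieces hK (by omega) (by omega),
      ← ENNReal.ofReal_pow (rad_pos g.one_le_K _).le,
      ← ENNReal.ofReal_pow (rad_pos g.one_le_K _).le,
      show (2 : ENNReal) = ENNReal.ofReal 2 by simp,
      ENNReal.ofReal_rpow_of_pos (by norm_num), ← ENNReal.ofReal_pow (by norm_num),
      ← ENNReal.ofReal_mul (by positivity), ← ENNReal.ofReal_mul (by positivity)]
    obtain ⟨r1, r2⟩ := g.rad_ratio hm h3 (by omega)
    exact ⟨ENNReal.ofReal_le_ofReal r1, ENNReal.ofReal_le_ofReal r2⟩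
  · omega

/-- Indices below the range are judged at the inner radius, those above it at the outer one. In the
first ring the lower ones have zero coefficients; in the last there are no higher ones. -/
theorem RingCover.term_le {a : ℕ → ℤ} {nz : ℕ → Prop} {F : ℕ → ℝ} {x S : ℝ} {j : ℕ}
    (h : RingCover b d σ ((m + 3) * I) ρ T Lo Up N) (g : FineGrid d K I) (hK : K = 2 ^ e)
    (hs : SlopeSpec b d a nz I σ) (hF : LogSpec d a nz F) (hx0 : 0 ≤ x)
    (hS : ∀ k ≤ d, F k * x ^ k ≤ S) (hS0 : 0 ≤ S) (hn : n ≤ N)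
    (h1 : radius (ringPieces c K I e T Lo Up N) n ≤ ENNReal.ofReal x)
    (h2 : ENNReal.ofReal x ≤ radius (ringPieces c K I e T Lo Up N) (n + 1)) (hjd : j ≤ d)
    (hj : j < Lo n ∨ Up n < j) : F j * x ^ j ≤ 2 ^ (-(m : ℤ)) * S := by
  have hN := h.sweep.one_le
  have hlow : 0 < n → rad K I (T n) ≤ x := fun h0 => by
    rw [radius_ringPieces hK h0 hn] at h1
    exact (ENNReal.ofReal_le_ofReal_iff hx0).1 h1
  have hup : n < N → x ≤ rad K I (T (n + 1)) := fun h0 => by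
    rw [radius_ringPieces hK (by omega) h0] at h2
    exact (ENNReal.ofReal_le_ofReal_iff (rad_pos g.one_le_K _).le).1 h2
  rcases h.cases hn with ⟨rfl, l1, l2⟩ | ⟨h3, h4, R⟩ | ⟨h3, rfl, l1, l2⟩
  · rw [l1, l2] at hj
    rcases hj with hj | hj
    · rw [hF.zero j hjd fun hz => by have := (hs.le j hjd hz).1; omega, zero_mul]
      positivity
    · exact term_le_of_hSum g hs hF hS hS0 hjd hj hx0 (hup (by omega)) (h.sweep.above0 j hj hjd)
  · rcases hj with hj | hj
    · exact term_le_of_gSum g hs hF hS hS0 hjd (hlow h3) fun hb => R.below j hb hj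
    · have := R.bl
      have := R.lu
      exact term_le_of_hSum g hs hF hS hS0 hjd (by omega) hx0 (hup h4) (R.above j hj hjd)
  · exact term_le_of_gSum g hs hF hS hS0 hjd (hlow h3) fun hb => h.below j hb (by omega)

theorem sum_ringPieces :
    ((ringPieces c K I e T Lo Up N).map fun p => p.delta + 1).sum =
      ∑ n ∈ Finset.range (N + 1), (Up n - Lo n + 1) := by
  rw [ringPieces, List.map_map]
  rfl

end pieces

theorem norm_eval_sub_slice_le {f : Polynomial ℂ} {d l u : ℕ} {z : ℂ} {ε : ℝ}
    (hf : f.natDegree = d) (hlu : l ≤ u) (hud : u ≤ d)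
    (h : ∀ j ≤ d, j < l ∨ u < j → ‖f.coeff j‖ * ‖z‖ ^ j ≤ ε) :
    ‖f.eval z - z ^ l * (slice f l u).eval z‖ ≤ ((d : ℝ) - (u - l : ℕ)) * ε := by
  have h1 : z ^ l * (slice f l u).eval z = ∑ j ∈ Finset.Icc l u, f.coeff j * z ^ j := by
    rw [slice, Polynomial.eval_finsetSum, Finset.mul_sum]
    refine Finset.sum_congr rfl fun j hj => ?_
    rw [Finset.mem_Icc] at hj
    obtain ⟨k, rfl⟩ := Nat.exists_eq_add_of_le hj.1
    simp [pow_add]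
    ring
  have hsub : Finset.Icc l u ⊆ Finset.range (d + 1) := fun j hj => by
    rw [Finset.mem_Icc] at hj
    rw [Finset.mem_range]
    omega
  rw [h1, Polynomial.eval_eq_sum_range, hf, ← Finset.sum_sdiff hsub, add_sub_cancel_right]
  refine (norm_sum_le_of_le _ (f := fun j => f.coeff j * z ^ j) (n := fun _ => ε)
    fun j hj => ?_).trans ?_
  · rw [Finset.mem_sdiff, Finset.mem_range, Finset.mem_Icc] at hj
    rw [norm_mul, norm_pow]
    exact h j (by omega) (by omega)
  · rw [Finset.sum_const, Finset.card_sdiff_of_subset hsub, Finset.card_range, Nat.card_Icc,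
      nsmul_eq_mul, show d + 1 - (u + 1 - l) = d - (u - l) by omega, Nat.cast_sub (by omega)]

/-! ### The cost in terms of the input -/

theorem size_le_log {n : ℕ} (hn : 1 ≤ n) : (n.size : ℝ) ≤ 1 + 1.45 * Real.log n := by
  have h0 : 0 < n.size := Nat.size_pos.2 hn
  obtain ⟨k, hk⟩ : ∃ k, n.size = k + 1 := ⟨_, (Nat.sub_add_cancel h0).symm⟩
  have h1 : 2 ^ k ≤ n := Nat.lt_size.1 (by omega)
  have h2 : (2 : ℝ) ^ k ≤ n := by exact_mod_cast h1
  have h3 := Real.log_le_log (by positivity) h2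
  rw [Real.log_pow] at h3
  have h4 := Real.log_two_gt_d9
  rw [hk]
  push_cast
  nlinarith [(Nat.cast_nonneg k : (0 : ℝ) ≤ k)]

theorem cost_bound {d m τ K V W : ℕ} {X : ℤ} (hd : 1 ≤ d) (hm : 1 ≤ m) (hτ : 1 ≤ τ)
    (hK : K = 2 ^ (d.size + 8)) (hV : V = len (4 * (K : ℤ) ^ 2))
    (hX : X = 12 * (τ + 2 * m) * K ^ 2) (hW : W = m + 1 + len X) :
    (d * (V * W) : ℝ) ≤ 726 * ((d : ℝ) * (m + Real.log τ)) *
      (1 + Real.log ((d : ℝ) * (m + Real.log τ))) ^ 2 := by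
  have hV' : V = 2 * d.size + 20 := by
    have : 4 * (K : ℤ) ^ 2 = ((2 ^ (2 * (d.size + 8) + 2) : ℕ) : ℤ) := by
      rw [hK]; push_cast; ring
    rw [hV, this, len, Int.natAbs_natCast, Nat.size_pow]
    omega
  have hW' : W ≤ 2 * m + τ.size + 2 * d.size + 28 := by
    have h1 : len X ≤ len 12 + len (τ + 2 * m) + len ((K : ℤ) ^ 2) := by
      rw [hX]
      exact (len_mul_le _ _).trans (Nat.add_le_add_right (len_mul_le _ _) _)
    have h2 : len 12 = 5 := by decide
    have h3 : len (τ + 2 * m) ≤ len τ + len (2 * m) := len_add_le _ _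
    have h4 : len (τ : ℤ) = τ.size + 1 := by simp [len]
    have h5 : len (2 * m : ℤ) ≤ m + 2 := by
      refine len_le_of_natAbs_lt (n := m + 1) ?_
      have : m < 2 ^ m := Nat.lt_two_pow_self
      rw [pow_succ]
      omega
    have h6 : len ((K : ℤ) ^ 2) = 2 * d.size + 18 := by
      have : (K : ℤ) ^ 2 = ((2 ^ (2 * (d.size + 8)) : ℕ) : ℤ) := by
        rw [hK]; push_cast; ring
      rw [this, len, Int.natAbs_natCast, Nat.size_pow]
      omega
    omega
  have hd' : (1 : ℝ) ≤ d := by exact_mod_cast hd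
  have hm' : (1 : ℝ) ≤ m := by exact_mod_cast hm
  have hτ' : (1 : ℝ) ≤ τ := by exact_mod_cast hτ
  have l1 := size_le_log hd
  have l2 := size_le_log hτ
  have n1 := Real.log_nonneg hd'
  have n2 := Real.log_nonneg hτ'
  set L := Real.log d
  set B := (m : ℝ) + Real.log τ with hB
  have hB1 : 1 ≤ B := by linarith
  -- The lengths `V` and `W` each bring one factor `1 + log d`, absorbed into the logarithm of the
  -- input size; this is the origin of the square.
  have hLB : L ≤ Real.log (d * B) :=
    Real.log_le_log (by linarith) (le_mul_of_one_le_right (by linarith) hB1)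
  have v1 : (V : ℝ) ≤ 22 * (1 + L) := by
    rw [hV']; push_cast; linarith
  have w1 : (W : ℝ) ≤ 33 * B * (1 + L) := by
    have : (W : ℝ) ≤ 2 * m + τ.size + 2 * d.size + 28 := by exact_mod_cast hW'
    nlinarith
  calc (d * (V * W) : ℝ) ≤ d * ((22 * (1 + L)) * (33 * B * (1 + L))) := by gcongr
    _ = 726 * (d * B) * (1 + L) ^ 2 := by ring
    _ ≤ _ := by gcongr

/-! ### The algorithm -/

def ringAlgorithm : Prog := .seq ringsPhase outputPhase

theorem coeff_facts {d : ℕ} {f : Polynomial ℂ} {c : List CFloat} (hd : 1 ≤ d)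
    (hf : f.natDegree = d) (hc : c.map CFloat.val = (List.range (d + 1)).map f.coeff) :
    c.length = d + 1 ∧ (∀ j ≤ d, (c.getD j zeroFloat).val = f.coeff j) ∧ coeffNonzero c d ∧
      LogSpec d (coeffLog c) (coeffNonzero c) fun j => ‖f.coeff j‖ := by
  have hlen : c.length = d + 1 := by simpa using congrArg List.length hc
  have hval : ∀ j ≤ d, (c.getD j zeroFloat).val = f.coeff j := fun j hj => by
    have hj' : j < c.length := by omega
    rw [List.getD_eq_getElem _ _ hj', ← List.getElem_map CFloat.val (h := by simpa using hj')]
    simp [hc]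
  refine ⟨hlen, hval, ?_, fun j hj h => ?_, fun j hj h => ?_, fun j hj h => ?_⟩
  · by_contra h
    have h1 := CFloat.val_eq_zero h
    rw [hval d le_rfl, ← hf, Polynomial.coeff_natDegree, Polynomial.leadingCoeff_eq_zero] at h1
    rw [h1, Polynomial.natDegree_zero] at hf
    omega
  · rw [← hval j hj]
    exact CFloat.le_norm h
  · rw [← hval j hj]
    exact CFloat.norm_le _
  · rw [← hval j hj, CFloat.val_eq_zero h, norm_zero]

theorem le_fHat (f : Polynomial ℂ) (x : ℝ) {k : ℕ} (hk : k ≤ f.natDegree) :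
    ‖f.coeff k‖ * x ^ k ≤ fHat f x :=
  Finset.le_sup' (fun j => ‖f.coeff j‖ * x ^ j) (Finset.mem_range.2 (Nat.lt_succ_of_le hk))

theorem fHat_nonneg (f : Polynomial ℂ) {x : ℝ} (hx : 0 ≤ x) : 0 ≤ fHat f x :=
  (mul_nonneg (norm_nonneg _) (pow_nonneg hx 0)).trans (le_fHat f x (Nat.zero_le _))

theorem ringAlgorithm_computes {d m τ K V W : ℕ} {c : List CFloat} {X : ℤ} (hd : 1 ≤ d)
    (hm : 1 ≤ m) (hc : c.length = d + 1) (hvalid : ∀ x ∈ c, x.Valid m τ)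
    (hlast : coeffNonzero c d) (hK : K = 2 ^ (d.size + 8)) (hV : V = len (4 * (K : ℤ) ^ 2))
    (hX : X = 12 * (τ + 2 * m) * K ^ 2) (hW : W = m + 1 + len X) :
    ∃ I b σ N T Lo Up t, FineGrid d K I ∧
      SlopeSpec b d (coeffLog c) (coeffNonzero c) I σ ∧
      RingCover b d σ ((m + 3) * I) (m * I - 8 * d) T Lo Up N ∧
      ∑ n ∈ Finset.range (N + 1), (Up n - Lo n + 1) ≤ 65 * d + 1 ∧
      t ≤ (ringsCost + outputCost) * (d * (V * W)) ∧
      Computes ringAlgorithm (encodeInput m d c) t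
        (encodeOutput (ringPieces c K I (d.size + 8) T Lo Up N)) := by
  obtain ⟨s, I, b, σ, N, T, Lo, Up, R, hper, spec, D, r2, r3, r7, arr6, le6, St, inp, out⟩ :=
    ringsPhase_runs hd hm hc hvalid hlast hK hV hX hW
  obtain ⟨hK1, hK2⟩ := size_two_pow_bounds hd
  rw [← hK] at hK1 hK2
  have g : FineGrid d K I := ⟨hK1, hper⟩
  have hI := hper.pos g.one_le_K
  have hIK := hper.le_self
  have cover : RingCover b d σ ((m + 3) * I) (m * I - 8 * d) T Lo Up N :=
    ⟨D.sweep, spec.bd, D.lo_last, D.up_last, D.below⟩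
  have hKK : (K : ℤ) * 256 ≤ K ^ 2 := by
    have : (256 : ℤ) ≤ K := by omega
    nlinarith
  have heK : d.size + 8 < K := by rw [hK]; exact Nat.lt_two_pow_self
  have hV1 : 1 ≤ V := hV ▸ one_le_len _
  have hXW : len X ≤ W := by omega
  have hVW : V ≤ W := by
    refine le_trans ?_ hXW
    rw [hV, hX]
    have : (1 : ℤ) ≤ τ + 2 * m := by omega
    exact len_le_len (by nlinarith) (by nlinarith)
  have hP : ∀ (n : ℕ) (hn : n < (ringPieces c K I (d.size + 8) T Lo Up N).length),
      PieceData d c s n (ringPieces c K I (d.size + 8) T Lo Up N)[n] := fun n hn => by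
    rw [getElem_ringPieces]
    rw [length_ringPieces] at hn
    have hn' : n ≤ N := by omega
    obtain ⟨h1, h2⟩ := cover.le hn'
    refine ⟨rfl, h1, h2, D.arr12 n hn', D.arr13 n hn', fun h => if_pos h, fun h => ?_⟩
    rw [ringPiece, if_neg h.ne', radFloat, D.arr11 n hn', r2, r3]
    have e1 := Int.emod_nonneg (T n) (show (I : ℤ) ≠ 0 by omega)
    have e2 := Int.emod_lt_of_pos (T n) (show (0 : ℤ) < I by omega)
    rw [← arr6 _ ((Int.toNat_lt e1).2 e2), Int.toNat_of_nonneg e1]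
    push_cast
    rfl
  obtain ⟨s', R', hout⟩ := outputPhase_runs (Y := 4 * (K : ℤ) ^ 2) hV1 hVW hV.ge (by omega) hd St hc
    r7 (by rw [length_ringPieces, D.r64]; push_cast; rfl)
    (by rw [r2, abs_le]; constructor <;> omega) (by rw [r3, abs_le]; constructor <;> omega) le6
    (fun i => len_le_of_abs_le hXW (D.le11 i)) D.le12 D.le13 inp out hP
    (by rw [sum_ringPieces]; exact D.sum)
  obtain ⟨t, ht, e⟩ := R.seq R'
  exact ⟨I, b, σ, N, T, Lo, Up, t, g, spec, cover, D.sum, by rwa [add_mul], s', e, hout⟩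

end RingLemma

/-! ### The algorithm and its three properties -/

theorem lemma3p1 :
    ∃ (prog : RingLemma.Prog) (C k : ℕ),
      ∀ (d m τ : ℕ) (f : Polynomial ℂ) (c : List RingLemma.CFloat),
        1 ≤ d → 1 ≤ m → 1 ≤ τ →
        f.natDegree = d →
        c.map RingLemma.CFloat.val = (List.range (d + 1)).map f.coeff →
        (∀ x ∈ c, x.Valid m τ) →
        ∃ (P : List RingLemma.Piece) (t : ℕ),
          -- the rings and the polynomials are computed in the claimed number of bit operations
          RingLemma.Computes prog (RingLemma.encodeInput m d c) t (RingLemma.encodeOutput P) ∧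
          (t : ℝ) ≤ C * ((d : ℝ) * (m + Real.log τ)) *
            (1 + Real.log ((d : ℝ) * (m + Real.log τ))) ^ k ∧
          RingLemma.IsRingPartition d c P ∧
          -- (i)
          (∀ (n : ℕ) (hn : n < P.length), 1 ≤ P[n].delta →
            (2 : ENNReal) ^ ((m : ℝ) / 2) * RingLemma.radius P n ^ P[n].delta
                ≤ RingLemma.radius P (n + 1) ^ P[n].delta ∧
              RingLemma.radius P (n + 1) ^ P[n].delta
                ≤ (2 : ENNReal) ^ m * RingLemma.radius P n ^ P[n].delta) ∧
          -- (ii)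
          (P.map (fun p => p.delta + 1)).sum ≤ 65 * d + 1 ∧
          -- (iii)
          (∀ (n : ℕ) (hn : n < P.length) (z : ℂ),
            RingLemma.radius P n ≤ ENNReal.ofReal ‖z‖ →
            ENNReal.ofReal ‖z‖ ≤ RingLemma.radius P (n + 1) →
            ‖f.eval z - z ^ P[n].lower *
                (RingLemma.slice f P[n].lower P[n].upper).eval z‖
              ≤ ((d : ℝ) - P[n].delta) * (2 : ℝ) ^ (-(m : ℤ)) * RingLemma.fHat f ‖z‖) := by
  -- The machine cost is a constant times `d * V * W`; `726 = 22 * 33` and the exponent `2` come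
  -- from `RingLemma.cost_bound`.
  refine ⟨RingLemma.ringAlgorithm, (RingLemma.ringsCost + RingLemma.outputCost) * 726, 2,
    fun d m τ f c hd hm hτ hf hc hvalid => ?_⟩
  obtain ⟨hlen, hval, hlast, hlog⟩ := RingLemma.coeff_facts hd hf hc
  obtain ⟨I, b, σ, N, T, Lo, Up, t, g, spec, cover, hsum, ht, hcomp⟩ :=
    RingLemma.ringAlgorithm_computes hd hm hlen hvalid hlast rfl rfl rfl rfl
  refine ⟨_, t, hcomp, ?_, cover.isRingPartition g rfl, fun n hn hδ => ?_, ?_,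
    fun n hn z h1 h2 => ?_⟩
  · calc (t : ℝ) ≤ ((RingLemma.ringsCost + RingLemma.outputCost : ℕ) : ℝ) * (d * (_ * _)) := by
          exact_mod_cast ht
      _ ≤ ((RingLemma.ringsCost + RingLemma.outputCost : ℕ) : ℝ) * _ :=
          mul_le_mul_of_nonneg_left (RingLemma.cost_bound hd hm hτ rfl rfl rfl rfl)
            (Nat.cast_nonneg _)
      _ = _ := by push_cast; ring
  · rw [RingLemma.length_ringPieces] at hn
    rw [RingLemma.getElem_ringPieces] at hδ ⊢
    exact cover.radius_ratio g rfl hm (Nat.lt_succ_iff.1 hn) hδ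
  · rw [RingLemma.sum_ringPieces]
    exact hsum
  · rw [RingLemma.length_ringPieces] at hn
    rw [RingLemma.getElem_ringPieces]
    obtain ⟨hlu, hud⟩ := cover.le (Nat.lt_succ_iff.1 hn)
    rw [mul_assoc]
    exact RingLemma.norm_eval_sub_slice_le hf hlu hud fun j hjd hj =>
      cover.term_le g rfl spec hlog (norm_nonneg z)
        (fun k hk => RingLemma.le_fHat f _ (hf ▸ hk)) (RingLemma.fHat_nonneg f (norm_nonneg z))
        (Nat.lt_succ_iff.1 hn) h1 h2 hjd hj
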